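/- All manifolds and maps are of class $C^\infty$ and finite-dimensional, and all morphisms are over the identity of the base. Let $Y\to M$ and $Z\to M$ be fibered manifolds (surjective submersions), let $k,r,s\ge 0$ be integers with $s\le r$, and let $J^rY\to M$ denote the $r$-th jet prolongation of $Y$ and $V$ the vertical tangent bundle. Notation. Let $\varkappa_s: VJ^sY\to J^sVY$ be the canonical identification $\frac{d}{dt}\big|_0 j^s_x\sigma_t\mapsto j^s_x\big(y\mapsto \frac{d}{dt}\big|_0\sigma_t(y)\big)$. For a morphism $\chi:J^rY\to Z$ let $J^k_{\mathrm{hol}}\chi:J^{k+r}Y\to J^kZ$ be the composition of the canonical inclusion $J^{k+r}Y\subset J^kJ^rY$, $j^{k+r}_x\sigma\mapsto j^k_x(j^r\sigma)$, with $J^k\chi: j^k_xS\mapsto j^k_x(\chi\circ S)$. Similarly, for a morphism $\psi:J^rY\times_{J^sY}J^sVY\to Z$ let $J^k_{\mathrm{hol}}\psi:J^{k+r}Y\times_{J^{k+s}Y}J^{k+s}VY\to J^kZ$ be the composition of the canonical inclusions into $J^kJ^rY\times_{J^kJ^sY}J^kJ^sVY$ with $J^k\psi:(j^k_xS,j^k_x\Sigma)\mapsto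 j^k_x(\psi(S,\Sigma))$ (where $S,\Sigma$ have the same projection to $J^sY$). For a morphism $\varphi:J^rY\times_{J^sY}VJ^sY\to Z$ put $$\mathcal J^k_{\mathrm{hol}}\varphi:=J^k_{\mathrm{hol}}\big(\varphi\circ(\mathrm{id}_{J^rY}\times_{J^sY}\varkappa_s^{-1})\big)\circ(\mathrm{id}_{J^{k+r}Y}\times_{J^{k+s}Y}\varkappa_{k+s}):J^{k+r}Y\times_{J^{k+s}Y}VJ^{k+s}Y\to J^kZ .$$ For a vertical vector field $\eta:Y\to VY$ with flow $\mathrm{Fl}_t$, its flow prolongation is $\mathcal J^s\eta:J^sY\to VJ^sY$, $\mathcal J^s\eta(j^s_x\sigma)=\frac{d}{dt}\big|_0 j^s_x(\mathrm{Fl}_t\circ\sigma)$. Write $\varphi(\mathcal J^s\eta):=\varphi\circ(\mathrm{id}_{J^rY}\times_{J^sY}\mathcal J^s\eta):J^rY\to Z$, and analogously $(\mathcal J^k_{\mathrm{hol}}\varphi)(\mathcal J^{k+s}\eta):J^{k+r}Y\to J^kZ$. Proposition 1.1. For every morphism $\varphi:J^rY\times_{J^sY}VJ^sY\to Z$ and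 every vertical vector field $\eta$ on $Y$, $$(\mathcal J^k_{\mathrm{hol}}\varphi)(\mathcal J^{k+s}\eta)=J^k_{\mathrm{hol}}\big(\varphi(\mathcal J^s\eta)\big)\quad\text{as maps } J^{k+r}Y\to J^kZ .$$ -/

import Mathlib

open scoped Manifold ContDiff Topology
open Set Filter Diffeology

noncomputable section

/-! # Smooth spaces

All spaces below carry a diffeology (Mathlib's `DiffeologicalSpace`): a smooth structure given by
declaring which maps `ℝⁿ → X` are smooth.  Manifolds carry their standard diffeology, fibre products
the one induced from the product, jet spaces and vertical bundles the one of their standard manifold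
structure.  Between finite-dimensional manifolds, `DSmooth` is the same as `C^∞`. -/

/-- The Cartesian space `ℝⁿ`. -/
abbrev RSp (n : ℕ) := EuclideanSpace ℝ (Fin n)

/-- The standard diffeology of a manifold: the plots are the `C^∞` maps `ℝⁿ → M`. -/
@[reducible]
def manifoldDiffeology (E M : Type*) [NormedAddCommGroup E] [NormedSpace ℝ E]
    [TopologicalSpace M] [ChartedSpace E M] : DiffeologicalSpace M :=
  .ofCorePlotsOn {
    isPlotOn := fun {n u} _ p => ContMDiffOn 𝓘(ℝ, RSp n) 𝓘(ℝ, E) ∞ p u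
    isPlotOn_congr := fun _ _ _ h =>
      ⟨fun hp => hp.congr fun y hy => (h hy).symm, fun hp => hp.congr fun y hy => h hy⟩
    isPlot := fun {n} p => ContMDiff 𝓘(ℝ, RSp n) 𝓘(ℝ, E) ∞ p
    isPlotOn_univ := contMDiffOn_univ
    isPlot_const := fun _ => contMDiff_const
    isPlotOn_reparam := fun _ _ _ h hp hf => hp.comp hf.contMDiffOn h
    locality := fun _ _ h x hxu => by
      obtain ⟨v, hv, hxv, hv'⟩ := h x hxu
      exact ((hv' x hxv).contMDiffAt (hv.mem_nhds hxv)).contMDiffWithinAt }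

/-- The diffeology with plots the maps `p : ℝⁿ → X` whose germ at every point has the property `G`. -/
@[reducible]
def diffeologyOfGerms {X : Type*} (G : ∀ n : ℕ, (RSp n → X) → RSp n → Prop)
    (hconst : ∀ (n : ℕ) (x : X) (u : RSp n), G n (fun _ => x) u)
    (hcongr : ∀ (n : ℕ) (p q : RSp n → X) (u : RSp n), p =ᶠ[𝓝 u] q → G n p u → G n q u)
    (hcomp : ∀ (n m : ℕ) (p : RSp m → X) (f : RSp n → RSp m) (v : RSp n),
      (∃ U ∈ 𝓝 v, ContDiffOn ℝ ∞ f U) → G m p (f v) → G n (p ∘ f) v) :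
    DiffeologicalSpace X where
  plots n := {p | ∀ u, G n p u}
  constant_plots x := fun u => hconst _ x u
  plot_reparam hp hf := fun v => hcomp _ _ _ _ v ⟨univ, univ_mem, hf.contDiffOn⟩ (hp _)
  locality {n p} h := by
    intro x
    obtain ⟨u, hu, hxu, hu'⟩ := h x
    obtain ⟨ε, hε, hε'⟩ := Metric.isOpen_iff.mp hu x hxu
    set b := OpenPartialHomeomorph.univBall x ε with hb
    have hsrc : b.source = univ := OpenPartialHomeomorph.univBall_source x ε
    have htgt : b.target = Metric.ball x ε := OpenPartialHomeomorph.univBall_target x hε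
    have h1 : ∀ u, G n (p ∘ b) u := hu' (f := b)
      (fun y => hε' (htgt ▸ b.map_source (hsrc ▸ mem_univ y)))
      OpenPartialHomeomorph.contDiff_univBall
    have h2 := hcomp n n (p ∘ b) b.symm x
      ⟨Metric.ball x ε, Metric.ball_mem_nhds x hε,
        OpenPartialHomeomorph.contDiffOn_univBall_symm⟩ (h1 _)
    refine hcongr n _ _ x ?_ h2
    filter_upwards [Metric.ball_mem_nhds x hε] with y hy
    simp [b.right_inv (htgt ▸ hy)]

/-- The fibre product, as a smooth subspace of the product. -/
instance pullbackDiffeology {A B C : Type*} [DiffeologicalSpace A] [DiffeologicalSpace C]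
    (f : A → B) (g : C → B) : DiffeologicalSpace (f.Pullback g) where
  plots _ := {p | IsPlot (fun u => (p u).1.1) ∧ IsPlot (fun u => (p u).1.2)}
  constant_plots _ := ⟨isPlot_const, isPlot_const⟩
  plot_reparam hp hf := ⟨isPlot_reparam hp.1 hf, isPlot_reparam hp.2 hf⟩
  locality h := by
    refine ⟨DiffeologicalSpace.locality fun x => ?_, DiffeologicalSpace.locality fun x => ?_⟩
    · obtain ⟨u, hu, hxu, hu'⟩ := h x
      exact ⟨u, hu, hxu, fun hf hf' => (hu' hf hf').1⟩
    · obtain ⟨u, hu, hxu, hu'⟩ := h x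
      exact ⟨u, hu, hxu, fun hf hf' => (hu' hf hf').2⟩

/-- A map `f` from a manifold to a smooth space is smooth on some neighbourhood of `a`. -/
def SmoothNear {E H A P : Type*} [NormedAddCommGroup E] [NormedSpace ℝ E] [TopologicalSpace H]
    (I : ModelWithCorners ℝ E H) [TopologicalSpace A] [ChartedSpace H A] [DiffeologicalSpace P]
    (f : A → P) (a : A) : Prop :=
  ∃ U ∈ 𝓝 a, ∀ (n : ℕ) (q : RSp n → A), ContMDiff 𝓘(ℝ, RSp n) I ∞ q → (∀ u, q u ∈ U) →
    IsPlot (f ∘ q)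

section SmoothNear

variable {E H A E' H' B P Q : Type*} [NormedAddCommGroup E] [NormedSpace ℝ E] [TopologicalSpace H]
  {I : ModelWithCorners ℝ E H} [TopologicalSpace A] [ChartedSpace H A]
  [NormedAddCommGroup E'] [NormedSpace ℝ E'] [TopologicalSpace H']
  {J : ModelWithCorners ℝ E' H'} [TopologicalSpace B] [ChartedSpace H' B]
  [DiffeologicalSpace P] [DiffeologicalSpace Q]

lemma SmoothNear.comp_of_mem {f : A → P} {g : B → A} {b : B} {W : Set B}
    (hf : SmoothNear I f (g b)) (hW : W ∈ 𝓝 b) (hg : ContMDiffOn J I ∞ g W) :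
    SmoothNear J (f ∘ g) b := by
  obtain ⟨U, hU, h⟩ := hf
  have hc : ContinuousAt g b := (hg.continuousOn).continuousAt hW
  refine ⟨W ∩ g ⁻¹' U, inter_mem hW (hc hU), fun n q hq hqU => ?_⟩
  exact h n (g ∘ q) (hg.comp_contMDiff hq fun u => (hqU u).1) fun u => (hqU u).2

lemma SmoothNear.comp {f : A → P} {g : B → A} {b : B}
    (hf : SmoothNear I f (g b)) (hg : ContMDiff J I ∞ g) : SmoothNear J (f ∘ g) b :=
  hf.comp_of_mem univ_mem hg.contMDiffOn

lemma SmoothNear.dSmooth_comp {f : A → P} {a : A} {g : P → Q} (hg : DSmooth g)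
    (hf : SmoothNear I f a) : SmoothNear I (g ∘ f) a := by
  obtain ⟨U, hU, h⟩ := hf
  exact ⟨U, hU, fun n q hq hqU => hg n _ (h n q hq hqU)⟩

lemma smoothNear_const (p : P) (a : A) : SmoothNear I (fun _ : A => p) a :=
  ⟨univ, univ_mem, fun _ _ _ _ => isPlot_const⟩

lemma SmoothNear.eventually {f : A → P} {a : A} (hf : SmoothNear I f a) :
    ∀ᶠ b in 𝓝 a, SmoothNear I f b := by
  obtain ⟨U, hU, h⟩ := hf
  filter_upwards [eventually_mem_nhds_iff.2 hU] with b hb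
  exact ⟨U, hb, h⟩

end SmoothNear

/-! # Jets of sections -/

section Jets

variable (E : Type*) [NormedAddCommGroup E] [NormedSpace ℝ E]
  {M : Type*} [TopologicalSpace M] [ChartedSpace E M] {P : Type*} [DiffeologicalSpace P]

/-- `s` is, on some neighbourhood of `x`, a smooth section of `π : P → M` (the values of `s`
elsewhere are irrelevant). -/
def IsLocalSection (π : P → M) (s : M → P) (x : M) : Prop :=
  SmoothNear 𝓘(ℝ, E) s x ∧ ∀ᶠ y in 𝓝 x, π (s y) = y

/-- A local smooth section of `π : P → M` defined near a point. -/
structure LocalSection (π : P → M) where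
  pt : M
  toFun : M → P
  isLocalSection : IsLocalSection E π toFun pt

/-- Contact of order `k`: `s` and `s'` have the same value at `x`, and for every curve `c` in `M`
through `x`, the curves `s ∘ c` and `s' ∘ c` have contact of order `k`, i.e. every smooth function
on `P` has the same derivatives up to order `k` along both of them. -/
def jetSetoid (k : ℕ) (π : P → M) : Setoid (LocalSection E π) where
  r a b := a.pt = b.pt ∧ a.toFun a.pt = b.toFun b.pt ∧
    ∀ f : P → ℝ, DSmooth f → ∀ c : ℝ → M, ContMDiff 𝓘(ℝ, ℝ) 𝓘(ℝ, E) ∞ c → c 0 = a.pt →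
      ∀ i ≤ k, iteratedDeriv i (fun t => f (a.toFun (c t))) 0 =
        iteratedDeriv i (fun t => f (b.toFun (c t))) 0
  iseqv :=
    { refl := fun _ => ⟨rfl, rfl, fun _ _ _ _ _ _ _ => rfl⟩
      symm := fun h => ⟨h.1.symm, h.2.1.symm, fun f hf c hc h0 i hi =>
        (h.2.2 f hf c hc (h0.trans h.1.symm) i hi).symm⟩
      trans := fun h h' => ⟨h.1.trans h'.1, h.2.1.trans h'.2.1, fun f hf c hc h0 i hi =>
        (h.2.2 f hf c hc h0 i hi).trans (h'.2.2 f hf c hc (h0.trans h.1) i hi)⟩ }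

/-- The `k`-th jet prolongation `J^k P` of `π : P → M`: the `k`-jets of local sections. -/
def Jet (k : ℕ) (π : P → M) := Quotient (jetSetoid E k π)

variable {E} in
/-- The `k`-jet of a local section at its base point. -/
def LocalSection.jet {π : P → M} (a : LocalSection E π) (k : ℕ) : Jet E k π :=
  Quotient.mk (jetSetoid E k π) a

/-- `j = j^k_x s`. -/
def HasJet (k : ℕ) (π : P → M) (s : M → P) (x : M) (j : Jet E k π) : Prop :=
  ∃ h : IsLocalSection E π s x, j = LocalSection.jet ⟨x, s, h⟩ k

variable {E}

/-- The projection `J^k P → M`, `j^k_x s ↦ x`. -/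
def Jet.base {k : ℕ} {π : P → M} : Jet E k π → M :=
  Quotient.lift LocalSection.pt fun _ _ h => h.1

/-- The projection `J^k P → J^l P` for `l ≤ k`, `j^k_x s ↦ j^l_x s`. -/
def Jet.res {k l : ℕ} (h : l ≤ k) {π : P → M} : Jet E k π → Jet E l π :=
  Quotient.map' id fun _ _ hab =>
    ⟨hab.1, hab.2.1, fun f hf c hc h0 i hi => hab.2.2 f hf c hc h0 i (hi.trans h)⟩

lemma HasJet.base_eq {k : ℕ} {π : P → M} {s : M → P} {x : M} {j : Jet E k π}
    (h : HasJet E k π s x j) : j.base = x := by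
  obtain ⟨_, rfl⟩ := h
  rfl

lemma exists_hasJet {k : ℕ} {π : P → M} (j : Jet E k π) :
    ∃ s x, HasJet E k π s x j := by
  induction j using Quotient.inductionOn with
  | h a => exact ⟨a.toFun, a.pt, a.isLocalSection, rfl⟩

/-- The smooth structure of `J^k P`: the smooth maps `ℝⁿ → J^k P` are, locally, the maps
`u ↦ j^k_{x(u)} s(u, ·)` with `x` and `(u, y) ↦ s(u, y)` smooth. -/
instance jetDiffeology {k : ℕ} {π : P → M} : DiffeologicalSpace (Jet E k π) :=
  diffeologyOfGerms
    (fun n p u₀ => ∃ (x : RSp n → M) (s : RSp n → M → P),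
      (∃ U ∈ 𝓝 u₀, ContMDiffOn 𝓘(ℝ, RSp n) 𝓘(ℝ, E) ∞ x U) ∧
      SmoothNear (𝓘(ℝ, RSp n).prod 𝓘(ℝ, E)) (fun z : RSp n × M => s z.1 z.2) (u₀, x u₀) ∧
      ∀ᶠ u in 𝓝 u₀, HasJet E k π (s u) (x u) (p u))
    (fun n j u => by
      obtain ⟨s, x, h⟩ := exists_hasJet j
      exact ⟨fun _ => x, fun _ => s, ⟨univ, univ_mem, contMDiffOn_const⟩,
        SmoothNear.comp (g := Prod.snd) h.1.1 contMDiff_snd, .of_forall fun _ => h⟩)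
    (fun n p q u hpq => by
      rintro ⟨x, s, hx, hs, h⟩
      refine ⟨x, s, hx, hs, ?_⟩
      filter_upwards [h, hpq] with v hv hpv
      rwa [← hpv])
    (fun n m p f v => by
      rintro ⟨W, hW, hf⟩ ⟨x, s, ⟨U, hU, hx⟩, hs, h⟩
      have hc : ContinuousAt f v := hf.continuousOn.continuousAt hW
      refine ⟨x ∘ f, fun u => s (f u), ⟨W ∩ f ⁻¹' U, inter_mem hW (hc hU), ?_⟩, ?_, hc.eventually h⟩
      · exact hx.comp (hf.contMDiffOn.mono inter_subset_left) fun y hy => hy.2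
      · refine SmoothNear.comp_of_mem (f := fun z : RSp m × M => s z.1 z.2)
          (g := fun z : RSp n × M => (f z.1, z.2)) (b := (v, x (f v))) (W := W ×ˢ univ) hs
          (prod_mem_nhds hW univ_mem) ?_
        exact (hf.contMDiffOn.comp contMDiffOn_fst fun z hz => hz.1).prodMk contMDiffOn_snd)

open Classical in
/-- The prolongation `j^r σ : y ↦ j^r_y σ` of a local section (with a dummy value at the points
around which `σ` is not a section). -/
def jetSection (r : ℕ) {π : P → M} (σ : LocalSection E π) (y : M) : Jet E r π :=
  if h : IsLocalSection E π σ.toFun y then LocalSection.jet ⟨y, σ.toFun, h⟩ r else σ.jet r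

lemma IsLocalSection.eventually {π : P → M} {s : M → P} {x : M} (h : IsLocalSection E π s x) :
    ∀ᶠ y in 𝓝 x, IsLocalSection E π s y := by
  filter_upwards [h.1.eventually, h.2.eventually_nhds] with y h1 h2 using ⟨h1, h2⟩

lemma hasJet_jetSection (r : ℕ) {π : P → M} (σ : LocalSection E π) {y : M}
    (h : IsLocalSection E π σ.toFun y) : HasJet E r π σ.toFun y (jetSection r σ y) :=
  ⟨h, by rw [jetSection, dif_pos h]⟩

lemma isLocalSection_jetSection (r : ℕ) {π : P → M} (σ : LocalSection E π) :
    IsLocalSection E (Jet.base (k := r)) (jetSection r σ) σ.pt := by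
  have hev := σ.isLocalSection.eventually
  constructor
  · refine ⟨_, hev, fun n q hq hqU u₀ => ?_⟩
    refine ⟨q, fun _ => σ.toFun, ⟨univ, univ_mem, hq.contMDiffOn⟩,
      SmoothNear.comp (g := Prod.snd) (hqU u₀).1 contMDiff_snd,
      .of_forall fun u => hasJet_jetSection r σ (hqU u)⟩
  · filter_upwards [hev] with y hy using (hasJet_jetSection r σ hy).base_eq

/-- The canonical inclusion `J^{k+r} P → J^k J^r P`, `j^{k+r}_x σ ↦ j^k_x (j^r σ)` (the result does
not depend on the representative `σ`). -/
def jetIncl (k r : ℕ) {π : P → M} (j : Jet E (k + r) π) :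
    Jet E k (Jet.base : Jet E r π → M) :=
  LocalSection.jet ⟨_, _, isLocalSection_jetSection r (Quotient.out j)⟩ k

end Jets

/-! # Vertical tangent bundles -/

section Vertical

variable {M P : Type*} [DiffeologicalSpace P]

/-- `γ` is, near `0`, a smooth curve in one fibre of `π`. -/
def IsVerticalCurve (π : P → M) (γ : ℝ → P) : Prop :=
  SmoothNear 𝓘(ℝ, ℝ) γ 0 ∧ ∀ᶠ t in 𝓝 (0 : ℝ), π (γ t) = π (γ 0)

/-- A smooth curve in a fibre of `π`, defined near `0`. -/
structure VerticalCurve (π : P → M) where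
  toFun : ℝ → P
  isVerticalCurve : IsVerticalCurve π toFun

/-- Two curves are equivalent if they have the same initial point and the same velocity there, i.e.
every smooth function on `P` has the same derivative along both of them. -/
def verticalSetoid (π : P → M) : Setoid (VerticalCurve π) where
  r a b := a.toFun 0 = b.toFun 0 ∧ ∀ f : P → ℝ, DSmooth f →
    deriv (fun t => f (a.toFun t)) 0 = deriv (fun t => f (b.toFun t)) 0
  iseqv :=
    { refl := fun _ => ⟨rfl, fun _ _ => rfl⟩
      symm := fun h => ⟨h.1.symm, fun f hf => (h.2 f hf).symm⟩
      trans := fun h h' => ⟨h.1.trans h'.1, fun f hf => (h.2 f hf).trans (h'.2 f hf)⟩ }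

/-- The vertical tangent bundle `V P` of `π : P → M`: the velocities of curves in the fibres. -/
def VBundle (π : P → M) := Quotient (verticalSetoid π)

/-- The velocity at `0` of a curve in a fibre. -/
def VerticalCurve.velocity {π : P → M} (c : VerticalCurve π) : VBundle π :=
  Quotient.mk (verticalSetoid π) c

/-- `v` is the velocity `d/dt|₀ γ(t)`. -/
def HasVelocity (π : P → M) (γ : ℝ → P) (v : VBundle π) : Prop :=
  ∃ h : IsVerticalCurve π γ, v = VerticalCurve.velocity ⟨γ, h⟩

/-- The projection `V P → P`. -/
def VBundle.pt {π : P → M} : VBundle π → P :=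
  Quotient.lift (fun c : VerticalCurve π => c.toFun 0) fun _ _ h => h.1

lemma exists_hasVelocity {π : P → M} (v : VBundle π) : ∃ γ, HasVelocity π γ v := by
  induction v using Quotient.inductionOn with
  | h a => exact ⟨a.toFun, a.isVerticalCurve, rfl⟩

/-- The smooth structure of `V P`: the smooth maps `ℝⁿ → V P` are, locally, the maps
`u ↦ d/dt|₀ γ(u, t)` with `(u, t) ↦ γ(u, t)` smooth. -/
instance verticalDiffeology {π : P → M} : DiffeologicalSpace (VBundle π) :=
  diffeologyOfGerms
    (fun n p u₀ => ∃ γ : RSp n → ℝ → P,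
      SmoothNear (𝓘(ℝ, RSp n).prod 𝓘(ℝ, ℝ)) (fun z : RSp n × ℝ => γ z.1 z.2) (u₀, 0) ∧
      ∀ᶠ u in 𝓝 u₀, HasVelocity π (γ u) (p u))
    (fun n v u => by
      obtain ⟨γ, h⟩ := exists_hasVelocity v
      exact ⟨fun _ => γ, SmoothNear.comp (g := Prod.snd) h.1.1 contMDiff_snd, .of_forall fun _ => h⟩)
    (fun n p q u hpq => by
      rintro ⟨γ, hγ, h⟩
      refine ⟨γ, hγ, ?_⟩
      filter_upwards [h, hpq] with v hv hpv
      rwa [← hpv])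
    (fun n m p f v => by
      rintro ⟨W, hW, hf⟩ ⟨γ, hγ, h⟩
      have hc : ContinuousAt f v := hf.continuousOn.continuousAt hW
      refine ⟨fun u => γ (f u), ?_, hc.eventually h⟩
      refine SmoothNear.comp_of_mem (f := fun z : RSp m × ℝ => γ z.1 z.2)
        (g := fun z : RSp n × ℝ => (f z.1, z.2)) (b := (v, (0 : ℝ))) (W := W ×ˢ univ) hγ
        (prod_mem_nhds hW univ_mem) ?_
      exact (hf.contMDiffOn.comp contMDiffOn_fst fun z hz => hz.1).prodMk contMDiffOn_snd)

/-- The zero vertical vector at a point. -/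
def zeroVector (π : P → M) (p : P) : VBundle π :=
  VerticalCurve.velocity ⟨fun _ => p, smoothNear_const p _, .of_forall fun _ => rfl⟩

lemma zeroVector_pt (π : P → M) (p : P) : (zeroVector π p).pt = p := rfl

lemma dSmooth_zeroVector (π : P → M) : DSmooth (zeroVector π) := by
  intro n p hp u₀
  refine ⟨fun u _ => p u, ⟨univ, univ_mem, fun m q hq _ => ?_⟩, .of_forall fun u =>
    ⟨⟨smoothNear_const _ _, .of_forall fun _ => rfl⟩, rfl⟩⟩
  have h1 : ContMDiff 𝓘(ℝ, RSp m) 𝓘(ℝ, RSp n) ∞ (fun v => (q v).1) := contMDiff_fst.comp hq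
  exact isPlot_reparam hp h1.contDiff

instance (π : P → M) (p : P) : Nonempty {v : VBundle π // v.pt = p} := ⟨⟨zeroVector π p, rfl⟩⟩

end Vertical

/-! # Fibered manifolds -/

/-- A fibered manifold over `M`: a finite-dimensional smooth Hausdorff manifold with a surjective
submersion onto `M`. -/
structure FiberedManifold.{u, v, w, z} (E : Type u) (M : Type v) [NormedAddCommGroup E] [NormedSpace ℝ E]
    [TopologicalSpace M] [ChartedSpace E M] where
  Total : Type w
  Model : Type z
  [normedAddCommGroup : NormedAddCommGroup Model]
  [normedSpace : NormedSpace ℝ Model]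
  [finiteDimensional : FiniteDimensional ℝ Model]
  [topologicalSpace : TopologicalSpace Total]
  [t2Space : T2Space Total]
  [chartedSpace : ChartedSpace Model Total]
  [isManifold : IsManifold 𝓘(ℝ, Model) ∞ Total]
  proj : Total → M
  surjective : Function.Surjective proj
  isSubmersion : Manifold.IsSubmersion 𝓘(ℝ, Model) 𝓘(ℝ, E) ∞ proj

namespace FiberedManifold

attribute [instance] normedAddCommGroup normedSpace finiteDimensional topologicalSpace t2Space
  chartedSpace isManifold

variable {E M : Type*} [NormedAddCommGroup E] [NormedSpace ℝ E]
  [TopologicalSpace M] [ChartedSpace E M]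

instance (Y : FiberedManifold E M) : DiffeologicalSpace Y.Total :=
  manifoldDiffeology Y.Model Y.Total

/-- `J^k Y`. -/
abbrev J (Y : FiberedManifold E M) (k : ℕ) := Jet E k Y.proj

/-- `V Y`. -/
abbrev V (Y : FiberedManifold E M) := VBundle Y.proj

/-- The projection `V Y → M`. -/
abbrev projV (Y : FiberedManifold E M) : Y.V → M := fun v => Y.proj v.pt

/-- `V J^s Y`, the vertical tangent bundle of `J^s Y → M`. -/
abbrev VJ (Y : FiberedManifold E M) (s : ℕ) := VBundle (Jet.base : Y.J s → M)

/-- `J^s V Y`, the jet prolongation of `V Y → M`. -/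
abbrev JV (Y : FiberedManifold E M) (s : ℕ) := Jet E s Y.projV

lemma exists_isLocalSection (Y : FiberedManifold E M) (x : M) :
    ∃ s, IsLocalSection E Y.proj s x := by
  obtain ⟨y₀, rfl⟩ := Y.surjective x
  have h := (Y.isSubmersion.isSubmersionAt y₀).isSubmersionAtOfComplement_complement
  set φ := h.domChart with hφ
  set ψ := h.codChart with hψ
  have hy₀ : y₀ ∈ φ.source := h.mem_domChart_source
  have hx₀ : Y.proj y₀ ∈ ψ.source := h.mem_codChart_source
  have hwr : ∀ e ∈ φ.target, ψ (Y.proj (φ.symm e)) = (h.equiv e).1 := fun e he =>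
    h.writtenInCharts (by simpa using he)
  let g : M → Y.Model := fun x' => h.equiv.symm (ψ x', (h.equiv (φ y₀)).2)
  have hg₀ : g (Y.proj y₀) = φ y₀ := by
    have := hwr (φ y₀) (φ.map_source hy₀)
    rw [φ.left_inv hy₀] at this
    simp only [g, this, Prod.mk.eta, ContinuousLinearEquiv.symm_apply_apply]
  have hg : ContMDiffOn 𝓘(ℝ, E) 𝓘(ℝ, Y.Model) ∞ g ψ.source := by
    have h1 : ContMDiffOn 𝓘(ℝ, E) 𝓘(ℝ, E) ∞ ψ ψ.source :=
      contMDiffOn_of_mem_maximalAtlas h.codChart_mem_maximalAtlas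
    have h2 : ContDiff ℝ ∞ fun e : E => h.equiv.symm (e, (h.equiv (φ y₀)).2) := by fun_prop
    exact h2.contMDiff.comp_contMDiffOn h1
  have hφs : ContMDiffOn 𝓘(ℝ, Y.Model) 𝓘(ℝ, Y.Model) ∞ φ.symm φ.target :=
    contMDiffOn_symm_of_mem_maximalAtlas h.domChart_mem_maximalAtlas
  have hgc : ContinuousAt g (Y.proj y₀) :=
    hg.continuousOn.continuousAt (ψ.open_source.mem_nhds hx₀)
  have hW : ψ.source ∩ g ⁻¹' φ.target ∈ 𝓝 (Y.proj y₀) :=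
    inter_mem (ψ.open_source.mem_nhds hx₀)
      (hgc (φ.open_target.mem_nhds (hg₀ ▸ φ.map_source hy₀)))
  refine ⟨φ.symm ∘ g, ⟨_, hW, fun n q hq hqW => ?_⟩, ?_⟩
  · exact (hφs.comp (hg.mono inter_subset_left) fun z hz => hz.2).comp_contMDiff hq hqW
  · filter_upwards [hW] with x' hx'
    have hsrc : Y.proj (φ.symm (g x')) ∈ ψ.source :=
      h.source_subset_preimage_source (φ.map_target hx'.2)
    apply ψ.injOn hsrc hx'.1
    rw [hwr _ hx'.2]
    simp [g]

lemma nonempty_J (Y : FiberedManifold E M) (k : ℕ) (x : M) : Nonempty (Y.J k) := by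
  obtain ⟨s, hs⟩ := Y.exists_isLocalSection x
  exact ⟨LocalSection.jet ⟨x, s, hs⟩ k⟩

lemma nonempty_JV (Y : FiberedManifold E M) (s : ℕ) (x : M) : Nonempty (Y.JV s) := by
  obtain ⟨σ, hσ⟩ := Y.exists_isLocalSection x
  exact ⟨LocalSection.jet
    ⟨x, zeroVector Y.proj ∘ σ, hσ.1.dSmooth_comp (dSmooth_zeroVector _), hσ.2⟩ s⟩

end FiberedManifold

/-! # Prolongation of morphisms -/

section Prolongation

variable {E M : Type*} [NormedAddCommGroup E] [NormedSpace ℝ E]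
  [TopologicalSpace M] [ChartedSpace E M]

/-- The prolongation `J^k χ : J^k A → J^k N` of a morphism `χ : A → N` over `M`: the element
`J^k χ (j^k_x S) = j^k_x (χ ∘ S)`, which does not depend on the representative `S`. -/
def jetMap (k : ℕ) {A : Type*} [DiffeologicalSpace A] {πA : A → M} {N : FiberedManifold E M}
    (χ : A → N.Total) (a : Jet E k πA) : N.J k :=
  @Classical.epsilon _ (N.nonempty_J k a.base) fun c =>
    ∃ (x : M) (S : M → A), HasJet E k πA S x a ∧ HasJet E k N.proj (χ ∘ S) x c

/-- The prolongation `J^k ψ : J^k A ×_{J^k B} J^k C → J^k N` of a morphism `ψ : A ×_B C → N`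
over `M`: the element `J^k ψ (j^k_x S, j^k_x Σ) = j^k_x (ψ(S, Σ))`, where `S` and `Σ` have the same
projection to `B` near `x`; it does not depend on the choice of such `S` and `Σ`. -/
def jetMap₂ (k : ℕ) {A B C : Type*} [DiffeologicalSpace A] [DiffeologicalSpace C]
    {πA : A → M} {πC : C → M} {f : A → B} {g : C → B} {N : FiberedManifold E M}
    (ψ : f.Pullback g → N.Total) (a : Jet E k πA) (b : Jet E k πC) : N.J k :=
  @Classical.epsilon _ (N.nonempty_J k a.base) fun c =>
    ∃ (x : M) (S : M → A) (S' : M → C) (T : M → N.Total),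
      HasJet E k πA S x a ∧ HasJet E k πC S' x b ∧ HasJet E k N.proj T x c ∧
      ∀ᶠ y in 𝓝 x, ∃ h : f (S y) = g (S' y), T y = ψ ⟨(S y, S' y), h⟩

variable (Y : FiberedManifold E M)

/-- The projection `J^s V Y → J^s Y`, the prolongation of `V Y → Y`. -/
def projJV (s : ℕ) (w : Y.JV s) : Y.J s := jetMap s (N := Y) (VBundle.pt : Y.V → Y.Total) w

/-- The canonical identification `ϰ_s : V J^s Y → J^s V Y`,
`d/dt|₀ (j^s_x σ_t) ↦ j^s_x (y ↦ d/dt|₀ σ_t(y))`, for smooth families `σ_t` of sections. -/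
def kappa (s : ℕ) (v : Y.VJ s) : Y.JV s :=
  @Classical.epsilon _ (Y.nonempty_JV s v.pt.base) fun w =>
    ∃ (x : M) (σ : ℝ → M → Y.Total) (γ : ℝ → Y.J s) (ζ : M → Y.V),
      SmoothNear (𝓘(ℝ, ℝ).prod 𝓘(ℝ, E)) (fun z : ℝ × M => σ z.1 z.2) (0, x) ∧
      (∀ᶠ t in 𝓝 (0 : ℝ), HasJet E s Y.proj (σ t) x (γ t)) ∧
      HasVelocity Jet.base γ v ∧
      (∀ᶠ y in 𝓝 x, HasVelocity Y.proj (fun t => σ t y) (ζ y)) ∧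
      HasJet E s Y.projV ζ x w

/-- The inverse `ϰ_s⁻¹ : J^s V Y → V J^s Y` of `ϰ_s`, as a map over `J^s Y`. -/
def kappaInv (s : ℕ) (w : Y.JV s) : {v : Y.VJ s // v.pt = projJV Y s w} :=
  Classical.epsilon fun v => kappa Y s v.1 = w

/-! # Vertical vector fields and their flow prolongation -/

variable {Y}

/-- `Fl` is a local flow of `η` near `y₀`: it is smooth near `(0, y₀)`, `Fl_0 = id`, and
`d/dt Fl_t(y) = η(Fl_t(y))`. -/
def IsLocalFlow (η : Y.Total → Y.V) (Fl : ℝ → Y.Total → Y.Total) (y₀ : Y.Total) : Prop :=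
  SmoothNear (𝓘(ℝ, ℝ).prod 𝓘(ℝ, Y.Model)) (fun z : ℝ × Y.Total => Fl z.1 z.2) (0, y₀) ∧
  (∀ᶠ y in 𝓝 y₀, Fl 0 y = y) ∧
  ∀ᶠ z in 𝓝 ((0 : ℝ), y₀), HasVelocity Y.proj (fun h => Fl (z.1 + h) z.2) (η (Fl z.1 z.2))

/-- The flow prolongation `𝒥^s η : J^s Y → V J^s Y` of a vertical vector field:
`𝒥^s η (j^s_x σ) = d/dt|₀ j^s_x (Fl_t ∘ σ)` with `Fl` the flow of `η`. -/
def flowProlongation (s : ℕ) (η : Y.Total → Y.V) (j : Y.J s) : {v : Y.VJ s // v.pt = j} :=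
  Classical.epsilon fun v =>
    ∃ (x : M) (σ : M → Y.Total) (Fl : ℝ → Y.Total → Y.Total) (γ : ℝ → Y.J s),
      HasJet E s Y.proj σ x j ∧ IsLocalFlow η Fl (σ x) ∧
      (∀ᶠ t in 𝓝 (0 : ℝ), HasJet E s Y.proj (fun y => Fl t (σ y)) x (γ t)) ∧
      HasVelocity Jet.base γ v.1

/-! # Holonomic prolongation -/

/-- The fibre product `J^r Y ×_{J^s Y} V J^s Y`, for `s ≤ r`. -/
abbrev JVJ (Y : FiberedManifold E M) {r s : ℕ} (h : s ≤ r) :=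
  (Jet.res h : Y.J r → Y.J s).Pullback (VBundle.pt : Y.VJ s → Y.J s)

/-- The fibre product `J^r Y ×_{J^s Y} J^s V Y`, for `s ≤ r`. -/
abbrev JJV (Y : FiberedManifold E M) {r s : ℕ} (h : s ≤ r) :=
  (Jet.res h : Y.J r → Y.J s).Pullback (projJV Y s)

/-- `φ(X) = φ ∘ (id ×_{J^s Y} X) : J^r Y → B`, for a section `X` of `V J^s Y → J^s Y`. -/
def insertField {B : Type*} {r s : ℕ} {h : s ≤ r} (φ : JVJ Y h → B)
    (X : ∀ j : Y.J s, {v : Y.VJ s // v.pt = j}) (a : Y.J r) : B :=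
  φ ⟨(a, (X (a.res h)).1), (X (a.res h)).2.symm⟩

/-- `id ×_{J^s Y} ϰ_s⁻¹ : J^r Y ×_{J^s Y} J^s V Y → J^r Y ×_{J^s Y} V J^s Y`. -/
def idKappaInv {r s : ℕ} (h : s ≤ r) (p : JJV Y h) : JVJ Y h :=
  ⟨(p.1.1, (kappaInv Y s p.1.2).1), p.2.trans (kappaInv Y s p.1.2).2.symm⟩

variable {Z : FiberedManifold E M}

/-- `J^k_hol χ : J^{k+r} Y → J^k Z` for a morphism `χ : J^r Y → Z`. -/
def jetHol (k : ℕ) {r : ℕ} (χ : Y.J r → Z.Total) (a : Y.J (k + r)) : Z.J k :=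
  jetMap k χ (jetIncl k r a)

/-- `J^k_hol ψ` on `J^{k+r} Y ×_{J^{k+s} Y} J^{k+s} V Y`, for a morphism
`ψ : J^r Y ×_{J^s Y} J^s V Y → Z`. -/
def jetHol₂ (k : ℕ) {r s : ℕ} {h : s ≤ r} (ψ : JJV Y h → Z.Total)
    (a : Y.J (k + r)) (b : Y.JV (k + s)) : Z.J k :=
  jetMap₂ k ψ (jetIncl k r a) (jetIncl k s b)

/-- `𝒥^k_hol φ = J^k_hol (φ ∘ (id × ϰ_s⁻¹)) ∘ (id × ϰ_{k+s})`, a map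
`J^{k+r} Y ×_{J^{k+s} Y} V J^{k+s} Y → J^k Z`, for a morphism `φ : J^r Y ×_{J^s Y} V J^s Y → Z`. -/
def holProlongation (k : ℕ) {r s : ℕ} {h : s ≤ r} (φ : JVJ Y h → Z.Total)
    (p : JVJ Y (Nat.add_le_add_left h k)) : Z.J k :=
  jetHol₂ k (φ ∘ idKappaInv h) p.1.1 (kappa Y (k + s) p.1.2)

end Prolongation

end

/-!
Both sides of the identity are jets of one section of `Z`. Let `a = j^{k+r}_x σ`. The flow
prolongation of any order satisfies `ϰ_s(𝒥^s η (j^s_y σ)) = j^s_y (η ∘ σ)`, because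
`d/dt|₀ Fl_t(σ(y)) = η(σ(y))` (`kappaRel_flowProlongation`). Used in order `k + s`, this says that
`𝒥^k_hol φ` at `(a, 𝒥^{k+s} η (j^{k+s}_x σ))` is `J^k_hol (φ ∘ (id × ϰ_s⁻¹))` at
`(j^{k+r}_x σ, j^{k+s}_x (η ∘ σ))`, that is, the `k`-jet at `x` of
`y ↦ φ(j^r_y σ, ϰ_s⁻¹(j^s_y (η ∘ σ)))`. Used in order `s` at all points `y` near `x`, it identifies
this section with `y ↦ φ(j^r_y σ, 𝒥^s η (j^s_y σ))`, whose `k`-jet is `J^k_hol (φ(𝒥^s η))` at `a`.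

The work lies in the fact that all the operations involved are defined by a choice of
representatives, so that this computation needs their independence of the choice and the existence
of representatives:

* The jet of `χ ∘ S` depends only on the jet of `S` (`hasJet_jetMap`), directly by the definition of
  contact of order `k` through smooth functions.
* The inclusion `J^{k+r} Y → J^k J^r Y` is well defined (`HasJet.prolongation_unique`), and `ϰ_s` is a
  well-defined bijection (`exists_kappaRel`, `KappaRel.exists_left`, `KappaRel.unique`,
  `KappaRel.injective`).
* The jet of `φ(S, ϰ_s⁻¹ ∘ S')` depends only on the jets of `S` and `S'` (`HasJet.eq_of_kappaRel`).
* A vertical vector field has a smooth local flow (`exists_isLocalFlow`), obtained from the inverse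
  function theorem in a space of curves (`exists_smooth_flow`), and its flow prolongation is smooth
  (`dSmooth_flowProlongation`).

Jets and vertical vectors are defined by smooth curves and smooth functions. The link to coordinates
is the notion `FibredChart`, which passes from `Y` to its vertical bundle
(`FibredChart.vertical`), its jet spaces (`FibredChart.jet`) and the fibre product
`J^r Y ×_{J^s Y} V J^s Y` (`FibredChart.jetPullback`): the coordinates of a jet are Taylor coefficients,
those of a vertical vector are derivatives. In a chart, contact of order `k` of two sections is an
estimate `O(|y - x|^{k+1})` of the difference of their coordinates (`HasJet.eq_of_coord_isBigO`,
`HasJet.sub_isBigO`), since a smooth map whose derivatives of order at most `k` vanish along all lines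
through a point vanishes to order `k` there (`vanishesTo_of_lines`). In coordinates, `ϰ_s` is the interchange of
derivatives in `t` and in `y` (`KappaRel.vderiv_jetCoord`).
-/

noncomputable section

/-! ### Taylor coefficients and vanishing orders -/

section Calculus

open Asymptotics

variable {X V W G : Type*} [NormedAddCommGroup X] [NormedSpace ℝ X]
  [NormedAddCommGroup V] [NormedSpace ℝ V] [NormedAddCommGroup W] [NormedSpace ℝ W]
  [NormedAddCommGroup G] [NormedSpace ℝ G]

/-- Currying the first variable, as a continuous linear equivalence. -/
def curryLeftCLE (V X : Type*) [NormedAddCommGroup X] [NormedSpace ℝ X]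
    [NormedAddCommGroup V] [NormedSpace ℝ V] (i : ℕ) :
    (V [×(i+1)]→L[ℝ] X) ≃L[ℝ] (V →L[ℝ] V [×i]→L[ℝ] X) :=
  (continuousMultilinearCurryLeftEquiv ℝ (fun _ : Fin (i + 1) => V) X).toContinuousLinearEquiv

lemma natCast_le_infty (i : ℕ) : (i : WithTop ℕ∞) ≤ ∞ := by exact_mod_cast le_top

lemma infty_add_natCast_le (i : ℕ) : (∞ : WithTop ℕ∞) + i ≤ ∞ := by exact_mod_cast le_top

lemma ContDiff.iteratedFDeriv_infty {u : V → X} (hu : ContDiff ℝ ∞ u) (i : ℕ) :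
    ContDiff ℝ ∞ (iteratedFDeriv ℝ i u) := hu.iteratedFDeriv_right (infty_add_natCast_le i)

lemma ContDiff.fderiv_infty {u : V → X} (hu : ContDiff ℝ ∞ u) :
    ContDiff ℝ ∞ (fderiv ℝ u) := hu.fderiv_right (infty_add_natCast_le 1)

/-- Differentiation in a fixed direction commutes with iterated derivatives. -/
lemma iteratedFDeriv_fderiv_apply {u : V → X} (hu : ContDiff ℝ ∞ u) (i : ℕ) (e z : V) :
    iteratedFDeriv ℝ i (fun y => fderiv ℝ u y e) z = fderiv ℝ (iteratedFDeriv ℝ i u) z e := by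
  induction i generalizing z with
  | zero =>
    ext m
    have hd : DifferentiableAt ℝ (iteratedFDeriv ℝ 0 u) z :=
      ((hu.iteratedFDeriv_infty 0).differentiable (by simp)) z
    rw [← fderiv_continuousMultilinear_apply_const_apply hd]
    simp
  | succ i ih =>
    have hsm := hu.iteratedFDeriv_infty i
    have hd1 : DifferentiableAt ℝ (iteratedFDeriv ℝ (i + 1) u) z :=
      ((hu.iteratedFDeriv_infty (i + 1)).differentiable (by simp)) z
    have hd2 : Differentiable ℝ (fderiv ℝ (iteratedFDeriv ℝ i u)) :=
      hsm.fderiv_infty.differentiable (by simp)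
    have hsymm : IsSymmSndFDerivAt ℝ (iteratedFDeriv ℝ i u) z :=
      hsm.contDiffAt.isSymmSndFDerivAt (by simpa using natCast_le_infty 2)
    have h1 : ∀ v w : V, fderiv ℝ (fun y => fderiv ℝ (iteratedFDeriv ℝ i u) y v) z w =
        fderiv ℝ (fderiv ℝ (iteratedFDeriv ℝ i u)) z w v := by
      intro v w
      rw [((hd2 z).hasFDerivAt.clm_apply (hasFDerivAt_const v z)).fderiv]
      simp
    ext m
    rw [iteratedFDeriv_succ_apply_left, show iteratedFDeriv ℝ i (fun y => fderiv ℝ u y e) = fun y =>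
      fderiv ℝ (iteratedFDeriv ℝ i u) y e from funext ih,
      ← fderiv_continuousMultilinear_apply_const_apply hd1]
    simp_rw [iteratedFDeriv_succ_apply_left]
    rw [fderiv_continuousMultilinear_apply_const_apply
      ((hd2 z).clm_apply (differentiableAt_const _)), h1, h1, hsymm.eq]

/-- The partial iterated derivative in terms of the full one. -/
lemma iteratedFDeriv_partial {U : X × V → W} (hU : ContDiff ℝ ∞ U) (i : ℕ) (a : X) (b : V) :
    iteratedFDeriv ℝ i (fun y => U (a, y)) b =
      (iteratedFDeriv ℝ i U (a, b)).compContinuousLinearMap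
        (fun _ => ContinuousLinearMap.inr ℝ X V) := by
  have h1 : (fun y => U (a, y)) = (fun z => U ((a, 0) + z)) ∘ ContinuousLinearMap.inr ℝ X V := by
    ext y; simp
  have h2 : ContDiff ℝ ∞ (fun z => U ((a, 0) + z)) := hU.comp (contDiff_const.add contDiff_id)
  rw [h1, ContinuousLinearMap.iteratedFDeriv_comp_right _ h2 b (i := i) (natCast_le_infty _)]
  rw [iteratedFDeriv_comp_add_left]
  simp

lemma contDiff_iteratedFDeriv_partial {U : X × V → W} (hU : ContDiff ℝ ∞ U) (i : ℕ) :
    ContDiff ℝ ∞ fun z : X × V => iteratedFDeriv ℝ i (fun y => U (z.1, y)) z.2 := by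
  simp_rw [iteratedFDeriv_partial hU]
  have hsm := hU.iteratedFDeriv_infty i
  exact (ContinuousMultilinearMap.compContinuousLinearMapL (𝕜 := ℝ) (F := W)
    (fun _ : Fin i => ContinuousLinearMap.inr ℝ X V)).contDiff.comp hsm

/-- The velocity of a family of Taylor coefficients consists of the Taylor coefficients of the
velocity. -/
lemma hasDerivAt_iteratedFDeriv_partial {U : ℝ × V → W} (hU : ContDiff ℝ ∞ U) (i : ℕ) (b : V)
    (t : ℝ) :
    HasDerivAt (fun τ => iteratedFDeriv ℝ i (fun y => U (τ, y)) b)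
      (iteratedFDeriv ℝ i (fun y => deriv (fun τ => U (τ, y)) t) b) t := by
  have hd : Differentiable ℝ U := hU.differentiable (by simp)
  have h1 : (fun y => deriv (fun τ => U (τ, y)) t) = fun y => fderiv ℝ U (t, y) (1, 0) := by
    ext y
    exact ((hd (t, y)).hasFDerivAt.comp_hasDerivAt t
      ((hasDerivAt_id t).prodMk (hasDerivAt_const t y))).deriv
  have hU' : ContDiff ℝ ∞ (fun z => fderiv ℝ U z (1, 0)) :=
    hU.fderiv_infty.clm_apply contDiff_const
  rw [h1, iteratedFDeriv_partial hU', iteratedFDeriv_fderiv_apply hU]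
  simp_rw [iteratedFDeriv_partial hU]
  have hsm := hU.iteratedFDeriv_infty i
  have h2 := ((hsm.differentiable (by simp)) (t, b)).hasFDerivAt.comp_hasDerivAt t
      ((hasDerivAt_id t).prodMk (hasDerivAt_const t b))
  exact (ContinuousMultilinearMap.compContinuousLinearMapL (𝕜 := ℝ) (F := W)
    (fun _ : Fin i => ContinuousLinearMap.inr ℝ ℝ V)).hasFDerivAt.comp_hasDerivAt t h2

lemma iteratedDeriv_line {u : V → X} (hu : ContDiff ℝ ∞ u) (i : ℕ) (a w : V) (t : ℝ) :
    iteratedDeriv i (fun s : ℝ => u (a + s • w)) t =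
      iteratedFDeriv ℝ i u (a + t • w) fun _ => w := by
  have h1 : (fun s : ℝ => u (a + s • w)) =
      (fun z => u (a + z)) ∘ (ContinuousLinearMap.toSpanSingleton ℝ w) := by
    ext s; simp
  have h2 : ContDiff ℝ ∞ (fun z => u (a + z)) := hu.comp (contDiff_const.add contDiff_id)
  rw [iteratedDeriv_eq_iteratedFDeriv, h1,
    ContinuousLinearMap.iteratedFDeriv_comp_right _ h2 t (i := i) (natCast_le_infty _),
    iteratedFDeriv_comp_add_left]
  simp

/-- **Taylor's theorem** in several variables. -/
lemma taylor_isBigO {u : V → X} [ProperSpace V] (hu : ContDiff ℝ ∞ u) (r : ℕ) (a : V) :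
    (fun y => u y - ∑ i ∈ Finset.range (r + 1),
      ((i.factorial : ℝ)⁻¹) • iteratedFDeriv ℝ i u a fun _ => y - a) =O[𝓝 a]
      fun y => ‖y - a‖ ^ (r + 1) := by
  have hcont : Continuous (iteratedFDeriv ℝ (r + 1) u) :=
    hu.continuous_iteratedFDeriv (natCast_le_infty _)
  obtain ⟨C, hC⟩ := (isCompact_closedBall a 1).exists_bound_of_continuousOn hcont.continuousOn
  refine IsBigO.of_bound (C / r.factorial) ?_
  filter_upwards [Metric.closedBall_mem_nhds a one_pos] with y hy
  set w := y - a with hw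
  have hwn : ‖w‖ ≤ 1 := by simpa [hw, dist_eq_norm] using hy
  set g : ℝ → X := fun s => u (a + s • w) with hg
  have hgs : ContDiff ℝ ∞ g := by fun_prop
  have key := taylor_mean_remainder_bound (f := g) (a := 0) (b := 1) (x := 1) (n := r)
    (C := C * ‖w‖ ^ (r + 1)) zero_le_one
    ((hgs.of_le (natCast_le_infty (r + 1))).contDiffOn) (by simp) (fun s hs => by
      rw [iteratedDerivWithin_eq_iteratedDeriv (uniqueDiffOn_Icc zero_lt_one)
        (hgs.contDiffAt.of_le (natCast_le_infty (r + 1))) hs, iteratedDeriv_line hu]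
      refine (ContinuousMultilinearMap.le_opNorm _ _).trans ?_
      simp only [Finset.prod_const, Finset.card_univ, Fintype.card_fin]
      gcongr
      apply hC
      rw [Metric.mem_closedBall, dist_eq_norm, add_sub_cancel_left, norm_smul, Real.norm_eq_abs,
        abs_of_nonneg hs.1]
      exact mul_le_one₀ hs.2 (norm_nonneg _) hwn)
  rw [taylor_within_apply] at key
  have e1 : g 1 = u y := by simp [hg, hw]
  have e2 : ∀ i, iteratedDerivWithin i g (Icc 0 1) 0 = iteratedFDeriv ℝ i u a fun _ => w := by
    intro i
    rw [iteratedDerivWithin_eq_iteratedDeriv (uniqueDiffOn_Icc zero_lt_one)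
        (hgs.contDiffAt.of_le (natCast_le_infty _)) (by simp), iteratedDeriv_line hu]
    simp
  simp only [e1, e2, sub_zero, one_pow, mul_one] at key
  refine key.trans_eq ?_
  rw [norm_pow, norm_norm]
  ring

/-- A smooth curve which is `O(t^(k+1))` has vanishing derivatives up to order `k`. -/
lemma iteratedDeriv_eq_zero_of_isBigO {g : ℝ → X} (hg : ContDiff ℝ ∞ g) {k : ℕ}
    (h : g =O[𝓝[≠] 0] fun t => t ^ (k + 1)) {i : ℕ} (hi : i ≤ k) : iteratedDeriv i g 0 = 0 := by
  induction i using Nat.strong_induction_on with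
  | _ i ih =>
    have h1 := taylor_isLittleO_univ (x₀ := 0) (n := i) (hg.of_le (natCast_le_infty _))
    simp only [taylor_within_apply, iteratedDerivWithin_univ, sub_zero] at h1
    have h0 : ∀ t : ℝ, ∑ j ∈ Finset.range (i + 1),
        (((j.factorial : ℝ)⁻¹ * t ^ j) • iteratedDeriv j g 0) =
        ((i.factorial : ℝ)⁻¹ * t ^ i) • iteratedDeriv i g 0 := by
      intro t
      refine Finset.sum_eq_single_of_mem i (by simp) fun j hj hji => ?_
      rw [ih j (by grind) (by grind), smul_zero]
    simp only [h0] at h1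
    have h2 : g =o[𝓝[≠] 0] fun t => t ^ i := by
      refine h.trans_isLittleO ?_
      refine (isLittleO_pow_pow (by omega : i < k + 1)).mono nhdsWithin_le_nhds
    have h3 : (fun t : ℝ => (t ^ i) • ((i.factorial : ℝ)⁻¹ • iteratedDeriv i g 0)) =o[𝓝[≠] 0]
        fun t => t ^ i := by
      have := h2.sub (h1.mono nhdsWithin_le_nhds)
      refine this.congr_left fun t => ?_
      rw [smul_smul, mul_comm, sub_sub_cancel]
    have h4 : (fun _ : ℝ => ((i.factorial : ℝ)⁻¹ • iteratedDeriv i g 0)) =o[𝓝[≠] 0]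
        fun _ => (1 : ℝ) := by
      have := (isBigO_refl (fun t : ℝ => (t ^ i)⁻¹) (𝓝[≠] 0)).smul_isLittleO h3
      refine this.congr' ?_ ?_
      · filter_upwards [self_mem_nhdsWithin] with t ht
        rw [smul_smul, inv_mul_cancel₀ (pow_ne_zero _ ht), one_smul]
      · filter_upwards [self_mem_nhdsWithin] with t ht
        rw [smul_eq_mul, inv_mul_cancel₀ (pow_ne_zero _ ht)]
    rw [isLittleO_one_iff, tendsto_const_nhds_iff] at h4
    simpa [Nat.factorial_ne_zero] using h4

/-- `u` vanishes to order `k` at `a`: all its derivatives up to order `k` are zero there. -/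
def VanishesTo (k : ℕ) (u : V → X) (a : V) : Prop := ∀ i ≤ k, iteratedFDeriv ℝ i u a = 0

lemma VanishesTo.isBigO [ProperSpace V] {k : ℕ} {u : V → X} {a : V} (hu : ContDiff ℝ ∞ u)
    (h : VanishesTo k u a) : u =O[𝓝 a] fun y => ‖y - a‖ ^ (k + 1) := by
  refine (taylor_isBigO hu k a).congr_left fun y => ?_
  rw [Finset.sum_eq_zero fun i hi => ?_, sub_zero]
  rw [h i (by grind)]
  simp

lemma isBigO_punctured_of_smul {g : ℝ → X} {k : ℕ}
    (h : (fun t => t • g t) =O[𝓝 0] fun t : ℝ => t ^ (k + 2)) :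
    g =O[𝓝[≠] 0] fun t => t ^ (k + 1) := by
  have := (isBigO_refl (fun t : ℝ => t⁻¹) (𝓝[≠] 0)).smul (h.mono nhdsWithin_le_nhds)
  refine this.congr' ?_ ?_
  · filter_upwards [self_mem_nhdsWithin] with t ht
    rw [smul_smul, inv_mul_cancel₀ ht, one_smul]
  · filter_upwards [self_mem_nhdsWithin] with t ht
    have ht' : t ≠ 0 := ht
    rw [smul_eq_mul, pow_succ' t (k + 1), inv_mul_cancel_left₀ ht']

/-- Vanishing along all lines passes to directional derivatives, with one order less: the
derivative of `u (a + t (w + s e))` in `s` at `s = 0` is `t` times the directional derivative. -/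
lemma iteratedDeriv_line_fderiv {u : V → X} (hu : ContDiff ℝ ∞ u) {k : ℕ} {a : V}
    (hl : ∀ w, ∀ i ≤ k + 1, iteratedDeriv i (fun t : ℝ => u (a + t • w)) 0 = 0) (e w : V) :
    ∀ i ≤ k, iteratedDeriv i (fun t : ℝ => fderiv ℝ u (a + t • w) e) 0 = 0 := by
  set U : ℝ × ℝ → X := fun z => u (a + z.2 • (w + z.1 • e)) with hU
  have hUs : ContDiff ℝ ∞ U := by fun_prop
  have hd : Differentiable ℝ u := hu.differentiable (by simp)
  have h1 : ∀ t : ℝ, deriv (fun s => U (s, t)) 0 = t • fderiv ℝ u (a + t • w) e := by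
    intro t
    have hl : HasDerivAt (fun s : ℝ => a + t • (w + s • e)) (t • e) 0 := by
      have := ((((hasDerivAt_id (0 : ℝ)).smul_const e).const_add w).const_smul t).const_add a
      simpa using this
    have := (hd (a + t • (w + (0 : ℝ) • e))).hasFDerivAt.comp_hasDerivAt (0 : ℝ) hl
    rw [show (fun s => U (s, t)) = u ∘ fun s : ℝ => a + t • (w + s • e) from rfl, this.deriv]
    simp
  have h2 : VanishesTo (k + 1) (fun t : ℝ => t • fderiv ℝ u (a + t • w) e) 0 := by
    intro i hi
    have := (hasDerivAt_iteratedFDeriv_partial hUs i 0 0).deriv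
    simp_rw [h1] at this
    rw [← this]
    have h0 : ∀ s : ℝ, iteratedFDeriv ℝ i (fun y => U (s, y)) 0 = 0 := by
      intro s
      have := hl (w + s • e) i hi
      rw [iteratedDeriv_eq_equiv_comp] at this
      simpa [hU] using this
    simp [h0]
  have hg : ContDiff ℝ ∞ fun t : ℝ => fderiv ℝ u (a + t • w) e := by
    have := hu.fderiv_infty
    fun_prop
  have h3 := h2.isBigO (by fun_prop)
  intro i hi
  refine iteratedDeriv_eq_zero_of_isBigO hg (k := k) ?_ hi
  apply isBigO_punctured_of_smul
  refine h3.trans (IsBigO.of_bound 1 (.of_forall fun t => ?_))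
  simp

/-- A smooth map vanishing to order `k` along all lines through `a` vanishes to order `k`. -/
lemma vanishesTo_of_lines {k : ℕ} {u : V → X} (hu : ContDiff ℝ ∞ u) {a : V}
    (hl : ∀ w, ∀ i ≤ k, iteratedDeriv i (fun t : ℝ => u (a + t • w)) 0 = 0) :
    VanishesTo k u a := by
  induction k generalizing u with
  | zero =>
    intro i hi
    obtain rfl : i = 0 := by omega
    ext m
    simpa using hl 0 0 le_rfl
  | succ k ih =>
    rintro (_ | i) hi
    · ext m
      simpa using hl 0 0 (by omega)
    · ext m
      rw [iteratedFDeriv_succ_apply_right]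
      have hu' := hu.fderiv_infty
      have h := ih (u := fun y => fderiv ℝ u y (m (Fin.last i))) (by fun_prop)
        (fun w => iteratedDeriv_line_fderiv hu hl _ w) i (by omega)
      have h2 := iteratedFDeriv_clm_apply_const_apply (𝕜 := ℝ) (x := a) (n := ∞) hu' (i := i)
        (natCast_le_infty _) (u := m (Fin.last i)) (m := Fin.init m)
      rw [← h2, h]
      rfl

lemma vanishesTo_of_isBigO {k : ℕ} {u : V → X} (hu : ContDiff ℝ ∞ u) {a : V}
    (h : u =O[𝓝 a] fun y => ‖y - a‖ ^ (k + 1)) : VanishesTo k u a := by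
  refine vanishesTo_of_lines hu fun w i hi => ?_
  refine iteratedDeriv_eq_zero_of_isBigO (by fun_prop) (k := k) ?_ hi
  have ht : Tendsto (fun t : ℝ => a + t • w) (𝓝[≠] 0) (𝓝 a) := by
    have : Continuous fun t : ℝ => a + t • w := by fun_prop
    simpa using (this.tendsto 0).mono_left nhdsWithin_le_nhds
  refine (h.comp_tendsto ht).trans (IsBigO.of_bound (‖w‖ ^ (k + 1)) (.of_forall fun t => ?_))
  simp [norm_smul, mul_pow, mul_comm]

lemma VanishesTo.fderiv {k : ℕ} {u : V → X} {a : V} (h : VanishesTo (k + 1) u a) :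
    VanishesTo k (fderiv ℝ u) a := by
  intro i hi
  rw [← norm_eq_zero, norm_iteratedFDeriv_fderiv, h (i + 1) (by omega), norm_zero]

lemma VanishesTo.iteratedFDeriv {k r : ℕ} {u : V → X} {a : V} (h : VanishesTo (k + r) u a) :
    VanishesTo k (iteratedFDeriv ℝ r u) a := by
  induction r generalizing k with
  | zero =>
    intro i hi
    rw [iteratedFDeriv_zero_eq_comp, ← norm_eq_zero,
      LinearIsometryEquiv.norm_iteratedFDeriv_comp_left, h i (by omega), norm_zero]
  | succ r ih =>
    intro i hi
    have h1 := (ih (k := k + 1) (by rwa [add_right_comm])).fderiv i hi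
    have h2 := ContinuousLinearEquiv.iteratedFDeriv_comp_left (𝕜 := ℝ)
      (F := V →L[ℝ] V [×r]→L[ℝ] X) (G := V [×(r + 1)]→L[ℝ] X) (x := a) (i := i)
      (f := _root_.fderiv ℝ (_root_.iteratedFDeriv ℝ r u)) (curryLeftCLE V X r).symm
    rw [h1] at h2
    refine h2.trans ?_
    ext
    simp

/-- Smoothness on a neighbourhood of a point. -/
def SmoothGerm (u : V → X) (a : V) : Prop := ∀ᶠ y in 𝓝 a, ContDiffAt ℝ ∞ u y

/-- Every smooth germ is the germ of a globally smooth map. -/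
lemma SmoothGerm.exists_contDiff [FiniteDimensional ℝ V] {u : V → X} {a : V}
    (h : SmoothGerm u a) : ∃ u' : V → X, ContDiff ℝ ∞ u' ∧ u' =ᶠ[𝓝 a] u := by
  obtain ⟨ε, hε, hb⟩ := Metric.eventually_nhds_iff_ball.1 h
  let f : ContDiffBump a := ⟨ε / 4, ε / 2, by positivity, by linarith⟩
  refine ⟨fun y => f y • u y, ?_, ?_⟩
  · rw [contDiff_iff_contDiffAt]
    intro y
    by_cases hy : y ∈ Metric.ball a ε
    · exact f.contDiffAt.smul (hb y hy)
    · have : (fun y => f y • u y) =ᶠ[𝓝 y] fun _ => 0 := by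
        have hc : (Metric.closedBall a (ε / 2))ᶜ ∈ 𝓝 y := by
          refine Metric.isClosed_closedBall.isOpen_compl.mem_nhds ?_
          intro hy'
          exact hy (Metric.closedBall_subset_ball (by linarith) hy')
        filter_upwards [hc] with z hz
        have : f z = 0 := by
          apply f.zero_of_le_dist
          simp only [mem_compl_iff, Metric.mem_closedBall, not_le] at hz
          exact hz.le
        simp [this]
      exact contDiffAt_const.congr_of_eventuallyEq this
  · filter_upwards [f.eventuallyEq_one] with y hy
    simp [hy]

lemma ContDiffAt.multilinear_apply_diag {Q : Type*} [NormedAddCommGroup Q] [NormedSpace ℝ Q] {i : ℕ}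
    {θ : Q → V [×i]→L[ℝ] X} {w : Q → V} {q : Q} (hθ : ContDiffAt ℝ ∞ θ q)
    (hw : ContDiffAt ℝ ∞ w q) : ContDiffAt ℝ ∞ (fun q => θ q fun _ => w q) q := by
  induction i with
  | zero =>
    exact ((continuousMultilinearCurryFin0 ℝ V X).contDiff.contDiffAt.comp q
      hθ).congr_of_eventuallyEq
      (.of_forall fun q => by simp [Subsingleton.elim (fun _ : Fin 0 => w q) 0])
  | succ i ih =>
    have hL := ContinuousLinearEquiv.contDiff (𝕜 := ℝ) (n := ∞) (E := V [×(i + 1)]→L[ℝ] X)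
      (F := V →L[ℝ] V [×i]→L[ℝ] X) (curryLeftCLE V X i)
    have h1 : ContDiffAt ℝ ∞ (fun q => curryLeftCLE V X i (θ q)) q := hL.contDiffAt.comp q hθ
    refine (ih (h1.clm_apply hw)).congr_of_eventuallyEq (.of_forall fun q => ?_)
    change θ q _ = θ q _
    congr 1
    ext j
    refine Fin.cases rfl (fun j => rfl) j

end Calculus

/-! ### Charts onto `ℝⁿ` -/

section EuclideanCharts

variable {E H A : Type*} [NormedAddCommGroup E] [NormedSpace ℝ E] [TopologicalSpace H]

/-- A chart with values in `ℝⁿ` whose inverse is defined and smooth on all of `ℝⁿ`. -/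
structure EuclideanChart (I : ModelWithCorners ℝ E H) (A : Type*) [TopologicalSpace A]
    [ChartedSpace H A] (n : ℕ) where
  toFun : A → RSp n
  inv : RSp n → A
  source : Set A
  isOpen_source : IsOpen source
  contMDiffOn_toFun : ContMDiffOn I 𝓘(ℝ, RSp n) ∞ toFun source
  contMDiff_inv : ContMDiff 𝓘(ℝ, RSp n) I ∞ inv
  inv_mem : ∀ v, inv v ∈ source
  left_inv : ∀ a ∈ source, inv (toFun a) = a
  right_inv : ∀ v, toFun (inv v) = v

variable {I : ModelWithCorners ℝ E H} [TopologicalSpace A] [ChartedSpace H A]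

/-- A manifold has arbitrarily small charts onto `ℝⁿ`: a chart is restricted to a ball, which is
diffeomorphic to `ℝⁿ`. -/
lemma exists_euclideanChart (I : ModelWithCorners ℝ E H) [FiniteDimensional ℝ E] [I.Boundaryless]
    [IsManifold I ∞ A] (a : A) {W : Set A} (hW : W ∈ 𝓝 a) :
    ∃ (n : ℕ) (c : EuclideanChart I A n), a ∈ c.source ∧ c.source ⊆ W := by
  set φ := extChartAt I a with hφ
  set T := toEuclidean (E := E) with hT
  set n := Module.finrank ℝ E
  have hφsrc : IsOpen φ.source := isOpen_extChartAt_source a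
  have hφtgt : IsOpen φ.target := isOpen_extChartAt_target a
  have ha : a ∈ φ.source := mem_extChartAt_source a
  have hcs : ContinuousOn φ.symm φ.target := continuousOn_extChartAt_symm a
  obtain ⟨W', hW'W, hW'o, haW'⟩ := mem_nhds_iff.1 hW
  have hO : IsOpen (T.symm ⁻¹' (φ.target ∩ φ.symm ⁻¹' W')) :=
    (hcs.isOpen_inter_preimage hφtgt hW'o).preimage T.symm.continuous
  have hmem : T (φ a) ∈ T.symm ⁻¹' (φ.target ∩ φ.symm ⁻¹' W') := by
    simp only [mem_preimage, ContinuousLinearEquiv.symm_apply_apply, mem_inter_iff]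
    exact ⟨φ.map_source ha, by rw [φ.left_inv ha]; exact haW'⟩
  obtain ⟨ε, hε, hball⟩ := Metric.isOpen_iff.1 hO _ hmem
  set b := OpenPartialHomeomorph.univBall (T (φ a)) ε with hb
  have hsrc : b.source = univ := OpenPartialHomeomorph.univBall_source _ ε
  have htgt : b.target = Metric.ball (T (φ a)) ε := OpenPartialHomeomorph.univBall_target _ hε
  have hbm : ∀ v, b v ∈ Metric.ball (T (φ a)) ε := fun v =>
    htgt ▸ b.map_source (hsrc ▸ mem_univ v)
  have hTφ : ContMDiffOn I 𝓘(ℝ, RSp n) ∞ (fun x => T (φ x)) φ.source := by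
    have h1 : ContMDiffOn I 𝓘(ℝ, E) ∞ φ φ.source := by
      rw [hφ, extChartAt_source]; exact contMDiffOn_extChartAt
    exact T.contDiff.contMDiff.comp_contMDiffOn h1
  refine ⟨n, ⟨fun x => b.symm (T (φ x)), fun v => φ.symm (T.symm (b v)),
    φ.source ∩ (fun x => T (φ x)) ⁻¹' Metric.ball (T (φ a)) ε,
    hTφ.continuousOn.isOpen_inter_preimage hφsrc Metric.isOpen_ball, ?_, ?_, ?_, ?_, ?_⟩,
    ⟨ha, Metric.mem_ball_self hε⟩, ?_⟩
  · exact (OpenPartialHomeomorph.contDiffOn_univBall_symm.contMDiffOn).comp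
      (hTφ.mono inter_subset_left) fun x hx => hx.2
  · have h1 : ContMDiffOn 𝓘(ℝ, E) I ∞ φ.symm φ.target := contMDiffOn_extChartAt_symm a
    refine h1.comp_contMDiff ?_ fun v => (hball (hbm v)).1
    exact (T.symm.contDiff.comp OpenPartialHomeomorph.contDiff_univBall).contMDiff
  · intro v
    refine ⟨φ.map_target (hball (hbm v)).1, ?_⟩
    rw [mem_preimage, φ.right_inv (hball (hbm v)).1, ContinuousLinearEquiv.apply_symm_apply]
    exact hbm v
  · intro x hx
    rw [b.right_inv (htgt ▸ hx.2), ContinuousLinearEquiv.symm_apply_apply, φ.left_inv hx.1]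
  · intro v
    rw [φ.right_inv (hball (hbm v)).1, ContinuousLinearEquiv.apply_symm_apply,
      b.left_inv (hsrc ▸ mem_univ v)]
  · intro x hx
    have := (hball hx.2).2
    simp only [mem_preimage, ContinuousLinearEquiv.symm_apply_apply] at this
    rw [φ.left_inv hx.1] at this
    exact hW'W this

namespace EuclideanChart

variable {n : ℕ} (c : EuclideanChart I A n)

lemma source_mem_nhds {a : A} (ha : a ∈ c.source) : c.source ∈ 𝓝 a := c.isOpen_source.mem_nhds ha

lemma contMDiffAt_toFun {a : A} (ha : a ∈ c.source) :
    ContMDiffAt I 𝓘(ℝ, RSp n) ∞ c.toFun a :=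
  c.contMDiffOn_toFun.contMDiffAt (c.source_mem_nhds ha)

lemma continuousAt_toFun {a : A} (ha : a ∈ c.source) : ContinuousAt c.toFun a :=
  (c.contMDiffAt_toFun ha).continuousAt

lemma tendsto_inv {a : A} (ha : a ∈ c.source) : Tendsto c.inv (𝓝 (c.toFun a)) (𝓝 a) := by
  have := c.contMDiff_inv.continuous.tendsto (c.toFun a)
  rwa [c.left_inv a ha] at this

end EuclideanChart

end EuclideanCharts

/-! ### Smooth maps between manifolds and smooth spaces -/

section SmoothMaps

variable {E H A E' H' B E'' H'' N P Q X : Type*}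
  [NormedAddCommGroup E] [NormedSpace ℝ E] [TopologicalSpace H]
  {I : ModelWithCorners ℝ E H} [TopologicalSpace A] [ChartedSpace H A]
  [NormedAddCommGroup E'] [NormedSpace ℝ E'] [TopologicalSpace H']
  {J : ModelWithCorners ℝ E' H'} [TopologicalSpace B] [ChartedSpace H' B]
  [NormedAddCommGroup E''] [NormedSpace ℝ E''] [TopologicalSpace H'']
  {K : ModelWithCorners ℝ E'' H''} [TopologicalSpace N] [ChartedSpace H'' N]
  [DiffeologicalSpace P] [DiffeologicalSpace Q] [NormedAddCommGroup X] [NormedSpace ℝ X]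

/-- A map between manifolds is smooth on some neighbourhood of a point. -/
def ContMDiffNear (I : ModelWithCorners ℝ E H) (J : ModelWithCorners ℝ E' H') (f : A → B) (a : A) :
    Prop :=
  ∀ᶠ b in 𝓝 a, ContMDiffAt I J ∞ f b

lemma ContMDiff.contMDiffNear {f : A → B} (h : ContMDiff I J ∞ f) (a : A) :
    ContMDiffNear I J f a := .of_forall h

lemma ContMDiffOn.contMDiffNear {f : A → B} {U : Set A} {a : A} (h : ContMDiffOn I J ∞ f U)
    (hU : U ∈ 𝓝 a) : ContMDiffNear I J f a := by
  filter_upwards [eventually_mem_nhds_iff.2 hU] with b hb using h.contMDiffAt hb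

lemma ContMDiffNear.exists_contMDiffOn {f : A → B} {a : A} (h : ContMDiffNear I J f a) :
    ∃ U ∈ 𝓝 a, ContMDiffOn I J ∞ f U :=
  ⟨_, h, fun _ hb => hb.contMDiffWithinAt⟩

lemma ContMDiffNear.contMDiffAt {f : A → B} {a : A} (h : ContMDiffNear I J f a) :
    ContMDiffAt I J ∞ f a := h.self_of_nhds

lemma ContMDiffNear.continuousAt {f : A → B} {a : A} (h : ContMDiffNear I J f a) :
    ContinuousAt f a := h.contMDiffAt.continuousAt

lemma ContMDiffNear.eventually {f : A → B} {a : A} (h : ContMDiffNear I J f a) :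
    ∀ᶠ b in 𝓝 a, ContMDiffNear I J f b := h.eventually_nhds

lemma ContMDiffNear.congr {f g : A → B} {a : A} (h : ContMDiffNear I J f a) (hfg : g =ᶠ[𝓝 a] f) :
    ContMDiffNear I J g a := by
  filter_upwards [h, hfg.eventually_nhds] with b hb hb' using hb.congr_of_eventuallyEq hb'

lemma ContMDiffNear.comp {g : B → N} {f : A → B} {a : A} (hg : ContMDiffNear J K g (f a))
    (hf : ContMDiffNear I J f a) : ContMDiffNear I K (fun x => g (f x)) a := by
  filter_upwards [hf, hf.continuousAt.eventually hg] with b hb hb' using hb'.comp b hb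

lemma ContMDiffNear.prodMk {f : A → B} {g : A → N} {a : A} (hf : ContMDiffNear I J f a)
    (hg : ContMDiffNear I K g a) : ContMDiffNear I (J.prod K) (fun x => (f x, g x)) a := by
  filter_upwards [hf, hg] with b hb hb' using hb.prodMk hb'

lemma SmoothGerm.contMDiffNear {f : E → X} {a : E} (h : SmoothGerm f a) :
    ContMDiffNear 𝓘(ℝ, E) 𝓘(ℝ, X) f a := h.mono fun _ hb => hb.contMDiffAt

lemma ContMDiffNear.smoothGerm {f : E → X} {a : E} (h : ContMDiffNear 𝓘(ℝ, E) 𝓘(ℝ, X) f a) :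
    SmoothGerm f a := h.mono fun _ hb => hb.contDiffAt

lemma ContMDiffNear.smoothGerm_prod {f : E × E' → X} {a : E × E'}
    (h : ContMDiffNear (𝓘(ℝ, E).prod 𝓘(ℝ, E')) 𝓘(ℝ, X) f a) : SmoothGerm f a := by
  unfold ContMDiffNear at h
  rw [← modelWithCornersSelf_prod, chartedSpaceSelf_prod] at h
  exact h.mono fun _ hb => hb.contDiffAt

lemma EuclideanChart.contMDiffNear_toFun {n : ℕ} (c : EuclideanChart I A n) {a : A}
    (ha : a ∈ c.source) : ContMDiffNear I 𝓘(ℝ, RSp n) c.toFun a :=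
  c.contMDiffOn_toFun.contMDiffNear (c.source_mem_nhds ha)

lemma SmoothNear.comp_contMDiffNear {f : A → P} {g : B → A} {b : B}
    (hf : SmoothNear I f (g b)) (hg : ContMDiffNear J I g b) :
    SmoothNear J (fun x => f (g x)) b := by
  obtain ⟨U, hU, h⟩ := hg.exists_contMDiffOn
  exact hf.comp_of_mem hU h

lemma SmoothNear.congr {f g : A → P} {a : A} (hf : SmoothNear I f a) (hfg : g =ᶠ[𝓝 a] f) :
    SmoothNear I g a := by
  obtain ⟨U, hU, h⟩ := hf
  refine ⟨U ∩ {x | g x = f x}, inter_mem hU hfg, fun n q hq hqU => ?_⟩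
  rw [show g ∘ q = f ∘ q from funext fun u => (hqU u).2]
  exact h n q hq fun u => (hqU u).1

lemma Diffeology.IsPlot.smoothNear {n : ℕ} {p : RSp n → P} (hp : IsPlot p) (u : RSp n) :
    SmoothNear 𝓘(ℝ, RSp n) p u :=
  ⟨univ, univ_mem, fun _ _ hq _ => isPlot_reparam hp hq.contDiff⟩

lemma isPlot_of_smoothNear {n : ℕ} {p : RSp n → P}
    (h : ∀ u, SmoothNear 𝓘(ℝ, RSp n) p u) : IsPlot p := by
  refine DiffeologicalSpace.locality fun u => ?_
  obtain ⟨U, hU, hq⟩ := h u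
  obtain ⟨V, hVU, hV, huV⟩ := mem_nhds_iff.1 hU
  exact ⟨V, hV, huV, fun hf hfs => hq _ _ hfs.contMDiff fun x => hVU (hf x)⟩

/-- A map from a diffeological space to a manifold which is smooth along all plots. (The manifold,
often a normed space, is not given a diffeology.) -/
def SmoothTo (K : ModelWithCorners ℝ E'' H'') (G : P → N) : Prop :=
  ∀ (n : ℕ) (p : RSp n → P), IsPlot p → ContMDiff 𝓘(ℝ, RSp n) K ∞ (G ∘ p)

lemma SmoothTo.comp_dSmooth {G : P → N} (hG : SmoothTo K G) {f : Q → P} (hf : DSmooth f) :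
    SmoothTo K (fun x => G (f x)) := fun n p hp => hG n _ (hf n p hp)

lemma ContMDiff.comp_smoothTo {G : P → N} {g : N → B} (hg : ContMDiff K J ∞ g)
    (hG : SmoothTo K G) : SmoothTo J (fun x => g (G x)) := fun n p hp => hg.comp (hG n p hp)

lemma dSmooth_of_smoothTo {f : P → ℝ} (hf : SmoothTo 𝓘(ℝ, ℝ) f) : DSmooth f :=
  fun n p hp => (hf n p hp).contDiff.isPlot

lemma Diffeology.DSmooth.smoothTo {f : P → ℝ} (hf : DSmooth f) : SmoothTo 𝓘(ℝ, ℝ) f :=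
  fun n p hp => (hf n p hp).contDiff.contMDiff

lemma SmoothTo.prodMk_space {X' : Type*} [NormedAddCommGroup X'] [NormedSpace ℝ X'] {G : P → X}
    {G' : P → X'} (hG : SmoothTo 𝓘(ℝ, X) G) (hG' : SmoothTo 𝓘(ℝ, X') G') :
    SmoothTo 𝓘(ℝ, X × X') fun p => (G p, G' p) :=
  fun n p hp => (hG n p hp).prodMk_space (hG' n p hp)

lemma smoothTo_pi {ι : Type*} [Fintype ι] {X' : ι → Type*} [∀ i, NormedAddCommGroup (X' i)]
    [∀ i, NormedSpace ℝ (X' i)] {G : ∀ i, P → X' i} (hG : ∀ i, SmoothTo 𝓘(ℝ, X' i) (G i)) :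
    SmoothTo 𝓘(ℝ, ∀ i, X' i) fun p i => G i p :=
  fun n p hp => contMDiff_pi_space.2 fun i => hG i n p hp

section Charts

variable [FiniteDimensional ℝ E] [I.Boundaryless] [IsManifold I ∞ A]

/-- The inverse of a chart onto `ℝⁿ` is a plot, so smoothness along plots is smoothness in
charts. -/
lemma SmoothNear.smoothTo_comp {f : A → P} {a : A} {G : P → N} (hf : SmoothNear I f a)
    (hG : SmoothTo K G) : ContMDiffNear I K (fun x => G (f x)) a := by
  obtain ⟨U, hU, h⟩ := hf
  obtain ⟨n, c, ha, hc⟩ := exists_euclideanChart I a hU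
  have h1 := hG n _ (h n c.inv c.contMDiff_inv fun v => hc (c.inv_mem v))
  refine ContMDiffNear.congr (f := (G ∘ f ∘ c.inv) ∘ c.toFun)
    (ContMDiffOn.contMDiffNear (h1.comp_contMDiffOn c.contMDiffOn_toFun) (c.source_mem_nhds ha)) ?_
  filter_upwards [c.source_mem_nhds ha] with x hx
  simp [c.left_inv x hx]

/-- A map which is smooth near a point is continuous there, for the D-topology. -/
lemma SmoothNear.eventually_mem {f : A → P} {a : A} (hf : SmoothNear I f a) {S : Set P}
    (hS : IsOpen[dTopology] S) (ha : f a ∈ S) : ∀ᶠ x in 𝓝 a, f x ∈ S := by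
  obtain ⟨U, hU, h⟩ := hf
  obtain ⟨n, c, hac, hc⟩ := exists_euclideanChart I a hU
  have h1 := (isOpen_iff_preimages_plots.1 hS) n _
    (h n c.inv c.contMDiff_inv fun v => hc (c.inv_mem v))
  have h2 : ∀ᶠ v in 𝓝 (c.toFun a), f (c.inv v) ∈ S := by
    refine h1.mem_nhds ?_
    simpa [c.left_inv a hac] using ha
  filter_upwards [(c.continuousAt_toFun hac).eventually h2, c.source_mem_nhds hac] with x hx hx'
  rwa [c.left_inv x hx'] at hx

end Charts

lemma SmoothTo.isOpen_preimage {G : P → N} (hG : SmoothTo K G) {S : Set N} (hS : IsOpen S) :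
    IsOpen[dTopology] (G ⁻¹' S) := by
  rw [isOpen_iff_preimages_plots]
  intro n p hp
  exact hS.preimage (hG n p hp).continuous

lemma Diffeology.DSmooth.isOpen_preimage {g : Q → P} (hg : DSmooth g) {S : Set P}
    (hS : IsOpen[dTopology] S) : IsOpen[dTopology] (g ⁻¹' S) := by
  rw [isOpen_iff_preimages_plots] at hS ⊢
  exact fun n p hp => hS n _ (hg n p hp)

lemma isOpen_inter_dTopology {S T : Set P} (hS : IsOpen[dTopology] S) (hT : IsOpen[dTopology] T) :
    IsOpen[dTopology] (S ∩ T) := by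
  rw [isOpen_iff_preimages_plots] at hS hT ⊢
  exact fun n p hp => (hS n p hp).inter (hT n p hp)

end SmoothMaps

/-! ### Jets -/

section Jets

variable {E : Type*} [NormedAddCommGroup E] [NormedSpace ℝ E]
  {M : Type*} [TopologicalSpace M] [ChartedSpace E M] {P : Type*} [DiffeologicalSpace P]
  {π : P → M} {k : ℕ}
  {E' H' A : Type*} [NormedAddCommGroup E'] [NormedSpace ℝ E'] [TopologicalSpace H']
  {I : ModelWithCorners ℝ E' H'} [TopologicalSpace A] [ChartedSpace H' A]

/-- The value `s x` of a jet `j^k_x s`. -/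
def Jet.val : Jet E k π → P :=
  Quotient.lift (fun a : LocalSection E π => a.toFun a.pt) fun _ _ h => h.2.1

lemma HasJet.val_eq {s : M → P} {x : M} {j : Jet E k π} (h : HasJet E k π s x j) : j.val = s x := by
  obtain ⟨_, rfl⟩ := h
  rfl

lemma IsLocalSection.hasJet {s : M → P} {x : M} (h : IsLocalSection E π s x) (k : ℕ) :
    HasJet E k π s x (LocalSection.jet ⟨x, s, h⟩ k) := ⟨h, rfl⟩

lemma IsLocalSection.congr {s s' : M → P} {x : M} (h : IsLocalSection E π s x)
    (hs : s' =ᶠ[𝓝 x] s) : IsLocalSection E π s' x :=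
  ⟨h.1.congr hs, by filter_upwards [h.2, hs] with y h1 h2; rw [h2, h1]⟩

/-- Two sections with the same jet have the same derivatives along curves. -/
lemma HasJet.contact {s s' : M → P} {x x' : M} {j : Jet E k π} (h : HasJet E k π s x j)
    (h' : HasJet E k π s' x' j) : x = x' ∧ s x = s' x' ∧
    ∀ f : P → ℝ, DSmooth f → ∀ c : ℝ → M, ContMDiff 𝓘(ℝ, ℝ) 𝓘(ℝ, E) ∞ c → c 0 = x →
      ∀ i ≤ k, iteratedDeriv i (fun t => f (s (c t))) 0 =
        iteratedDeriv i (fun t => f (s' (c t))) 0 := by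
  obtain ⟨h1, rfl⟩ := h
  obtain ⟨h2, he⟩ := h'
  exact Quotient.exact he

lemma HasJet.eq_of_contact {s s' : M → P} {x : M} {j j' : Jet E k π} (h : HasJet E k π s x j)
    (h' : HasJet E k π s' x j') (h0 : s x = s' x)
    (hc : ∀ f : P → ℝ, DSmooth f → ∀ c : ℝ → M, ContMDiff 𝓘(ℝ, ℝ) 𝓘(ℝ, E) ∞ c → c 0 = x →
      ∀ i ≤ k, iteratedDeriv i (fun t => f (s (c t))) 0 =
        iteratedDeriv i (fun t => f (s' (c t))) 0) : j = j' := by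
  obtain ⟨h1, rfl⟩ := h
  obtain ⟨h2, rfl⟩ := h'
  exact Quotient.sound ⟨rfl, h0, hc⟩

lemma HasJet.congr {s s' : M → P} {x : M} {j : Jet E k π} (h : HasJet E k π s x j)
    (hs : s' =ᶠ[𝓝 x] s) : HasJet E k π s' x j := by
  obtain ⟨h1, rfl⟩ := h
  have h2 := h1.congr hs
  have hj := h2.hasJet k
  rwa [hj.eq_of_contact (h1.hasJet k) hs.self_of_nhds] at hj
  intro f _ c hc h0 i _
  refine Filter.EventuallyEq.iteratedDeriv_eq i ?_
  have : Tendsto c (𝓝 0) (𝓝 x) := by simpa [h0] using hc.continuous.tendsto 0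
  filter_upwards [this.eventually hs] with t ht
  rw [ht]

lemma HasJet.unique {s : M → P} {x : M} {j j' : Jet E k π} (h : HasJet E k π s x j)
    (h' : HasJet E k π s x j') : j = j' :=
  h.eq_of_contact h' rfl fun _ _ _ _ _ _ _ => rfl

lemma HasJet.res {l : ℕ} (hl : l ≤ k) {s : M → P} {x : M} {j : Jet E k π} (h : HasJet E k π s x j) :
    HasJet E l π s x (j.res hl) := by
  obtain ⟨h1, rfl⟩ := h
  exact ⟨h1, rfl⟩

lemma Jet.val_res {l : ℕ} (hl : l ≤ k) (j : Jet E k π) : (j.res hl).val = j.val := by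
  obtain ⟨s, x, h⟩ := exists_hasJet j
  rw [h.val_eq, (h.res hl).val_eq]

lemma Jet.base_res {l : ℕ} (hl : l ≤ k) (j : Jet E k π) : (j.res hl).base = j.base := by
  obtain ⟨s, x, h⟩ := exists_hasJet j
  rw [h.base_eq, (h.res hl).base_eq]

/-- A plot of a jet space is locally represented by a smooth family of sections. -/
lemma exists_family_of_isPlot {n : ℕ} {p : RSp n → Jet E k π} (hp : IsPlot p) (u₀ : RSp n) :
    ∃ (x : RSp n → M) (s : RSp n → M → P), ContMDiffNear 𝓘(ℝ, RSp n) 𝓘(ℝ, E) x u₀ ∧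
      SmoothNear (𝓘(ℝ, RSp n).prod 𝓘(ℝ, E)) (fun z : RSp n × M => s z.1 z.2) (u₀, x u₀) ∧
      ∀ᶠ u in 𝓝 u₀, HasJet E k π (s u) (x u) (p u) := by
  obtain ⟨x, s, ⟨U, hU, hx⟩, hs, h⟩ := hp u₀
  exact ⟨x, s, hx.contMDiffNear hU, hs, h⟩

/-- The jets of a smooth family of sections form a smooth family. -/
lemma smoothNear_jet {p : A → Jet E k π} {a : A} {x : A → M} {s : A → M → P}
    (hx : ContMDiffNear I 𝓘(ℝ, E) x a)
    (hs : SmoothNear (I.prod 𝓘(ℝ, E)) (fun z : A × M => s z.1 z.2) (a, x a))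
    (h : ∀ᶠ b in 𝓝 a, HasJet E k π (s b) (x b) (p b)) : SmoothNear I p a := by
  have hc : Tendsto (fun b => (b, x b)) (𝓝 a) (𝓝 (a, x a)) :=
    continuousAt_id.prodMk hx.continuousAt
  refine ⟨_, hx.eventually.and ((hc.eventually hs.eventually).and h.eventually_nhds), ?_⟩
  intro n q hq hqU u₀
  refine ⟨x ∘ q, fun u => s (q u), ?_, ?_, ?_⟩
  · exact ((hqU u₀).1.comp (hq.contMDiffNear u₀)).exists_contMDiffOn
  · refine SmoothNear.comp_contMDiffNear (f := fun z : A × M => s z.1 z.2)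
      (g := fun z : RSp n × M => (q z.1, z.2)) (b := (u₀, x (q u₀))) (hqU u₀).2.1 ?_
    exact ((hq.comp contMDiff_fst).prodMk contMDiff_snd).contMDiffNear _
  · exact hq.continuous.continuousAt.eventually (hqU u₀).2.2

lemma smoothTo_jet_base : SmoothTo 𝓘(ℝ, E) (Jet.base : Jet E k π → M) := by
  intro n p hp u₀
  obtain ⟨x, s, hx, hs, h⟩ := exists_family_of_isPlot hp u₀
  refine hx.contMDiffAt.congr_of_eventuallyEq ?_
  filter_upwards [h] with u hu using hu.base_eq

lemma dSmooth_jet_val : DSmooth (Jet.val : Jet E k π → P) := by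
  intro n p hp
  refine isPlot_of_smoothNear fun u₀ => ?_
  obtain ⟨x, s, hx, hs, h⟩ := exists_family_of_isPlot hp u₀
  refine SmoothNear.congr (f := fun u => s u (x u)) ?_ ?_
  · refine SmoothNear.comp_contMDiffNear (f := fun z : RSp n × M => s z.1 z.2)
      (g := fun u => (u, x u)) hs ?_
    exact (contMDiff_id.contMDiffNear _).prodMk hx
  · filter_upwards [h] with u hu using hu.val_eq

lemma dSmooth_jet_res {l : ℕ} (hl : l ≤ k) : DSmooth (Jet.res hl : Jet E k π → Jet E l π) := by
  intro n p hp u₀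
  obtain ⟨x, s, hx, hs, h⟩ := hp u₀
  exact ⟨x, s, hx, hs, h.mono fun u hu => hu.res hl⟩

end Jets

/-! ### Vertical vectors -/

section Vertical

variable {M P : Type*} [DiffeologicalSpace P] {π : P → M}
  {E' H' A : Type*} [NormedAddCommGroup E'] [NormedSpace ℝ E'] [TopologicalSpace H']
  {I : ModelWithCorners ℝ E' H'} [TopologicalSpace A] [ChartedSpace H' A]

lemma HasVelocity.pt_eq {γ : ℝ → P} {v : VBundle π} (h : HasVelocity π γ v) : v.pt = γ 0 := by
  obtain ⟨_, rfl⟩ := h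
  rfl

lemma IsVerticalCurve.hasVelocity {γ : ℝ → P} (h : IsVerticalCurve π γ) :
    HasVelocity π γ (VerticalCurve.velocity ⟨γ, h⟩) := ⟨h, rfl⟩

lemma HasVelocity.tangent {γ γ' : ℝ → P} {v : VBundle π} (h : HasVelocity π γ v)
    (h' : HasVelocity π γ' v) : γ 0 = γ' 0 ∧ ∀ f : P → ℝ, DSmooth f →
      deriv (fun t => f (γ t)) 0 = deriv (fun t => f (γ' t)) 0 := by
  obtain ⟨h1, rfl⟩ := h
  obtain ⟨h2, he⟩ := h'
  exact Quotient.exact he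

lemma HasVelocity.eq_of_tangent {γ γ' : ℝ → P} {v v' : VBundle π} (h : HasVelocity π γ v)
    (h' : HasVelocity π γ' v') (h0 : γ 0 = γ' 0) (hf : ∀ f : P → ℝ, DSmooth f →
      deriv (fun t => f (γ t)) 0 = deriv (fun t => f (γ' t)) 0) : v = v' := by
  obtain ⟨h1, rfl⟩ := h
  obtain ⟨h2, rfl⟩ := h'
  exact Quotient.sound ⟨h0, hf⟩

lemma HasVelocity.congr {γ γ' : ℝ → P} {v : VBundle π} (h : HasVelocity π γ v)
    (hγ : γ' =ᶠ[𝓝 0] γ) : HasVelocity π γ' v := by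
  obtain ⟨h1, rfl⟩ := h
  have h2 : IsVerticalCurve π γ' := ⟨h1.1.congr hγ, by
    filter_upwards [h1.2, hγ] with t ht ht'
    rw [ht', ht, hγ.self_of_nhds]⟩
  have h3 := h2.hasVelocity
  rwa [h3.eq_of_tangent h1.hasVelocity hγ.self_of_nhds] at h3
  intro f _
  refine Filter.EventuallyEq.deriv_eq ?_
  filter_upwards [hγ] with t ht
  rw [ht]

/-- The velocities of a smooth family of curves form a smooth family. -/
lemma smoothNear_velocity {p : A → VBundle π} {a : A} {γ : A → ℝ → P}
    (hγ : SmoothNear (I.prod 𝓘(ℝ, ℝ)) (fun z : A × ℝ => γ z.1 z.2) (a, 0))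
    (h : ∀ᶠ b in 𝓝 a, HasVelocity π (γ b) (p b)) : SmoothNear I p a := by
  have hc : Tendsto (fun b => (b, (0 : ℝ))) (𝓝 a) (𝓝 (a, 0)) :=
    continuousAt_id.prodMk continuousAt_const
  refine ⟨_, (hc.eventually hγ.eventually).and h.eventually_nhds, ?_⟩
  intro n q hq hqU u₀
  refine ⟨fun u => γ (q u), ?_, hq.continuous.continuousAt.eventually (hqU u₀).2⟩
  refine SmoothNear.comp_contMDiffNear (f := fun z : A × ℝ => γ z.1 z.2)
    (g := fun z : RSp n × ℝ => (q z.1, z.2)) (b := (u₀, (0 : ℝ))) (hqU u₀).1 ?_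
  exact ((hq.comp contMDiff_fst).prodMk contMDiff_snd).contMDiffNear _

lemma dSmooth_pt : DSmooth (VBundle.pt : VBundle π → P) := by
  intro n p hp
  refine isPlot_of_smoothNear fun u₀ => ?_
  obtain ⟨γ, hγ, h⟩ := hp u₀
  refine SmoothNear.congr (f := fun u => γ u 0) ?_ (h.mono fun u hu => hu.pt_eq)
  exact SmoothNear.comp_contMDiffNear (f := fun z : RSp n × ℝ => γ z.1 z.2)
    (g := fun u => (u, (0 : ℝ))) hγ ((contMDiff_id.prodMk contMDiff_const).contMDiffNear _)

end Vertical

/-! ### Order of contact -/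

section Germs

open Asymptotics

variable {X V : Type*} [NormedAddCommGroup X] [NormedSpace ℝ X]
  [NormedAddCommGroup V] [NormedSpace ℝ V]

lemma Filter.EventuallyEq.iteratedFDeriv_real {u u' : V → X} {a : V} (h : u =ᶠ[𝓝 a] u')
    (i : ℕ) : iteratedFDeriv ℝ i u =ᶠ[𝓝 a] iteratedFDeriv ℝ i u' := by
  have := Filter.EventuallyEq.iteratedFDerivWithin (𝕜 := ℝ) (s := univ) (x := a)
    (by simpa using h) i
  simpa [iteratedFDerivWithin_univ] using this

lemma SmoothGerm.contDiffAt {u : V → X} {a : V} (h : SmoothGerm u a) : ContDiffAt ℝ ∞ u a :=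
  h.self_of_nhds

lemma SmoothGerm.sub {u u' : V → X} {a : V} (h : SmoothGerm u a) (h' : SmoothGerm u' a) :
    SmoothGerm (fun y => u y - u' y) a := by
  filter_upwards [h, h'] with y hy hy' using hy.sub hy'

/-- Two germs have contact of order `k` if and only if their Taylor coefficients up to order `k`
coincide. -/
lemma SmoothGerm.sub_isBigO_iff [FiniteDimensional ℝ V] {u u' : V → X} {a : V}
    (h : SmoothGerm u a) (h' : SmoothGerm u' a) {k : ℕ} :
    (fun y => u y - u' y) =O[𝓝 a] (fun y => ‖y - a‖ ^ (k + 1)) ↔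
      ∀ i ≤ k, iteratedFDeriv ℝ i u a = iteratedFDeriv ℝ i u' a := by
  have : ProperSpace V := FiniteDimensional.proper_real V
  obtain ⟨w, hw, hwu⟩ := (h.sub h').exists_contDiff
  have hd : ∀ i, iteratedFDeriv ℝ i w a = iteratedFDeriv ℝ i u a - iteratedFDeriv ℝ i u' a := by
    intro i
    rw [(hwu.iteratedFDeriv_real i).self_of_nhds]
    exact iteratedFDeriv_sub_apply (h.contDiffAt.of_le (natCast_le_infty i))
      (h'.contDiffAt.of_le (natCast_le_infty i))
  constructor
  · intro hO i hi
    have := vanishesTo_of_isBigO hw (hO.congr' hwu.symm .rfl) i hi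
    rwa [hd, sub_eq_zero] at this
  · intro hi
    have : VanishesTo k w a := fun i hik => by rw [hd, hi i hik, sub_self]
    exact (this.isBigO hw).congr' hwu .rfl

/-- Contact of order `k + r` of two germs implies contact of order `k` of their `r`-th
derivatives. -/
lemma SmoothGerm.iteratedFDeriv_sub_isBigO [FiniteDimensional ℝ V] {u u' : V → X} {a : V}
    (h : SmoothGerm u a) (h' : SmoothGerm u' a) {k r : ℕ}
    (hO : (fun y => u y - u' y) =O[𝓝 a] (fun y => ‖y - a‖ ^ (k + r + 1))) :
    (fun y => iteratedFDeriv ℝ r u y - iteratedFDeriv ℝ r u' y) =O[𝓝 a]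
      (fun y => ‖y - a‖ ^ (k + 1)) := by
  have : ProperSpace V := FiniteDimensional.proper_real V
  obtain ⟨w, hw, hwu⟩ := (h.sub h').exists_contDiff
  have h1 := (vanishesTo_of_isBigO hw (hO.congr' hwu.symm .rfl)).iteratedFDeriv
  refine (h1.isBigO (hw.iteratedFDeriv_infty r)).congr' ?_ .rfl
  filter_upwards [hwu.iteratedFDeriv_real r, h, h'] with y hy h1 h2
  rw [hy]
  exact iteratedFDeriv_sub_apply (h1.of_le (natCast_le_infty r)) (h2.of_le (natCast_le_infty r))

lemma SmoothGerm.iteratedDeriv_eq_of_isBigO {g g' : ℝ → X} (h : SmoothGerm g 0)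
    (h' : SmoothGerm g' 0) {k : ℕ} (hO : (fun t => g t - g' t) =O[𝓝 0] fun t => t ^ (k + 1))
    {i : ℕ} (hi : i ≤ k) : iteratedDeriv i g 0 = iteratedDeriv i g' 0 := by
  have := (h.sub_isBigO_iff h' (k := k)).1 (hO.trans (IsBigO.of_bound 1 (.of_forall fun t => by
    simp))) i hi
  rw [iteratedDeriv_eq_iteratedFDeriv, this, iteratedDeriv_eq_iteratedFDeriv]

lemma iteratedDeriv_clm_comp {g : ℝ → X} {t : ℝ} (hg : ContDiffAt ℝ ∞ g t) (ℓ : X →L[ℝ] ℝ) (i : ℕ) :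
    iteratedDeriv i (fun s => ℓ (g s)) t = ℓ (iteratedDeriv i g t) := by
  rw [iteratedDeriv_eq_iteratedFDeriv, iteratedDeriv_eq_iteratedFDeriv,
    show (fun s => ℓ (g s)) = ℓ ∘ g from rfl, ℓ.iteratedFDeriv_comp_left hg (natCast_le_infty i)]
  rfl

end Germs

section ChartEstimates

open Asymptotics

variable {E H A X : Type*} [NormedAddCommGroup E] [NormedSpace ℝ E] [TopologicalSpace H]
  {I : ModelWithCorners ℝ E H} [TopologicalSpace A] [ChartedSpace H A] [NormedAddCommGroup X]

/-- Asymptotic estimates at `x` may be checked in a chart. -/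
lemma EuclideanChart.isBigO_comp_inv {n k : ℕ} (c : EuclideanChart I A n) {x : A}
    (hx : x ∈ c.source) {g : A → X}
    (h : (fun v => g (c.inv v)) =O[𝓝 (c.toFun x)] fun v => ‖v - c.toFun x‖ ^ k) :
    g =O[𝓝 x] fun y => ‖c.toFun y - c.toFun x‖ ^ k := by
  refine (h.comp_tendsto (c.continuousAt_toFun hx)).congr' ?_ .rfl
  filter_upwards [c.source_mem_nhds hx] with y hy
  simp [c.left_inv y hy]

end ChartEstimates

/-! ### Fibred charts -/

section FibredCharts

open Asymptotics

variable {E M P : Type*} [NormedAddCommGroup E] [NormedSpace ℝ E]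
  [TopologicalSpace M] [ChartedSpace E M] [DiffeologicalSpace P]

/-- Fibre coordinates with values in `F` on a part `source` of a smooth space `π : P → M` over `M`:
the map `(π, coord)` has the left inverse `param`, defined and smooth near its image. (The
coordinates may be redundant: `coord` need not be a left inverse of `param`.) The function
`coord` is smooth on all of `P`, like the functions by which jets and vertical vectors are
compared. -/
structure FibredChart (E : Type*) [NormedAddCommGroup E] [NormedSpace ℝ E]
    {M P : Type*} [TopologicalSpace M] [ChartedSpace E M] [DiffeologicalSpace P] (π : P → M)
    (F : Type*) [NormedAddCommGroup F] [NormedSpace ℝ F] where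
  source : Set P
  isOpen_source : IsOpen[dTopology] source
  coord : P → F
  smoothTo_coord : SmoothTo 𝓘(ℝ, F) coord
  param : M × F → P
  smoothNear_param : ∀ p ∈ source, SmoothNear (𝓘(ℝ, E).prod 𝓘(ℝ, F)) param (π p, coord p)
  proj_param : ∀ p ∈ source, ∀ᶠ z in 𝓝 (π p, coord p), π (param z) = z.1
  param_coord : ∀ p ∈ source, param (π p, coord p) = p

variable {F : Type*} [NormedAddCommGroup F] [NormedSpace ℝ F] {π : P → M}
  {X : Type*} [NormedAddCommGroup X] [NormedSpace ℝ X]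

lemma FibredChart.eq_of_coord_eq (C : FibredChart E π F) {p q : P} (hp : p ∈ C.source)
    (hq : q ∈ C.source) (h : π p = π q) (h' : C.coord p = C.coord q) : p = q := by
  rw [← C.param_coord p hp, ← C.param_coord q hq, h, h']

variable [FiniteDimensional ℝ E] [IsManifold 𝓘(ℝ, E) ∞ M]

/-- In terms of the parameters, smooth functions are locally Lipschitz along the fibres. -/
lemma FibredChart.param_sub_isBigO [FiniteDimensional ℝ F] (C : FibredChart E π F)
    {ι : Type*} {L : Filter ι} {y : ι → M} {a a' : ι → F} {x : M} {f : F}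
    (hC : SmoothNear (𝓘(ℝ, E).prod 𝓘(ℝ, F)) C.param (x, f))
    (hy : Tendsto y L (𝓝 x)) (ha : Tendsto a L (𝓝 f))
    (ha' : Tendsto a' L (𝓝 f)) {G : P → X} (hG : SmoothTo 𝓘(ℝ, X) G) :
    (fun i => G (C.param (y i, a i)) - G (C.param (y i, a' i))) =O[L] fun i => a i - a' i := by
  obtain ⟨n, c, hx, -⟩ := exists_euclideanChart 𝓘(ℝ, E) x univ_mem
  have h1 : ContMDiffNear (𝓘(ℝ, RSp n).prod 𝓘(ℝ, F)) 𝓘(ℝ, X)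
      (fun z : RSp n × F => G (C.param (c.inv z.1, z.2))) (c.toFun x, f) := by
    refine ContMDiffNear.comp (J := 𝓘(ℝ, E).prod 𝓘(ℝ, F)) (g := fun z => G (C.param z))
      (f := fun z : RSp n × F => (c.inv z.1, z.2)) ?_ ?_
    · simpa only [c.left_inv _ hx] using hC.smoothTo_comp hG
    · exact ((c.contMDiff_inv.comp contMDiff_fst).prodMk contMDiff_snd).contMDiffNear _
  obtain ⟨K, t, ht, hK⟩ := (h1.smoothGerm_prod.contDiffAt.of_le
    (natCast_le_infty 1)).exists_lipschitzOnWith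
  have hcx := (c.continuousAt_toFun hx).tendsto.comp hy
  refine IsBigO.of_bound K ?_
  filter_upwards [(hcx.prodMk_nhds ha).eventually ht, (hcx.prodMk_nhds ha').eventually ht,
    hy.eventually (c.source_mem_nhds hx)] with i h1 h2 h3
  have := hK.dist_le_mul _ h1 _ h2
  simpa [Prod.dist_eq, c.left_inv _ h3, dist_eq_norm] using this

/-- Along the fibres, smooth functions are locally Lipschitz in the coordinates. -/
lemma FibredChart.sub_isBigO_coord_sub [FiniteDimensional ℝ F] (C : FibredChart E π F)
    {ι : Type*} {L : Filter ι} {p p' : ι → P} {q : P} (hq : q ∈ C.source)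
    (hp : ∀ᶠ i in L, p i ∈ C.source) (hp' : ∀ᶠ i in L, p' i ∈ C.source)
    (hπ : ∀ᶠ i in L, π (p i) = π (p' i)) (hlim : Tendsto (fun i => π (p i)) L (𝓝 (π q)))
    (hc : Tendsto (fun i => C.coord (p i)) L (𝓝 (C.coord q)))
    (hc' : Tendsto (fun i => C.coord (p' i)) L (𝓝 (C.coord q)))
    {G : P → X} (hG : SmoothTo 𝓘(ℝ, X) G) :
    (fun i => G (p i) - G (p' i)) =O[L] fun i => C.coord (p i) - C.coord (p' i) := by
  refine (C.param_sub_isBigO (C.smoothNear_param q hq) hlim hc hc' hG).congr' ?_ .rfl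
  filter_upwards [hp, hp', hπ] with i hi hi' hπi
  rw [C.param_coord _ hi, hπi, C.param_coord _ hi']

/-- Sections whose parameters have contact of order `k` have the same `k`-jet. -/
lemma HasJet.eq_of_param_isBigO [FiniteDimensional ℝ F] (C : FibredChart E π F) {k n : ℕ}
    (c : EuclideanChart 𝓘(ℝ, E) M n) {x : M} (hx : x ∈ c.source) {f₀ : F}
    (hC : SmoothNear (𝓘(ℝ, E).prod 𝓘(ℝ, F)) C.param (x, f₀)) {s s' : M → P}
    {j j' : Jet E k π} (h : HasJet E k π s x j)
    (h' : HasJet E k π s' x j') {a a' : M → F} (hs : ∀ᶠ y in 𝓝 x, s y = C.param (y, a y))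
    (hs' : ∀ᶠ y in 𝓝 x, s' y = C.param (y, a' y))
    (ha : Tendsto a (𝓝 x) (𝓝 f₀)) (ha' : Tendsto a' (𝓝 x) (𝓝 f₀))
    (hO : (fun y => a y - a' y) =O[𝓝 x] fun y => ‖c.toFun y - c.toFun x‖ ^ (k + 1)) :
    j = j' := by
  -- `a x = f₀`, as `a` converges to `f₀` along the pure filter at `x`; likewise for `a'`
  have h0 : s x = s' x := by
    rw [hs.self_of_nhds, hs'.self_of_nhds,
      tendsto_nhds_unique (tendsto_pure_nhds a x) (ha.mono_left (pure_le_nhds _)),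
      tendsto_nhds_unique (tendsto_pure_nhds a' x) (ha'.mono_left (pure_le_nhds _))]
  refine h.eq_of_contact h' h0 fun f hf γ hγ hγ0 i hi => ?_
  have hγt : Tendsto γ (𝓝 0) (𝓝 x) := by simpa [hγ0] using hγ.continuous.tendsto 0
  have hγn : ContMDiffNear 𝓘(ℝ, ℝ) 𝓘(ℝ, E) γ 0 := hγ.contMDiffNear 0
  have hsm : ∀ {s : M → P}, IsLocalSection E π s x → SmoothGerm (fun t => f (s (γ t))) 0 :=
    fun {s} hs => (ContMDiffNear.comp (g := fun y => f (s y)) (f := γ)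
      (by rw [hγ0]; exact hs.1.smoothTo_comp hf.smoothTo) hγn).smoothGerm
  refine (hsm h.1).iteratedDeriv_eq_of_isBigO (hsm h'.1) (k := k) ?_ hi
  have key : (fun t => f (s (γ t)) - f (s' (γ t))) =O[𝓝 0] fun t => a (γ t) - a' (γ t) := by
    refine (C.param_sub_isBigO hC hγt (ha.comp hγt) (ha'.comp hγt) hf.smoothTo).congr' ?_ .rfl
    filter_upwards [hγt.eventually hs, hγt.eventually hs'] with t h1 h2
    rw [h1, h2]
    rfl
  refine key.trans ((hO.comp_tendsto hγt).trans ?_)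
  have hd : SmoothGerm (fun t => c.toFun (γ t)) 0 :=
    (ContMDiffNear.comp (g := c.toFun) (f := γ) (by rw [hγ0]; exact c.contMDiffNear_toFun hx)
      hγn).smoothGerm
  have hb : (fun t => c.toFun (γ t) - c.toFun x) =O[𝓝 0] fun t : ℝ => t := by
    have := (hd.contDiffAt.differentiableAt (by simp)).isBigO_sub
    simpa [hγ0] using this
  exact hb.norm_left.pow (k + 1)

/-- Sections whose coordinates have contact of order `k` have the same `k`-jet. -/
lemma HasJet.eq_of_coord_isBigO [FiniteDimensional ℝ F] (C : FibredChart E π F)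
    {k n : ℕ} (c : EuclideanChart 𝓘(ℝ, E) M n) {x : M} (hx : x ∈ c.source) {s s' : M → P}
    {j j' : Jet E k π} (h : HasJet E k π s x j) (h' : HasJet E k π s' x j') (h0 : s x = s' x)
    (hs : s x ∈ C.source)
    (hO : (fun y => C.coord (s y) - C.coord (s' y)) =O[𝓝 x]
      fun y => ‖c.toFun y - c.toFun x‖ ^ (k + 1)) : j = j' := by
  have hev : ∀ {s : M → P}, IsLocalSection E π s x → s x ∈ C.source →
      ∀ᶠ y in 𝓝 x, s y = C.param (y, C.coord (s y)) := by
    intro s h hs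
    filter_upwards [h.2, h.1.eventually_mem C.isOpen_source hs] with y h1 h2
    have := C.param_coord _ h2
    rw [h1] at this
    exact this.symm
  have hπx : π (s x) = x := h.1.2.self_of_nhds
  have hc := (h.1.1.smoothTo_comp C.smoothTo_coord).continuousAt
  have hc' := (h'.1.1.smoothTo_comp C.smoothTo_coord).continuousAt
  have hC := C.smoothNear_param _ hs
  rw [hπx] at hC
  exact HasJet.eq_of_param_isBigO C c hx hC h h' (hev h.1 hs) (hev h'.1 (h0 ▸ hs)) hc
    (by rw [h0]; exact hc') hO

lemma IsLocalSection.smoothGerm {n : ℕ} (c : EuclideanChart 𝓘(ℝ, E) M n) {x : M}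
    (hx : x ∈ c.source) {s : M → P} (h : IsLocalSection E π s x) {G : P → X}
    (hG : SmoothTo 𝓘(ℝ, X) G) : SmoothGerm (fun v => G (s (c.inv v))) (c.toFun x) :=
  (ContMDiffNear.comp (g := fun y => G (s y)) (f := c.inv)
    (by rw [c.left_inv x hx]; exact h.1.smoothTo_comp hG)
    (c.contMDiff_inv.contMDiffNear _)).smoothGerm

/-- Sections with the same `k`-jet have contact of order `k`, for all smooth functions. -/
lemma HasJet.iteratedFDeriv_eq {k n : ℕ} (c : EuclideanChart 𝓘(ℝ, E) M n) {x : M}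
    (hx : x ∈ c.source) {s s' : M → P} {j : Jet E k π}
    (h : HasJet E k π s x j) (h' : HasJet E k π s' x j) {G : P → X} (hG : SmoothTo 𝓘(ℝ, X) G) :
    ∀ i ≤ k, iteratedFDeriv ℝ i (fun v => G (s (c.inv v))) (c.toFun x) =
      iteratedFDeriv ℝ i (fun v => G (s' (c.inv v))) (c.toFun x) := by
  have hls := h.1.smoothGerm c hx hG
  have hls' := h'.1.smoothGerm c hx hG
  obtain ⟨w, hw, hwu⟩ := (hls.sub hls').exists_contDiff
  have hv : VanishesTo k w (c.toFun x) := by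
    refine vanishesTo_of_lines hw fun e i hi => ?_
    -- contact along the curves which are lines in the chart, tested by linear functionals of `G`
    rw [SeparatingDual.eq_zero_iff_forall_dual_eq_zero (R := ℝ)]
    intro ℓ
    have hline : ContDiff ℝ ∞ fun t : ℝ => c.toFun x + t • e := by fun_prop
    have ht : Tendsto (fun t : ℝ => c.toFun x + t • e) (𝓝 0) (𝓝 (c.toFun x)) := by
      simpa using hline.continuous.tendsto 0
    rw [← iteratedDeriv_clm_comp (by fun_prop)]
    have hev : (fun t : ℝ => ℓ (w (c.toFun x + t • e))) =ᶠ[𝓝 0] fun t =>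
        ℓ (G (s (c.inv (c.toFun x + t • e)))) - ℓ (G (s' (c.inv (c.toFun x + t • e)))) := by
      filter_upwards [ht.eventually hwu] with t ht
      rw [ht, map_sub]
    have hg : ∀ {u : RSp n → X}, SmoothGerm u (c.toFun x) →
        ContDiffAt ℝ i (fun t : ℝ => ℓ (u (c.toFun x + t • e))) 0 := by
      intro u hu
      refine ContDiffAt.of_le ?_ (natCast_le_infty i)
      refine ℓ.contDiff.contDiffAt.comp (0 : ℝ) (ContDiffAt.comp (0 : ℝ) ?_ hline.contDiffAt)
      simpa using hu.contDiffAt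
    rw [hev.iteratedDeriv_eq, iteratedDeriv_fun_sub (hg hls) (hg hls'), sub_eq_zero]
    have hdG : DSmooth fun p => ℓ (G p) :=
      dSmooth_of_smoothTo (ℓ.contDiff.contMDiff.comp_smoothTo hG)
    exact (h.contact h').2.2 _ hdG (fun t : ℝ => c.inv (c.toFun x + t • e))
      (c.contMDiff_inv.comp hline.contMDiff) (by simp [c.left_inv x hx]) i hi
  intro i hi
  have := hv i hi
  rw [(hwu.iteratedFDeriv_real i).self_of_nhds] at this
  rw [← sub_eq_zero, ← this]
  exact (iteratedFDeriv_sub_apply (hls.contDiffAt.of_le (natCast_le_infty i))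
      (hls'.contDiffAt.of_le (natCast_le_infty i))).symm

/-- Contact of order `k` of sections with the same `k`-jet, as an estimate. -/
lemma HasJet.sub_isBigO {k n : ℕ} (c : EuclideanChart 𝓘(ℝ, E) M n) {x : M}
    (hx : x ∈ c.source) {s s' : M → P} {j : Jet E k π}
    (h : HasJet E k π s x j) (h' : HasJet E k π s' x j) {G : P → X} (hG : SmoothTo 𝓘(ℝ, X) G) :
    (fun y => G (s y) - G (s' y)) =O[𝓝 x] fun y => ‖c.toFun y - c.toFun x‖ ^ (k + 1) := by
  refine c.isBigO_comp_inv hx ?_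
  rw [(h.1.smoothGerm c hx hG).sub_isBigO_iff (h'.1.smoothGerm c hx hG)]
  exact h.iteratedFDeriv_eq c hx h' hG

end FibredCharts

/-! ### Derivatives along vertical vectors -/

section VerticalDerivative

variable {M P : Type*} [DiffeologicalSpace P] {π : P → M}
  {X : Type*} [NormedAddCommGroup X] [NormedSpace ℝ X]

lemma HasVelocity.unique_of_eventuallyEq {γ γ' : ℝ → P} {v v' : VBundle π}
    (h : HasVelocity π γ v) (h' : HasVelocity π γ' v') (hγ : γ =ᶠ[𝓝 0] γ') : v = v' :=
  h.eq_of_tangent (h'.congr hγ) rfl fun _ _ => rfl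

/-- The derivative of a function `G` on `P` along a vertical vector. -/
def vderiv (π : P → M) (G : P → X) (v : VBundle π) : X :=
  deriv (fun t => G ((Quotient.out v).toFun t)) 0

lemma IsVerticalCurve.contDiffAt {γ : ℝ → P} (h : IsVerticalCurve π γ) {G : P → X}
    (hG : SmoothTo 𝓘(ℝ, X) G) : ContDiffAt ℝ ∞ (fun t => G (γ t)) 0 :=
  (h.1.smoothTo_comp hG).smoothGerm.contDiffAt

lemma IsVerticalCurve.differentiableAt {γ : ℝ → P} (h : IsVerticalCurve π γ) {G : P → X}
    (hG : SmoothTo 𝓘(ℝ, X) G) : DifferentiableAt ℝ (fun t => G (γ t)) 0 :=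
  (h.contDiffAt hG).differentiableAt (by simp)

/-- The defining relation of vertical vectors concerns real functions; linear functionals extend it
to functions with values in `X`. -/
lemma HasVelocity.vderiv_eq {γ : ℝ → P} {v : VBundle π} (h : HasVelocity π γ v) {G : P → X}
    (hG : SmoothTo 𝓘(ℝ, X) G) : vderiv π G v = deriv (fun t => G (γ t)) 0 := by
  have h0 : HasVelocity π (Quotient.out v).toFun v :=
    ⟨(Quotient.out v).isVerticalCurve, (Quotient.out_eq v).symm⟩
  rw [SeparatingDual.eq_iff_forall_dual_eq (R := ℝ)]
  intro ℓ
  have hℓ : ∀ {γ : ℝ → P}, IsVerticalCurve π γ →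
      ℓ (deriv (fun t => G (γ t)) 0) = deriv (fun t => ℓ (G (γ t))) 0 := fun {γ} hγ =>
    (ℓ.hasFDerivAt.comp_hasDerivAt (0 : ℝ) (hγ.differentiableAt hG).hasDerivAt).deriv.symm
  rw [vderiv, hℓ h0.1, hℓ h.1]
  exact (h0.tangent h).2 _ (dSmooth_of_smoothTo (ℓ.contDiff.contMDiff.comp_smoothTo hG))

/-- The derivative of a smooth family of curves is smooth in the parameter. -/
lemma SmoothGerm.deriv_snd {V : Type*} [NormedAddCommGroup V] [NormedSpace ℝ V]
    [FiniteDimensional ℝ V] {U : V × ℝ → X} {a : V} (h : SmoothGerm U (a, 0)) :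
    ContDiffAt ℝ ∞ (fun u => deriv (fun t => U (u, t)) 0) a := by
  obtain ⟨U', hU', hUU'⟩ := h.exists_contDiff
  have hd : Differentiable ℝ U' := hU'.differentiable (by simp)
  have h1 : ContDiff ℝ ∞ fun u : V => fderiv ℝ U' (u, 0) (0, 1) :=
    (hU'.fderiv_infty.comp (contDiff_id.prodMk contDiff_const)).clm_apply contDiff_const
  refine h1.contDiffAt.congr_of_eventuallyEq ?_
  have hc : Tendsto (fun u : V => (u, (0 : ℝ))) (𝓝 a) (𝓝 (a, 0)) :=
    continuousAt_id.prodMk continuousAt_const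
  filter_upwards [hc.eventually hUU'.eventually_nhds] with u hu
  have hc' : Tendsto (fun t : ℝ => (u, t)) (𝓝 0) (𝓝 (u, 0)) :=
    continuousAt_const.prodMk continuousAt_id
  have h2 : (fun t => U (u, t)) =ᶠ[𝓝 0] fun t => U' (u, t) := by
    filter_upwards [hc'.eventually hu] with t ht using ht.symm
  rw [h2.deriv_eq]
  exact ((hd (u, 0)).hasFDerivAt.comp_hasDerivAt (0 : ℝ)
    ((hasDerivAt_const (0 : ℝ) u).prodMk (hasDerivAt_id (0 : ℝ)))).deriv

lemma smoothTo_vderiv {G : P → X} (hG : SmoothTo 𝓘(ℝ, X) G) :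
    SmoothTo 𝓘(ℝ, X) (vderiv π G) := by
  intro n p hp u₀
  obtain ⟨γ, hγ, h⟩ := hp u₀
  have h1 := (hγ.smoothTo_comp hG).smoothGerm_prod.deriv_snd
  refine (h1.congr_of_eventuallyEq ?_).contMDiffAt
  filter_upwards [h] with u hu using hu.vderiv_eq hG

open Classical in
/-- The velocity of a curve, or the zero vector at its initial point if the curve is not
vertical. -/
def velocityOrZero (π : P → M) (γ : ℝ → P) : VBundle π :=
  if h : IsVerticalCurve π γ then VerticalCurve.velocity ⟨γ, h⟩ else zeroVector π (γ 0)

lemma hasVelocity_velocityOrZero {γ : ℝ → P} (h : IsVerticalCurve π γ) :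
    HasVelocity π γ (velocityOrZero π γ) :=
  ⟨h, by rw [velocityOrZero, dif_pos h]⟩

lemma velocityOrZero_pt (γ : ℝ → P) : (velocityOrZero π γ).pt = γ 0 := by
  unfold velocityOrZero
  split_ifs <;> rfl

end VerticalDerivative

/-! ### Charts of vertical bundles -/

section VerticalChart

open Asymptotics

variable {E M P : Type*} [NormedAddCommGroup E] [NormedSpace ℝ E]
  [TopologicalSpace M] [ChartedSpace E M] [DiffeologicalSpace P]
  {F : Type*} [NormedAddCommGroup F] [NormedSpace ℝ F] {π : P → M}

lemma FibredChart.smoothNear_line (C : FibredChart E π F) {p : P} (hp : p ∈ C.source) (f' : F) :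
    SmoothNear ((𝓘(ℝ, E).prod 𝓘(ℝ, F × F)).prod 𝓘(ℝ, ℝ))
      (fun w : (M × F × F) × ℝ => C.param (w.1.1, w.1.2.1 + w.2 • w.1.2.2))
      ((π p, C.coord p, f'), 0) := by
  refine SmoothNear.comp_contMDiffNear (I := 𝓘(ℝ, E).prod 𝓘(ℝ, F)) (f := C.param)
    (g := fun w : (M × F × F) × ℝ => (w.1.1, w.1.2.1 + w.2 • w.1.2.2)) ?_ ?_
  · simpa using C.smoothNear_param p hp
  · refine ContMDiff.contMDiffNear ?_ _
    refine (contMDiff_fst.comp contMDiff_fst).prodMk ?_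
    have h1 : ContMDiff ((𝓘(ℝ, E).prod 𝓘(ℝ, F × F)).prod 𝓘(ℝ, ℝ)) 𝓘(ℝ, (F × F) × ℝ) ∞
        fun w : (M × F × F) × ℝ => (w.1.2, w.2) :=
      (contMDiff_snd.comp contMDiff_fst).prodMk_space contMDiff_snd
    have h2 : ContDiff ℝ ∞ fun z : (F × F) × ℝ => z.1.1 + z.2 • z.1.2 := by fun_prop
    exact h2.contMDiff.comp h1

lemma FibredChart.eventually_isVerticalCurve (C : FibredChart E π F) {p : P} (hp : p ∈ C.source)
    (f' : F) : ∀ᶠ z : M × F × F in 𝓝 (π p, C.coord p, f'),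
      IsVerticalCurve π (fun t => C.param (z.1, z.2.1 + t • z.2.2)) := by
  have hc : Tendsto (fun z : M × F × F => (z, (0 : ℝ))) (𝓝 (π p, C.coord p, f'))
      (𝓝 ((π p, C.coord p, f'), 0)) := continuousAt_id.prodMk continuousAt_const
  have hc' : Tendsto (fun z : M × F × F => (z.1, z.2.1)) (𝓝 (π p, C.coord p, f'))
      (𝓝 (π p, C.coord p)) := by
    have : Continuous fun z : M × F × F => (z.1, z.2.1) := by fun_prop
    exact this.tendsto _
  filter_upwards [hc.eventually (C.smoothNear_line hp f').eventually,
    hc'.eventually (C.proj_param p hp).eventually_nhds] with z h1 h2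
  have hl : Tendsto (fun t : ℝ => (z.1, z.2.1 + t • z.2.2)) (𝓝 0) (𝓝 (z.1, z.2.1)) := by
    have : Continuous fun t : ℝ => (z.1, z.2.1 + t • z.2.2) := by fun_prop
    simpa using this.tendsto 0
  refine ⟨SmoothNear.comp_contMDiffNear
    (f := fun w : (M × F × F) × ℝ => C.param (w.1.1, w.1.2.1 + w.2 • w.1.2.2))
    (g := fun t : ℝ => (z, t)) h1 ((contMDiff_const.prodMk contMDiff_id).contMDiffNear _), ?_⟩
  have h3 := hl.eventually h2
  filter_upwards [h3] with t ht
  rw [ht, h3.self_of_nhds]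

lemma FibredChart.smoothNear_velocity_line (C : FibredChart E π F) {p : P} (hp : p ∈ C.source)
    (f' : F) : SmoothNear (𝓘(ℝ, E).prod 𝓘(ℝ, F × F))
      (fun z : M × F × F => velocityOrZero π fun t => C.param (z.1, z.2.1 + t • z.2.2))
      (π p, C.coord p, f') := by
  refine smoothNear_velocity (γ := fun (z : M × F × F) t => C.param (z.1, z.2.1 + t • z.2.2))
    (C.smoothNear_line hp _) ?_
  filter_upwards [C.eventually_isVerticalCurve hp _] with z hz
  exact hasVelocity_velocityOrZero hz

variable [FiniteDimensional ℝ E] [IsManifold 𝓘(ℝ, E) ∞ M] [FiniteDimensional ℝ F]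

/-- The chart of the vertical bundle induced by a chart of `P`: the coordinates of a vertical vector
are the coordinates of its base point and their derivatives along it. -/
def FibredChart.vertical (C : FibredChart E π F) :
    FibredChart E (fun v : VBundle π => π v.pt) (F × F) where
  source := VBundle.pt ⁻¹' C.source
  isOpen_source := dSmooth_pt.isOpen_preimage C.isOpen_source
  coord v := (C.coord v.pt, vderiv π C.coord v)
  smoothTo_coord := (C.smoothTo_coord.comp_dSmooth dSmooth_pt).prodMk_space
    (smoothTo_vderiv C.smoothTo_coord)
  param z := velocityOrZero π fun t => C.param (z.1, z.2.1 + t • z.2.2)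
  smoothNear_param v hv := C.smoothNear_velocity_line hv _
  proj_param v hv := by
    have hc : Tendsto (fun z : M × F × F => (z.1, z.2.1)) (𝓝 (π v.pt, C.coord v.pt,
        vderiv π C.coord v)) (𝓝 (π v.pt, C.coord v.pt)) := by
      have : Continuous fun z : M × F × F => (z.1, z.2.1) := by fun_prop
      exact this.tendsto _
    filter_upwards [hc.eventually (C.proj_param _ hv)] with z hz
    rw [velocityOrZero_pt]
    simpa using hz
  param_coord v hv := by
    obtain ⟨γ, hγ⟩ := exists_hasVelocity v
    have hv' : γ 0 ∈ C.source := by rw [← hγ.pt_eq]; exact hv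
    have h1 := hasVelocity_velocityOrZero (C.eventually_isVerticalCurve hv
      (vderiv π C.coord v)).self_of_nhds
    have hd := (hγ.1.differentiableAt C.smoothTo_coord).hasDerivAt
    rw [← hγ.vderiv_eq C.smoothTo_coord] at hd
    refine h1.eq_of_tangent hγ ?_ fun f hf => ?_
    · simp [hγ.pt_eq, C.param_coord _ hv']
    have hγt : Tendsto (fun t => C.coord (γ t)) (𝓝 0) (𝓝 (C.coord v.pt)) := by
      rw [hγ.pt_eq]; exact hd.continuousAt
    have hl : Tendsto (fun t : ℝ => C.coord v.pt + t • vderiv π C.coord v) (𝓝 0)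
        (𝓝 (C.coord v.pt)) := by
      have : Continuous fun t : ℝ => C.coord v.pt + t • vderiv π C.coord v := by fun_prop
      simpa using this.tendsto 0
    have hO := C.param_sub_isBigO (y := fun _ => π v.pt) (C.smoothNear_param _ hv)
      tendsto_const_nhds hl hγt hf.smoothTo
    -- in coordinates, `γ` and the line with the same velocity differ by `o(t)`
    have ho : (fun t : ℝ => C.coord v.pt + t • vderiv π C.coord v - C.coord (γ t))
        =o[𝓝 0] fun t : ℝ => t := by
      refine (hasDerivAt_iff_isLittleO.1 hd).neg_left.congr' (.of_forall fun t => ?_)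
        (.of_forall fun t => by simp)
      simp only [hγ.pt_eq, sub_zero]
      abel
    have hfγ := (hγ.1.differentiableAt hf.smoothTo).hasDerivAt
    refine HasDerivAt.deriv ?_
    rw [hasDerivAt_iff_isLittleO] at hfγ ⊢
    have h0 : C.param (π v.pt, C.coord v.pt + (0 : ℝ) • vderiv π C.coord v) = γ 0 := by
      simp [hγ.pt_eq, C.param_coord _ hv']
    refine (hfγ.add ((hO.trans_isLittleO ho).congr_right fun t => (sub_zero t).symm)).congr' ?_ .rfl
    filter_upwards [hγ.1.2, hγ.1.1.eventually_mem C.isOpen_source hv'] with t h1 h2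
    have h3 : C.param (π v.pt, C.coord (γ t)) = γ t := by
      rw [hγ.pt_eq, ← h1]; exact C.param_coord _ h2
    rw [h0, h3]
    abel

end VerticalChart

/-! ### Taylor polynomials -/

section TaylorPolynomials

open Asymptotics

variable {V X : Type*} [NormedAddCommGroup V] [NormedSpace ℝ V]
  [NormedAddCommGroup X] [NormedSpace ℝ X]

/-- Taylor coefficients up to order `r` of maps `V → X`. -/
abbrev JetCoord (V X : Type*) [NormedAddCommGroup V] [NormedSpace ℝ V]
    [NormedAddCommGroup X] [NormedSpace ℝ X] (r : ℕ) := ∀ i : Fin (r + 1), V [×i]→L[ℝ] X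

instance finiteDimensional_continuousMultilinearMap [FiniteDimensional ℝ V] [FiniteDimensional ℝ X]
    (i : ℕ) : FiniteDimensional ℝ (V [×i]→L[ℝ] X) :=
  Module.Finite.of_injective
    (ContinuousMultilinearMap.toMultilinearMapLinear (R' := ℝ) (A := ℝ)
      (M₁ := fun _ : Fin i => V) (M₂ := X))
    ContinuousMultilinearMap.toMultilinearMap_injective

/-- The polynomial with given Taylor coefficients at `0`. -/
def taylorPoly {r : ℕ} (θ : JetCoord V X r) (w : V) : X :=
  ∑ i : Fin (r + 1), ((i : ℕ).factorial : ℝ)⁻¹ • θ i fun _ => w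

lemma contDiff_taylorPoly {r : ℕ} :
    ContDiff ℝ ∞ fun z : JetCoord V X r × V => taylorPoly z.1 z.2 := by
  refine ContDiff.sum fun i _ => contDiff_const.smul ?_
  rw [contDiff_iff_contDiffAt]
  intro z
  exact ContDiffAt.multilinear_apply_diag
    ((contDiff_pi.1 (contDiff_fst (E := JetCoord V X r) (F := V) (𝕜 := ℝ) (n := ∞)) i).contDiffAt)
    contDiff_snd.contDiffAt

lemma taylorPoly_zero {r : ℕ} (θ : JetCoord V X r) : taylorPoly θ 0 = θ 0 fun _ => 0 := by
  unfold taylorPoly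
  rw [Finset.sum_eq_single (0 : Fin (r + 1))]
  · simp
  · intro i _ hi
    have : Nonempty (Fin (i : ℕ)) := ⟨⟨0, by
      have : (i : ℕ) ≠ 0 := fun h => hi (Fin.ext h)
      omega⟩⟩
    rw [show (fun _ : Fin (i : ℕ) => (0 : V)) = 0 from rfl, ContinuousMultilinearMap.map_zero,
      smul_zero]
  · simp

lemma SmoothGerm.sub_taylorPoly_isBigO [FiniteDimensional ℝ V] {u : V → X} {a : V}
    (h : SmoothGerm u a) (r : ℕ) :
    (fun y => u y - taylorPoly (r := r) (fun i => iteratedFDeriv ℝ i u a) (y - a)) =O[𝓝 a]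
      fun y => ‖y - a‖ ^ (r + 1) := by
  have : ProperSpace V := FiniteDimensional.proper_real V
  obtain ⟨u', hu', huu'⟩ := h.exists_contDiff
  refine (taylor_isBigO hu' r a).congr' ?_ .rfl
  filter_upwards [huu'] with y hy
  rw [hy, Finset.sum_range]
  simp only [taylorPoly, (huu'.iteratedFDeriv_real _).self_of_nhds]

end TaylorPolynomials

/-! ### Charts with a cutoff function -/

section CutoffCharts

/-- A chart together with a cutoff function supported in its domain. Products with the cutoff
function extend smooth functions on the domain to the whole manifold. -/
structure CutoffChart {E H : Type*} [NormedAddCommGroup E] [NormedSpace ℝ E] [TopologicalSpace H]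
    (I : ModelWithCorners ℝ E H) (A : Type*) [TopologicalSpace A]
    [ChartedSpace H A] (n : ℕ) extends EuclideanChart I A n where
  cutoff : A → ℝ
  contMDiff_cutoff : ContMDiff I 𝓘(ℝ, ℝ) ∞ cutoff
  tsupport_cutoff : tsupport cutoff ⊆ source

variable {E H A : Type*} [NormedAddCommGroup E] [NormedSpace ℝ E] [TopologicalSpace H]
  {I : ModelWithCorners ℝ E H} [TopologicalSpace A] [ChartedSpace H A] {n : ℕ}

/-- The open set on which the cutoff function is locally equal to `1`. -/
def CutoffChart.core (c : CutoffChart I A n) : Set A := interior {a | c.cutoff a = 1}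

lemma CutoffChart.cutoff_eq_one (c : CutoffChart I A n) {a : A} (ha : a ∈ c.core) :
    c.cutoff a = 1 := interior_subset (s := {a | c.cutoff a = 1}) ha

lemma CutoffChart.core_subset (c : CutoffChart I A n) : c.core ⊆ c.source := fun a ha =>
  c.tsupport_cutoff (subset_tsupport _ (by simp [c.cutoff_eq_one ha]))

lemma exists_cutoffChart (I : ModelWithCorners ℝ E H) [FiniteDimensional ℝ E] [I.Boundaryless]
    [IsManifold I ∞ A] [T2Space A] (a : A) :
    ∃ (n : ℕ) (c : CutoffChart I A n), a ∈ c.core := by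
  obtain ⟨n, c, ha, -⟩ := exists_euclideanChart I a univ_mem
  obtain ⟨f, -, hf⟩ := (SmoothBumpFunction.nhds_basis_tsupport (I := I) a).mem_iff.1
    (c.source_mem_nhds ha)
  exact ⟨n, ⟨c, f, f.contMDiff, hf⟩, mem_interior_iff_mem_nhds.2 f.eventuallyEq_one⟩

end CutoffCharts

/-! ### Charts of jet spaces -/

section JetChart

variable {E M P : Type*} [NormedAddCommGroup E] [NormedSpace ℝ E]
  [TopologicalSpace M] [ChartedSpace E M] [DiffeologicalSpace P]
  {X : Type*} [NormedAddCommGroup X] [NormedSpace ℝ X] {π : P → M} {n r : ℕ}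

/-- A section representing a jet. -/
def Jet.rep (j : Jet E r π) : LocalSection E π := Quotient.out j

lemma Jet.hasJet_rep (j : Jet E r π) : HasJet E r π j.rep.toFun j.rep.pt j :=
  ⟨j.rep.isLocalSection, (Quotient.out_eq j).symm⟩

/-- The Taylor coefficients in a chart of a smooth function along a jet of sections, multiplied by
the cutoff function of the chart. -/
def jetCoord (π : P → M) (c : CutoffChart 𝓘(ℝ, E) M n) (G : P → X) (j : Jet E r π) :
    JetCoord (RSp n) X r := fun i =>
  c.cutoff j.base • iteratedFDeriv ℝ i (fun v => G (j.rep.toFun (c.inv v)))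
    (c.toFun j.base)

open Classical in
/-- The jet of a section, or a given jet if it is not a section near the point. -/
def jetOr (j₀ : Jet E r π) (s : M → P) (x : M) : Jet E r π :=
  if h : IsLocalSection E π s x then LocalSection.jet ⟨x, s, h⟩ r else j₀

lemma hasJet_jetOr (j₀ : Jet E r π) {s : M → P} {x : M} (h : IsLocalSection E π s x) :
    HasJet E r π s x (jetOr j₀ s x) :=
  ⟨h, by rw [jetOr, dif_pos h]⟩

variable [FiniteDimensional ℝ E] [IsManifold 𝓘(ℝ, E) ∞ M]

/-- The Taylor coefficients do not depend on the representative of the jet. -/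
lemma HasJet.jetCoord_eq (c : CutoffChart 𝓘(ℝ, E) M n) {s : M → P} {x : M} {j : Jet E r π}
    (h : HasJet E r π s x j) {G : P → X} (hG : SmoothTo 𝓘(ℝ, X) G) (i : Fin (r + 1)) :
    jetCoord π c G j i =
      c.cutoff x • iteratedFDeriv ℝ i (fun v => G (s (c.inv v))) (c.toFun x) := by
  have h0 := j.hasJet_rep
  have hx : j.rep.pt = x := (h0.contact h).1
  rw [hx] at h0
  unfold jetCoord
  rw [h.base_eq]
  by_cases hxs : x ∈ c.source
  · rw [h0.iteratedFDeriv_eq c.toEuclideanChart hxs h hG i (Nat.lt_succ_iff.1 i.2)]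
  · have : c.cutoff x = 0 := by
      by_contra h'
      exact hxs (c.tsupport_cutoff (subset_tsupport _ h'))
    simp [this]

lemma smoothTo_jetCoord (c : CutoffChart 𝓘(ℝ, E) M n) {G : P → X} (hG : SmoothTo 𝓘(ℝ, X) G) :
    SmoothTo 𝓘(ℝ, JetCoord (RSp n) X r) (jetCoord (r := r) π c G) := by
  refine smoothTo_pi (G := fun i j => jetCoord π c G j i) fun i => ?_
  intro m p hp u₀
  obtain ⟨x, s, hx, hs, h⟩ := exists_family_of_isPlot hp u₀
  have hρ : ContDiffAt ℝ ∞ (fun u => c.cutoff (x u)) u₀ :=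
    (ContMDiffAt.comp u₀ (c.contMDiff_cutoff.contMDiffAt) hx.contMDiffAt).contDiffAt
  have hev : (fun u => jetCoord π c G (p u) i) =ᶠ[𝓝 u₀] fun u =>
      c.cutoff (x u) • iteratedFDeriv ℝ i (fun v => G (s u (c.inv v))) (c.toFun (x u)) := by
    filter_upwards [h] with u hu using hu.jetCoord_eq c hG i
  refine (ContDiffAt.congr_of_eventuallyEq ?_ hev).contMDiffAt
  by_cases hxs : x u₀ ∈ c.source
  · have h1 : ContMDiffNear (𝓘(ℝ, RSp m).prod 𝓘(ℝ, RSp n)) 𝓘(ℝ, X)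
        (fun z : RSp m × RSp n => G (s z.1 (c.inv z.2))) (u₀, c.toFun (x u₀)) := by
      refine ContMDiffNear.comp (J := 𝓘(ℝ, RSp m).prod 𝓘(ℝ, E))
        (g := fun z : RSp m × M => G (s z.1 z.2))
        (f := fun z : RSp m × RSp n => (z.1, c.inv z.2)) ?_ ?_
      · simpa only [c.left_inv _ hxs] using hs.smoothTo_comp hG
      · exact (contMDiff_fst.prodMk (c.contMDiff_inv.comp contMDiff_snd)).contMDiffNear _
    obtain ⟨U, hU, hUe⟩ := h1.smoothGerm_prod.exists_contDiff
    have hcx : ContDiffAt ℝ ∞ (fun u => c.toFun (x u)) u₀ :=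
      (ContMDiffAt.comp u₀ (c.contMDiffAt_toFun hxs) hx.contMDiffAt).contDiffAt
    have h2 : ContDiffAt ℝ ∞ (fun u => c.cutoff (x u) •
        iteratedFDeriv ℝ i (fun v => U (u, v)) (c.toFun (x u))) u₀ :=
      hρ.smul ((contDiff_iteratedFDeriv_partial hU i).contDiffAt.comp u₀
        (contDiffAt_id.prodMk hcx))
    refine h2.congr_of_eventuallyEq ?_
    have hc : Tendsto (fun u => (u, c.toFun (x u))) (𝓝 u₀) (𝓝 (u₀, c.toFun (x u₀))) :=
      continuousAt_id.prodMk hcx.continuousAt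
    filter_upwards [hc.eventually hUe.eventually_nhds] with u hu
    have hc' : Tendsto (fun v => (u, v)) (𝓝 (c.toFun (x u))) (𝓝 (u, c.toFun (x u))) :=
      continuousAt_const.prodMk continuousAt_id
    have : (fun v => G (s u (c.inv v))) =ᶠ[𝓝 (c.toFun (x u))] fun v => U (u, v) := by
      filter_upwards [hc'.eventually hu] with v hv using hv.symm
    rw [(this.iteratedFDeriv_real i).self_of_nhds]
  -- outside the domain of the chart, the cutoff function vanishes locally
  · refine (contDiffAt_const (c := 0)).congr_of_eventuallyEq ?_
    have h1 : (tsupport c.cutoff)ᶜ ∈ 𝓝 (x u₀) :=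
      (isClosed_tsupport _).isOpen_compl.mem_nhds fun h => hxs (c.tsupport_cutoff h)
    filter_upwards [hx.continuousAt h1] with u hu
    rw [image_eq_zero_of_notMem_tsupport hu, zero_smul]

variable {F : Type*} [NormedAddCommGroup F] [NormedSpace ℝ F]

/-- The section given, in a chart, by a polynomial. -/
def FibredChart.polySection (C : FibredChart E π F) (c : CutoffChart 𝓘(ℝ, E) M n)
    (z : M × JetCoord (RSp n) F r) (y : M) : P :=
  C.param (y, taylorPoly z.2 (c.toFun y - c.toFun z.1))

lemma HasJet.taylorPoly_zero (C : FibredChart E π F) (c : CutoffChart 𝓘(ℝ, E) M n)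
    {s : M → P} {x : M} {j : Jet E r π} (h : HasJet E r π s x j) (hx : x ∈ c.core) :
    taylorPoly (jetCoord π c C.coord j) 0 = C.coord (s x) := by
  rw [_root_.taylorPoly_zero, h.jetCoord_eq c C.smoothTo_coord, c.cutoff_eq_one hx, one_smul]
  refine (iteratedFDeriv_zero_apply (𝕜 := ℝ) (f := fun v => C.coord (s (c.inv v)))
    (x := c.toFun x) _).trans ?_
  simp only [c.left_inv x (c.core_subset hx)]

lemma FibredChart.smoothNear_polySection (C : FibredChart E π F) (c : CutoffChart 𝓘(ℝ, E) M n)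
    {j : Jet E r π} (hj : j.base ∈ c.core) (hv : j.val ∈ C.source) :
    SmoothNear ((𝓘(ℝ, E).prod 𝓘(ℝ, JetCoord (RSp n) F r)).prod 𝓘(ℝ, E))
      (fun w : (M × JetCoord (RSp n) F r) × M => C.polySection c w.1 w.2)
      ((j.base, jetCoord π c C.coord j), j.base) ∧
    ∀ᶠ w : (M × JetCoord (RSp n) F r) × M in 𝓝 ((j.base, jetCoord π c C.coord j), j.base),
      π (C.polySection c w.1 w.2) = w.2 := by
  obtain ⟨s, x, h⟩ := exists_hasJet j
  have hx : j.base = x := h.base_eq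
  have hp : π j.val = x := by rw [h.val_eq]; exact h.1.2.self_of_nhds
  rw [hx] at hj ⊢
  have hxs := c.core_subset hj
  have hpoint : (x, taylorPoly (jetCoord π c C.coord j) (c.toFun x - c.toFun x)) =
      (π j.val, C.coord j.val) := by
    rw [sub_self, h.taylorPoly_zero C c hj, hp, h.val_eq]
  have hsm : ContMDiffNear ((𝓘(ℝ, E).prod 𝓘(ℝ, JetCoord (RSp n) F r)).prod 𝓘(ℝ, E))
      (𝓘(ℝ, E).prod 𝓘(ℝ, F))
      (fun w : (M × JetCoord (RSp n) F r) × M =>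
        (w.2, taylorPoly w.1.2 (c.toFun w.2 - c.toFun w.1.1)))
      ((x, jetCoord π c C.coord j), x) := by
    refine (contMDiff_snd.contMDiffNear _).prodMk ?_
    have h1 : ContMDiffNear ((𝓘(ℝ, E).prod 𝓘(ℝ, JetCoord (RSp n) F r)).prod 𝓘(ℝ, E))
        𝓘(ℝ, RSp n) (fun w => c.toFun w.2) ((x, jetCoord π c C.coord j), x) :=
      ContMDiffNear.comp (g := c.toFun) (f := Prod.snd) (c.contMDiffNear_toFun hxs)
        (contMDiff_snd.contMDiffNear _)
    have h2 : ContMDiffNear ((𝓘(ℝ, E).prod 𝓘(ℝ, JetCoord (RSp n) F r)).prod 𝓘(ℝ, E))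
        𝓘(ℝ, RSp n) (fun w => c.toFun w.1.1) ((x, jetCoord π c C.coord j), x) :=
      ContMDiffNear.comp (g := c.toFun)
        (f := fun w : (M × JetCoord (RSp n) F r) × M => w.1.1) (c.contMDiffNear_toFun hxs)
        ((contMDiff_fst.comp contMDiff_fst).contMDiffNear _)
    have h3 : ContMDiffNear ((𝓘(ℝ, E).prod 𝓘(ℝ, JetCoord (RSp n) F r)).prod 𝓘(ℝ, E))
        𝓘(ℝ, JetCoord (RSp n) F r) (fun w => w.1.2) ((x, jetCoord π c C.coord j), x) :=
      (contMDiff_snd.comp contMDiff_fst).contMDiffNear _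
    filter_upwards [h1, h2, h3] with w hw1 hw2 hw3
    have h4 : ContMDiffAt ((𝓘(ℝ, E).prod 𝓘(ℝ, JetCoord (RSp n) F r)).prod 𝓘(ℝ, E))
        𝓘(ℝ, JetCoord (RSp n) F r × RSp n) ∞
        (fun w : (M × JetCoord (RSp n) F r) × M => (w.1.2, c.toFun w.2 - c.toFun w.1.1)) w :=
      hw3.prodMk_space (hw1.sub hw2)
    exact (contDiff_taylorPoly.contMDiff.contMDiffAt (n := ∞)).comp w h4
  constructor
  · refine SmoothNear.comp_contMDiffNear (f := C.param) ?_ hsm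
    show SmoothNear _ _ (x, taylorPoly (jetCoord π c C.coord j) (c.toFun x - c.toFun x))
    rw [hpoint]
    exact C.smoothNear_param _ hv
  · have ht : Tendsto _ _ (𝓝 (x, taylorPoly (jetCoord π c C.coord j)
      (c.toFun x - c.toFun x))) := hsm.continuousAt.tendsto
    rw [hpoint] at ht
    exact ht.eventually (C.proj_param _ hv)

lemma FibredChart.eventually_isLocalSection (C : FibredChart E π F) (c : CutoffChart 𝓘(ℝ, E) M n)
    {j : Jet E r π} (hj : j.base ∈ c.core) (hv : j.val ∈ C.source) :
    ∀ᶠ z in 𝓝 (j.base, jetCoord π c C.coord j), IsLocalSection E π (C.polySection c z) z.1 := by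
  obtain ⟨h1, h2⟩ := C.smoothNear_polySection c hj hv
  have hc : Tendsto (fun z : M × JetCoord (RSp n) F r => (z, z.1))
      (𝓝 (j.base, jetCoord π c C.coord j))
      (𝓝 ((j.base, jetCoord π c C.coord j), j.base)) := by
    have : Continuous fun z : M × JetCoord (RSp n) F r => (z, z.1) := by fun_prop
    exact this.tendsto _
  filter_upwards [hc.eventually h1.eventually, hc.eventually h2.eventually_nhds] with z hz hz'
  have hc' : Tendsto (fun y : M => (z, y)) (𝓝 z.1) (𝓝 (z, z.1)) :=
    continuousAt_const.prodMk continuousAt_id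
  refine ⟨?_, hc'.eventually hz'⟩
  exact SmoothNear.comp_contMDiffNear
    (f := fun w : (M × JetCoord (RSp n) F r) × M => C.polySection c w.1 w.2)
    (g := fun y : M => (z, y)) hz ((contMDiff_const.prodMk contMDiff_id).contMDiffNear _)

variable [FiniteDimensional ℝ F]

/-- The chart of a jet space induced by a chart of `P` and a chart of the base: the coordinates
of a jet are the Taylor coefficients. (The jet `j₀` is a dummy value of `param`.) -/
def FibredChart.jet (C : FibredChart E π F) (c : CutoffChart 𝓘(ℝ, E) M n) (j₀ : Jet E r π) :
    FibredChart E (Jet.base : Jet E r π → M) (JetCoord (RSp n) F r) where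
  source := Jet.base ⁻¹' c.core ∩ Jet.val ⁻¹' C.source
  isOpen_source := isOpen_inter_dTopology (smoothTo_jet_base.isOpen_preimage isOpen_interior)
    (dSmooth_jet_val.isOpen_preimage C.isOpen_source)
  coord := jetCoord π c C.coord
  smoothTo_coord := smoothTo_jetCoord c C.smoothTo_coord
  param z := jetOr j₀ (C.polySection c z) z.1
  smoothNear_param j hj := by
    refine smoothNear_jet (s := C.polySection c) (contMDiff_fst.contMDiffNear _)
      (C.smoothNear_polySection c hj.1 hj.2).1 ?_
    filter_upwards [C.eventually_isLocalSection c hj.1 hj.2] with z hz using hasJet_jetOr j₀ hz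
  proj_param j hj := by
    filter_upwards [C.eventually_isLocalSection c hj.1 hj.2] with z hz
      using (hasJet_jetOr j₀ hz).base_eq
  param_coord j hj := by
    obtain ⟨s, x, h⟩ := exists_hasJet j
    obtain ⟨hjc, hjv⟩ := hj
    have hloc := (C.eventually_isLocalSection c hjc hjv).self_of_nhds
    have hjet := hasJet_jetOr j₀ hloc
    rw [mem_preimage, h.base_eq] at hjc
    rw [mem_preimage, h.val_eq] at hjv
    rw [h.base_eq] at hjet ⊢
    have hxs := c.core_subset hjc
    have hs : ∀ᶠ y in 𝓝 x, s y = C.param (y, C.coord (s y)) := by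
      filter_upwards [h.1.2, h.1.1.eventually_mem C.isOpen_source hjv] with y h1 h2
      have := C.param_coord _ h2
      rw [h1] at this
      exact this.symm
    have hg := h.1.smoothGerm c.toEuclideanChart hxs C.smoothTo_coord
    have hθ : jetCoord π c C.coord j = fun i : Fin (r + 1) =>
        iteratedFDeriv ℝ i (fun v => C.coord (s (c.inv v))) (c.toFun x) := by
      ext1 i
      rw [h.jetCoord_eq c C.smoothTo_coord, c.cutoff_eq_one hjc, one_smul]
    -- a section has contact of order `r` with its Taylor polynomial
    have hO := c.isBigO_comp_inv (g := fun y => C.coord (s y) -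
      taylorPoly (jetCoord π c C.coord j) (c.toFun y - c.toFun x)) hxs (by
        simp only [c.right_inv, hθ]
        exact hg.sub_taylorPoly_isBigO r)
    have hC := C.smoothNear_param _ hjv
    rw [h.1.2.self_of_nhds] at hC
    refine (HasJet.eq_of_param_isBigO C c.toEuclideanChart hxs hC h hjet
      (a := fun y => C.coord (s y))
      (a' := fun y => taylorPoly (jetCoord π c C.coord j) (c.toFun y - c.toFun x))
      hs (.of_forall fun y => rfl) (h.1.1.smoothTo_comp C.smoothTo_coord).continuousAt ?_ hO).symm
    have h1 : ContinuousAt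
        (fun y => taylorPoly (jetCoord π c C.coord j) (c.toFun y - c.toFun x)) x := by
      have h2 : Continuous fun w => taylorPoly (jetCoord π c C.coord j) w :=
        contDiff_taylorPoly.continuous.comp (Continuous.prodMk_right _)
      exact h2.continuousAt.comp ((c.continuousAt_toFun hxs).sub continuousAt_const)
    have h3 := h1.tendsto
    rwa [sub_self, h.taylorPoly_zero C c hjc] at h3

end JetChart

/-! ### Charts of fibered manifolds -/

section FiberedManifolds

variable {E M : Type*} [NormedAddCommGroup E] [NormedSpace ℝ E]
  [TopologicalSpace M] [ChartedSpace E M] {Y : FiberedManifold E M}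
  {E' H' A : Type*} [NormedAddCommGroup E'] [NormedSpace ℝ E'] [TopologicalSpace H']
  {I : ModelWithCorners ℝ E' H'} [TopologicalSpace A] [ChartedSpace H' A]
  {E'' H'' N : Type*} [NormedAddCommGroup E''] [NormedSpace ℝ E''] [TopologicalSpace H'']
  {K : ModelWithCorners ℝ E'' H''} [TopologicalSpace N] [ChartedSpace H'' N]

lemma ContMDiffNear.smoothNear {f : A → Y.Total} {a : A}
    (h : ContMDiffNear I 𝓘(ℝ, Y.Model) f a) : SmoothNear I f a := by
  obtain ⟨U, hU, hf⟩ := h.exists_contMDiffOn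
  exact ⟨U, hU, fun n q hq hqU => hf.comp_contMDiff hq hqU⟩

lemma ContMDiff.smoothTo {G : Y.Total → N} (h : ContMDiff 𝓘(ℝ, Y.Model) K ∞ G) : SmoothTo K G :=
  fun _ _ hp => h.comp hp

lemma FiberedManifold.smoothTo_id : SmoothTo 𝓘(ℝ, Y.Model) (id : Y.Total → Y.Total) :=
  contMDiff_id.smoothTo

variable (Y)

/-- A submersion has a chart near every point, with independent coordinates: `coord` is a left
inverse of `param` as well. -/
lemma FiberedManifold.exists_fibredChart [FiniteDimensional ℝ E] (y₀ : Y.Total) :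
    ∃ (m : ℕ) (C : FibredChart E Y.proj (RSp m)), y₀ ∈ C.source ∧
      ∀ᶠ z in 𝓝 (Y.proj y₀, C.coord y₀), C.coord (C.param z) = z.2 := by
  have h := (Y.isSubmersion.isSubmersionAt y₀).isSubmersionAtOfComplement_complement
  set φ := h.domChart with hφ
  set ψ := h.codChart with hψ
  have hfd : FiniteDimensional ℝ (E × (Y.isSubmersion.isSubmersionAt y₀).complement) :=
    h.equiv.toLinearEquiv.finiteDimensional
  have : FiniteDimensional ℝ (Y.isSubmersion.isSubmersionAt y₀).complement :=
    Module.Finite.of_surjective (LinearMap.snd ℝ E (Y.isSubmersion.isSubmersionAt y₀).complement)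
      LinearMap.snd_surjective
  set T := toEuclidean (E := (Y.isSubmersion.isSubmersionAt y₀).complement)
  set m := Module.finrank ℝ (Y.isSubmersion.isSubmersionAt y₀).complement
  have hy₀ : y₀ ∈ φ.source := h.mem_domChart_source
  have hwr : ∀ p ∈ φ.source, ψ (Y.proj p) = (h.equiv (φ p)).1 := fun p hp => by
    have : ψ (Y.proj (φ.symm (φ p))) = (h.equiv (φ p)).1 :=
      h.writtenInCharts (by simpa using φ.map_source hp)
    rwa [φ.left_inv hp] at this
  have hsrc : ∀ p ∈ φ.source, Y.proj p ∈ ψ.source := fun p hp => h.source_subset_preimage_source hp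
  have hφs : ContMDiffOn 𝓘(ℝ, Y.Model) 𝓘(ℝ, Y.Model) ∞ φ.symm φ.target :=
    contMDiffOn_symm_of_mem_maximalAtlas h.domChart_mem_maximalAtlas
  have hφ1 : ContMDiffOn 𝓘(ℝ, Y.Model) 𝓘(ℝ, Y.Model) ∞ φ φ.source :=
    contMDiffOn_of_mem_maximalAtlas h.domChart_mem_maximalAtlas
  have hψ1 : ContMDiffOn 𝓘(ℝ, E) 𝓘(ℝ, E) ∞ ψ ψ.source :=
    contMDiffOn_of_mem_maximalAtlas h.codChart_mem_maximalAtlas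
  obtain ⟨f, -, hf⟩ := (SmoothBumpFunction.nhds_basis_tsupport (I := 𝓘(ℝ, Y.Model)) y₀).mem_iff.1
    (φ.open_source.mem_nhds hy₀)
  let coord : Y.Total → RSp m := fun p => f p • T (h.equiv (φ p)).2
  let param : M × RSp m → Y.Total := fun z => φ.symm (h.equiv.symm (ψ z.1, T.symm z.2))
  have hcore : ∀ p ∈ interior {p | f p = 1}, p ∈ φ.source ∧ f p = 1 := fun p hp => by
    have h1 : f p = 1 := interior_subset (s := {p | f p = 1}) hp
    exact ⟨hf (subset_tsupport _ (by simp [h1])), h1⟩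
  have hcoord : ContMDiff 𝓘(ℝ, Y.Model) 𝓘(ℝ, RSp m) ∞ coord := by
    refine contMDiff_of_tsupport fun p hp => ?_
    have hp' : p ∈ φ.source := hf (closure_mono (Function.support_smul_subset_left _ _) hp)
    have h1 : ContDiff ℝ ∞ fun e : Y.Model => T (h.equiv e).2 := by fun_prop
    exact (f.contMDiff p).smul (ContMDiffAt.comp (g := fun e => T (h.equiv e).2) p
      h1.contMDiff.contMDiffAt (hφ1.contMDiffAt (φ.open_source.mem_nhds hp')))
  -- in the chart, points are determined by their projection and their coordinate
  have hinner : ∀ p ∈ interior {p | f p = 1},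
      h.equiv.symm (ψ (Y.proj p), T.symm (coord p)) = φ p := fun p hp => by
    obtain ⟨h1, h2⟩ := hcore p hp
    simp [coord, h2, hwr p h1]
  have hpc : ∀ p ∈ interior {p | f p = 1}, param (Y.proj p, coord p) = p := fun p hp => by
    simp only [param, hinner p hp, φ.left_inv (hcore p hp).1]
  have hin : ∀ p ∈ interior {p | f p = 1}, ContMDiffNear (𝓘(ℝ, E).prod 𝓘(ℝ, RSp m))
      𝓘(ℝ, Y.Model) (fun z : M × RSp m => h.equiv.symm (ψ z.1, T.symm z.2))
      (Y.proj p, coord p) := fun p hp => by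
    have h1 : ContMDiffNear (𝓘(ℝ, E).prod 𝓘(ℝ, RSp m)) 𝓘(ℝ, E)
        (fun z : M × RSp m => ψ z.1) (Y.proj p, coord p) :=
      ContMDiffNear.comp (g := ψ) (f := Prod.fst)
        (hψ1.contMDiffNear (ψ.open_source.mem_nhds (hsrc p (hcore p hp).1)))
        (contMDiff_fst.contMDiffNear _)
    have h2 : ContDiff ℝ ∞ fun z : E × RSp m => h.equiv.symm (z.1, T.symm z.2) := by fun_prop
    filter_upwards [h1] with z hz
    exact (h2.contMDiff.contMDiffAt (n := ∞)).comp z (hz.prodMk_space contMDiffAt_snd)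
  have htgt : ∀ p ∈ interior {p | f p = 1}, ∀ᶠ z : M × RSp m in 𝓝 (Y.proj p, coord p),
      h.equiv.symm (ψ z.1, T.symm z.2) ∈ φ.target := fun p hp =>
    (hin p hp).continuousAt (φ.open_target.mem_nhds (by
      simp only [hinner p hp]; exact φ.map_source (hcore p hp).1))
  have hparam : ∀ p ∈ interior {p | f p = 1}, ContMDiffNear (𝓘(ℝ, E).prod 𝓘(ℝ, RSp m))
      𝓘(ℝ, Y.Model) param (Y.proj p, coord p) := fun p hp => by
    refine ContMDiffNear.comp (g := φ.symm)
      (f := fun z : M × RSp m => h.equiv.symm (ψ z.1, T.symm z.2)) ?_ (hin p hp)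
    refine hφs.contMDiffNear (φ.open_target.mem_nhds ?_)
    simp only [hinner p hp]
    exact φ.map_source (hcore p hp).1
  let C : FibredChart E Y.proj (RSp m) :=
    { source := interior {p | f p = 1}
      isOpen_source := FiberedManifold.smoothTo_id.isOpen_preimage isOpen_interior
      coord := coord
      smoothTo_coord := hcoord.smoothTo
      param := param
      smoothNear_param := fun p hp => (hparam p hp).smoothNear
      proj_param := fun p hp => by
        have h1 : ∀ᶠ z : M × RSp m in 𝓝 (Y.proj p, coord p), z.1 ∈ ψ.source :=
          continuousAt_fst (ψ.open_source.mem_nhds (hsrc p (hcore p hp).1))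
        filter_upwards [htgt p hp, h1] with z hz hz1
        have hz2 := φ.map_target hz
        apply ψ.injOn (hsrc _ hz2) hz1
        rw [hwr _ hz2, φ.right_inv hz, ContinuousLinearEquiv.apply_symm_apply]
      param_coord := hpc }
  have hmem : y₀ ∈ interior {p | f p = 1} := mem_interior_iff_mem_nhds.2 f.eventuallyEq_one
  refine ⟨m, C, hmem, ?_⟩
  have h1 : ∀ᶠ z in 𝓝 (Y.proj y₀, coord y₀), param z ∈ interior {p | f p = 1} :=
    (hparam y₀ hmem).continuousAt (isOpen_interior.mem_nhds (by rw [hpc y₀ hmem]; exact hmem))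
  filter_upwards [h1, htgt y₀ hmem] with z hz hz'
  show f (param z) • T (h.equiv (φ (param z))).2 = z.2
  rw [(hcore _ hz).2, one_smul]
  simp only [param, φ.right_inv hz', ContinuousLinearEquiv.apply_symm_apply]

end FiberedManifolds

/-! ### Fibre products -/

section Pullback

lemma dSmooth_pullback_fst {A B C : Type*} [DiffeologicalSpace A] [DiffeologicalSpace C]
    {f : A → B} {g : C → B} : DSmooth fun p : f.Pullback g => p.1.1 := fun _ _ hp => hp.1

lemma dSmooth_pullback_snd {A B C : Type*} [DiffeologicalSpace A] [DiffeologicalSpace C]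
    {f : A → B} {g : C → B} : DSmooth fun p : f.Pullback g => p.1.2 := fun _ _ hp => hp.2

end Pullback

/-! ### Induced maps of vertical bundles -/

section VerticalMap

variable {M P Q : Type*} [DiffeologicalSpace P] [DiffeologicalSpace Q] {πP : P → M} {πQ : Q → M}

lemma IsVerticalCurve.comp {g : P → Q} (hg : DSmooth g) (hπ : ∀ p, πQ (g p) = πP p) {γ : ℝ → P}
    (h : IsVerticalCurve πP γ) : IsVerticalCurve πQ (fun t => g (γ t)) :=
  ⟨h.1.dSmooth_comp hg, by simpa only [hπ] using h.2⟩

/-- The map of vertical bundles induced by a smooth map `g` over the base. -/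
def VBundle.map (πQ : Q → M) (g : P → Q) (v : VBundle πP) : VBundle πQ :=
  velocityOrZero πQ fun t => g ((Quotient.out v).toFun t)

lemma HasVelocity.map {g : P → Q} (hg : DSmooth g) (hπ : ∀ p, πQ (g p) = πP p) {γ : ℝ → P}
    {v : VBundle πP} (h : HasVelocity πP γ v) :
    HasVelocity πQ (fun t => g (γ t)) (v.map πQ g) := by
  have h0 : HasVelocity πP (Quotient.out v).toFun v :=
    ⟨(Quotient.out v).isVerticalCurve, (Quotient.out_eq v).symm⟩
  have h1 := hasVelocity_velocityOrZero (h0.1.comp hg hπ)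
  have h2 := (h.1.comp hg hπ).hasVelocity
  have h3 := h0.tangent h
  rwa [h2.eq_of_tangent h1 (by rw [h3.1])
    fun f hf => (h3.2 (fun p => f (g p)) fun n p hp => hf n _ (hg n p hp)).symm] at h2

lemma VBundle.pt_map (g : P → Q) (v : VBundle πP) : (v.map πQ g).pt = g v.pt := by
  have h0 : HasVelocity πP (Quotient.out v).toFun v :=
    ⟨(Quotient.out v).isVerticalCurve, (Quotient.out_eq v).symm⟩
  rw [VBundle.map, velocityOrZero_pt, h0.pt_eq]

lemma dSmooth_vBundle_map {g : P → Q} (hg : DSmooth g) (hπ : ∀ p, πQ (g p) = πP p) :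
    DSmooth (VBundle.map (πP := πP) πQ g) := by
  intro n p hp u₀
  obtain ⟨γ, hγ, h⟩ := hp u₀
  exact ⟨fun u t => g (γ u t), hγ.dSmooth_comp hg, h.mono fun u hu => hu.map hg hπ⟩

end VerticalMap

/-! ### Charts of `J^r P ×_{J^s P} V J^s P` -/

section PullbackChart

open Asymptotics

variable {V X : Type*} [NormedAddCommGroup V] [NormedSpace ℝ V]
  [NormedAddCommGroup X] [NormedSpace ℝ X] {r s : ℕ}

/-- The Taylor coefficients up to order `s`. -/
def JetCoord.trunc (h : s ≤ r) (θ : JetCoord V X r) : JetCoord V X s :=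
  fun i => θ (Fin.castLE (Nat.succ_le_succ h) i)

/-- Extension of Taylor coefficients by zero. -/
def JetCoord.extend (r : ℕ) (θ : JetCoord V X s) : JetCoord V X r :=
  fun i => if h : (i : ℕ) < s + 1 then θ ⟨i, h⟩ else 0

lemma JetCoord.trunc_add_smul_extend (h : s ≤ r) (θ : JetCoord V X r) (θ' : JetCoord V X s)
    (t : ℝ) : (θ + t • θ'.extend r).trunc h = θ.trunc h + t • θ' := by
  ext1 i
  have : (i : ℕ) < s + 1 := i.2
  simp [JetCoord.trunc, JetCoord.extend, this]

lemma JetCoord.continuous_trunc (h : s ≤ r) :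
    Continuous (JetCoord.trunc h : JetCoord V X r → JetCoord V X s) :=
  continuous_pi fun _ => continuous_apply _

lemma JetCoord.contDiff_extend (r : ℕ) :
    ContDiff ℝ ∞ (JetCoord.extend r : JetCoord V X s → JetCoord V X r) := by
  refine contDiff_pi.2 fun i => ?_
  by_cases h : (i : ℕ) < s + 1
  · simp only [JetCoord.extend, h, dite_true]
    exact contDiff_pi.1 (contDiff_id (E := JetCoord V X s)) ⟨i, h⟩
  · simp only [JetCoord.extend, h, dite_false]
    exact contDiff_const

lemma taylorPoly_sub_trunc_isBigO (h : s ≤ r) (θ : JetCoord V X r) :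
    (fun w => taylorPoly θ w - taylorPoly (θ.trunc h) w) =O[𝓝 0] fun w => ‖w‖ ^ (s + 1) := by
  let a : ℕ → V → X := fun i w =>
    if hi : i < r + 1 then (i.factorial : ℝ)⁻¹ • θ ⟨i, hi⟩ fun _ => w else 0
  have h1 : ∀ w, taylorPoly θ w = ∑ i ∈ Finset.range (r + 1), a i w := fun w => by
    rw [Finset.sum_range]
    exact Finset.sum_congr rfl fun i _ => by simp only [a, i.2, dite_true]
  have h2 : ∀ w, taylorPoly (θ.trunc h) w = ∑ i ∈ Finset.range (s + 1), a i w := fun w => by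
    rw [Finset.sum_range]
    refine Finset.sum_congr rfl fun i _ => ?_
    have : (i : ℕ) < r + 1 := i.2.trans_le (Nat.succ_le_succ h)
    simp only [a, this, dite_true]
    rfl
  have h3 : ∀ w, taylorPoly θ w - taylorPoly (θ.trunc h) w =
      ∑ i ∈ Finset.Ico (s + 1) (r + 1), a i w := fun w =>
    by rw [h1, h2, Finset.sum_Ico_eq_sub _ (Nat.succ_le_succ h)]
  simp_rw [h3]
  refine IsBigO.fun_sum fun i hi => ?_
  obtain ⟨hi1, hi2⟩ := Finset.mem_Ico.1 hi
  have h4 : a i =O[𝓝 0] fun w => ‖w‖ ^ i := by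
    refine IsBigO.of_bound (‖(i.factorial : ℝ)⁻¹‖ * ‖θ ⟨i, hi2⟩‖) (.of_forall fun w => ?_)
    simp only [a, hi2, dite_true, norm_smul, norm_pow, norm_norm, mul_assoc]
    gcongr
    exact ((θ ⟨i, hi2⟩).le_opNorm _).trans (by simp)
  refine h4.trans (IsBigO.of_bound 1 ?_)
  filter_upwards [Metric.closedBall_mem_nhds (0 : V) one_pos] with w hw
  have hw' : ‖w‖ ≤ 1 := by simpa using hw
  simp only [norm_pow, norm_norm, one_mul]
  exact pow_le_pow_of_le_one (norm_nonneg _) hw' hi1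

variable {E M P : Type*} [NormedAddCommGroup E] [NormedSpace ℝ E]
  [TopologicalSpace M] [ChartedSpace E M] [DiffeologicalSpace P]
  {π : P → M} {n : ℕ}
  {F : Type*} [NormedAddCommGroup F] [NormedSpace ℝ F]

/-- The map `V J^r P → J^r P ×_{J^s P} V J^s P`. Smooth families in the fibre product are lifted to
`V J^r P`, where charts are available. -/
def verticalToPullback (h : s ≤ r) (v : VBundle (Jet.base : Jet E r π → M)) :
    (Jet.res h : Jet E r π → Jet E s π).Pullback
      (VBundle.pt : VBundle (Jet.base : Jet E s π → M) → Jet E s π) :=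
  ⟨(v.pt, v.map Jet.base (Jet.res h)), (VBundle.pt_map _ _).symm⟩

lemma dSmooth_verticalToPullback (h : s ≤ r) :
    DSmooth (verticalToPullback h (E := E) (π := π)) := fun n p hp =>
  ⟨dSmooth_pt n p hp, dSmooth_vBundle_map (dSmooth_jet_res h) (fun j => j.base_res h) n p hp⟩

variable [FiniteDimensional ℝ E] [IsManifold 𝓘(ℝ, E) ∞ M]

lemma trunc_jetCoord (h : s ≤ r) (c : CutoffChart 𝓘(ℝ, E) M n) {G : P → F}
    (hG : SmoothTo 𝓘(ℝ, F) G) (j : Jet E r π) :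
    (jetCoord π c G j).trunc h = jetCoord π c G (j.res h) := by
  obtain ⟨σ, x, hj⟩ := exists_hasJet j
  ext1 i
  rw [JetCoord.trunc, hj.jetCoord_eq c hG, (hj.res h).jetCoord_eq c hG]
  rfl

variable [FiniteDimensional ℝ F]

/-- Truncation of Taylor polynomials corresponds to the projection of jets. -/
lemma FibredChart.eventually_res_param (C : FibredChart E π F) (c : CutoffChart 𝓘(ℝ, E) M n)
    (h : s ≤ r) (j₀ : Jet E r π) (j₁ : Jet E s π) {j : Jet E r π} (hj : j ∈ (C.jet c j₀).source) :
    ∀ᶠ z in 𝓝 (j.base, jetCoord π c C.coord j),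
      ((C.jet c j₀).param z).res h = (C.jet c j₁).param (z.1, z.2.trunc h) := by
  have h0 := trunc_jetCoord h c C.smoothTo_coord j
  have hc : Tendsto (fun z : M × JetCoord (RSp n) F r => (z.1, z.2.trunc h))
      (𝓝 (j.base, jetCoord π c C.coord j))
      (𝓝 ((j.res h).base, jetCoord π c C.coord (j.res h))) := by
    rw [← h0, Jet.base_res]
    exact (continuous_fst.prodMk ((JetCoord.continuous_trunc h).comp continuous_snd)).tendsto _
  have hx : ∀ᶠ z : M × JetCoord (RSp n) F r in 𝓝 (j.base, jetCoord π c C.coord j),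
      z.1 ∈ c.core := continuousAt_fst (isOpen_interior.mem_nhds hj.1)
  obtain ⟨σ, x, hσ⟩ := exists_hasJet j
  have hp0 : ∀ᶠ z : M × JetCoord (RSp n) F r in 𝓝 (j.base, jetCoord π c C.coord j),
      SmoothNear (𝓘(ℝ, E).prod 𝓘(ℝ, F)) C.param (z.1, taylorPoly z.2 0) := by
    have h1 : Continuous fun z : M × JetCoord (RSp n) F r => (z.1, taylorPoly z.2 0) :=
      continuous_fst.prodMk ((contDiff_taylorPoly.continuous.comp
        (Continuous.prodMk_left 0)).comp continuous_snd)
    have h2 := h1.tendsto (j.base, jetCoord π c C.coord j)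
    have h3 : (j.base, taylorPoly (jetCoord π c C.coord j) 0) = (π j.val, C.coord j.val) := by
      have := hj.1
      rw [mem_preimage, hσ.base_eq] at this
      rw [hσ.taylorPoly_zero C c this, hσ.base_eq, hσ.val_eq, hσ.1.2.self_of_nhds]
    rw [h3] at h2
    exact h2.eventually (C.smoothNear_param _ hj.2).eventually
  filter_upwards [C.eventually_isLocalSection c hj.1 hj.2, hc.eventually
    (C.eventually_isLocalSection c (j := j.res h) (by rw [Jet.base_res]; exact hj.1)
      (by rw [Jet.val_res]; exact hj.2)), hx, hp0] with z h1 h2 h3 h4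
  have hxs := c.core_subset h3
  have hw : Tendsto (fun y => c.toFun y - c.toFun z.1) (𝓝 z.1) (𝓝 0) := by
    simpa using (c.continuousAt_toFun hxs).tendsto.sub_const (c.toFun z.1)
  have ht : ∀ {l : ℕ} (θ : JetCoord (RSp n) F l), Tendsto
      (fun y => taylorPoly θ (c.toFun y - c.toFun z.1)) (𝓝 z.1) (𝓝 (taylorPoly θ 0)) := by
    intro l θ
    have h2 : Continuous fun w => taylorPoly θ w :=
      contDiff_taylorPoly.continuous.comp (Continuous.prodMk_right _)
    exact (h2.tendsto 0).comp hw
  refine HasJet.eq_of_param_isBigO C c.toEuclideanChart hxs h4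
    ((hasJet_jetOr j₀ h1).res h) (hasJet_jetOr j₁ h2)
    (a := fun y => taylorPoly z.2 (c.toFun y - c.toFun z.1))
    (a' := fun y => taylorPoly (z.2.trunc h) (c.toFun y - c.toFun z.1))
    (.of_forall fun y => rfl) (.of_forall fun y => rfl) (ht _) ?_ ?_
  · have h5 : taylorPoly z.2 0 = taylorPoly (z.2.trunc h) 0 := by
      rw [taylorPoly_zero, taylorPoly_zero]; rfl
    rw [h5]
    exact ht _
  · exact (taylorPoly_sub_trunc_isBigO h z.2).comp_tendsto hw

/-- The chart of `J^r P ×_{J^s P} V J^s P` induced by a chart of `P` and a chart of the base: the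
coordinates are the Taylor coefficients of the jet, and the derivatives along the vertical vector
of those of order at most `s`. The latter are extended by zero to obtain a vertical vector of
`J^r P`. -/
def FibredChart.jetPullback (C : FibredChart E π F) (c : CutoffChart 𝓘(ℝ, E) M n)
    (j₀ : Jet E r π) (h : s ≤ r) :
    FibredChart E (fun p : (Jet.res h : Jet E r π → Jet E s π).Pullback
      (VBundle.pt : VBundle (Jet.base : Jet E s π → M) → Jet E s π) => p.1.1.base)
      (JetCoord (RSp n) F r × JetCoord (RSp n) F s) where
  source := (fun p => p.1.1) ⁻¹' (C.jet c j₀).source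
  isOpen_source := dSmooth_pullback_fst.isOpen_preimage (C.jet c j₀).isOpen_source
  coord p := (jetCoord π c C.coord p.1.1, vderiv Jet.base (jetCoord π c C.coord) p.1.2)
  smoothTo_coord := ((smoothTo_jetCoord c C.smoothTo_coord).comp_dSmooth
      dSmooth_pullback_fst).prodMk_space
    ((smoothTo_vderiv (smoothTo_jetCoord c C.smoothTo_coord)).comp_dSmooth dSmooth_pullback_snd)
  param z := verticalToPullback h ((C.jet c j₀).vertical.param (z.1, z.2.1, z.2.2.extend r))
  smoothNear_param p hp := by
    refine SmoothNear.dSmooth_comp (dSmooth_verticalToPullback h) ?_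
    refine SmoothNear.comp_contMDiffNear (I := 𝓘(ℝ, E).prod
      𝓘(ℝ, JetCoord (RSp n) F r × JetCoord (RSp n) F r)) (f := (C.jet c j₀).vertical.param)
      (g := fun z : M × JetCoord (RSp n) F r × JetCoord (RSp n) F s =>
        (z.1, z.2.1, z.2.2.extend r)) ((C.jet c j₀).smoothNear_velocity_line hp _) ?_
    have h1 : ContDiff ℝ ∞ fun z : JetCoord (RSp n) F r × JetCoord (RSp n) F s =>
      (z.1, z.2.extend r) :=
        contDiff_fst.prodMk ((JetCoord.contDiff_extend r).comp contDiff_snd)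
    exact (contMDiff_fst.prodMk (h1.contMDiff.comp contMDiff_snd)).contMDiffNear _
  proj_param p hp := by
    have hc : Tendsto (fun z : M × JetCoord (RSp n) F r × JetCoord (RSp n) F s => (z.1, z.2.1))
        (𝓝 (p.1.1.base, jetCoord π c C.coord p.1.1,
          vderiv Jet.base (jetCoord π c C.coord) p.1.2))
        (𝓝 (p.1.1.base, jetCoord π c C.coord p.1.1)) := by
      have : Continuous fun z : M × JetCoord (RSp n) F r × JetCoord (RSp n) F s =>
        (z.1, z.2.1) := by fun_prop
      exact this.tendsto _
    filter_upwards [hc.eventually ((C.jet c j₀).proj_param _ hp)] with z hz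
    show Jet.base (velocityOrZero (Jet.base : Jet E r π → M) _).pt = _
    rw [velocityOrZero_pt]
    simpa using hz
  param_coord p hp := by
    obtain ⟨⟨a, v⟩, hav⟩ := p
    have hav' : a.res h = v.pt := hav
    have hv : v.pt ∈ (C.jet c v.pt).source := by
      rw [← hav']
      exact ⟨by rw [mem_preimage, Jet.base_res]; exact hp.1,
        by rw [mem_preimage, Jet.val_res]; exact hp.2⟩
    have hb : v.pt.base = a.base := by rw [← hav', Jet.base_res]
    set θ := jetCoord π c C.coord a
    set θ' := vderiv Jet.base (jetCoord π c C.coord) v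
    have hθ : θ.trunc h = jetCoord π c C.coord v.pt := by
      rw [← hav']; exact trunc_jetCoord h c C.smoothTo_coord a
    have h1 := hasVelocity_velocityOrZero
      ((C.jet c j₀).eventually_isVerticalCurve hp (θ'.extend r)).self_of_nhds
    have h2 := hasVelocity_velocityOrZero
      ((C.jet c v.pt).eventually_isVerticalCurve hv θ').self_of_nhds
    have h3 : (C.jet c v.pt).vertical.param (v.pt.base, jetCoord π c C.coord v.pt, θ') = v :=
      (C.jet c v.pt).vertical.param_coord v hv
    have hl : Tendsto (fun t : ℝ => (a.base, θ + t • θ'.extend r)) (𝓝 0) (𝓝 (a.base, θ)) := by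
      have : Continuous fun t : ℝ => (a.base, θ + t • θ'.extend r) := by fun_prop
      simpa using this.tendsto 0
    have h4 := (h1.map (dSmooth_jet_res h) (fun j => j.base_res h)).unique_of_eventuallyEq h2 (by
      filter_upwards [hl.eventually (C.eventually_res_param c h j₀ v.pt hp)] with t ht
      refine ht.trans ?_
      show (C.jet c v.pt).param (a.base, (θ + t • θ'.extend r).trunc h) =
        (C.jet c v.pt).param (v.pt.base, jetCoord π c C.coord v.pt + t • θ')
      rw [JetCoord.trunc_add_smul_extend, hθ, hb])
    apply Subtype.ext
    refine Prod.ext ?_ (h4.trans h3)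
    show (velocityOrZero _ _).pt = a
    rw [velocityOrZero_pt]
    refine Eq.trans ?_ ((C.jet c j₀).param_coord a hp)
    simp only [zero_smul, add_zero]
    rfl

end PullbackChart

/-! ### Smooth families of jets -/

section JetFamilies

variable {E M P : Type*} [NormedAddCommGroup E] [NormedSpace ℝ E]
  [TopologicalSpace M] [ChartedSpace E M] [DiffeologicalSpace P]
  {π : P → M} {n k s : ℕ}
  {F : Type*} [NormedAddCommGroup F] [NormedSpace ℝ F]
  {X : Type*} [NormedAddCommGroup X] [NormedSpace ℝ X]
  {E' H' A : Type*} [NormedAddCommGroup E'] [NormedSpace ℝ E'] [TopologicalSpace H']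
  {I : ModelWithCorners ℝ E' H'} [TopologicalSpace A] [ChartedSpace H' A]

/-- A smooth family of jets is represented by a smooth family of sections. -/
lemma SmoothNear.exists_family [FiniteDimensional ℝ E'] [I.Boundaryless] [IsManifold I ∞ A]
    {p : A → Jet E k π} {a : A} (hp : SmoothNear I p a) :
    ∃ (x : A → M) (σ : A → M → P), ContMDiffNear I 𝓘(ℝ, E) x a ∧
      SmoothNear (I.prod 𝓘(ℝ, E)) (fun z : A × M => σ z.1 z.2) (a, x a) ∧
      ∀ᶠ b in 𝓝 a, HasJet E k π (σ b) (x b) (p b) := by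
  obtain ⟨U, hU, h⟩ := hp
  obtain ⟨m, c, ha, hc⟩ := exists_euclideanChart I a hU
  obtain ⟨x, σ, hx, hσ, hj⟩ := exists_family_of_isPlot
    (h m c.inv c.contMDiff_inv fun v => hc (c.inv_mem v)) (c.toFun a)
  refine ⟨fun b => x (c.toFun b), fun b => σ (c.toFun b),
    ContMDiffNear.comp (g := x) hx (c.contMDiffNear_toFun ha), ?_, ?_⟩
  · refine SmoothNear.comp_contMDiffNear (f := fun z : RSp m × M => σ z.1 z.2)
      (g := fun z : A × M => (c.toFun z.1, z.2)) hσ ?_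
    exact ContMDiffNear.prodMk (ContMDiffNear.comp (g := c.toFun) (f := Prod.fst)
      (c.contMDiffNear_toFun ha) (contMDiff_fst.contMDiffNear _)) (contMDiff_snd.contMDiffNear _)
  · filter_upwards [(c.continuousAt_toFun ha).eventually hj, c.source_mem_nhds ha] with b hb hb'
    simpa only [Function.comp_apply, c.left_inv b hb'] using hb

variable [FiniteDimensional ℝ E] [IsManifold 𝓘(ℝ, E) ∞ M]

/-- The family of sections may be chosen such that its members are sections on a common
neighbourhood. -/
lemma FibredChart.exists_family (C : FibredChart E π F) [FiniteDimensional ℝ E'] [I.Boundaryless]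
    [IsManifold I ∞ A]
    {p : A → Jet E k π} {a : A} (hp : SmoothNear I p a) (ha : (p a).val ∈ C.source) :
    ∃ (x : A → M) (σ : A → M → P), ContMDiffNear I 𝓘(ℝ, E) x a ∧
      SmoothNear (I.prod 𝓘(ℝ, E)) (fun z : A × M => σ z.1 z.2) (a, x a) ∧
      (∀ᶠ b in 𝓝 a, HasJet E k π (σ b) (x b) (p b)) ∧
      ∀ᶠ z : A × M in 𝓝 (a, x a), π (σ z.1 z.2) = z.2 := by
  obtain ⟨x, σ, hx, hσ, hj⟩ := hp.exists_family
  have hja := hj.self_of_nhds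
  have hsrc : σ a (x a) ∈ C.source := by rw [← hja.val_eq]; exact ha
  have hπ : π (σ a (x a)) = x a := hja.1.2.self_of_nhds
  have hg : ContMDiffNear (I.prod 𝓘(ℝ, E)) (𝓘(ℝ, E).prod 𝓘(ℝ, F))
      (fun z : A × M => (z.2, C.coord (σ z.1 z.2))) (a, x a) :=
    (contMDiff_snd.contMDiffNear _).prodMk (hσ.smoothTo_comp C.smoothTo_coord)
  have hC := C.smoothNear_param _ hsrc
  have hC' := C.proj_param _ hsrc
  rw [hπ] at hC hC'
  -- in the chart, the family is moved onto the fibres prescribed by its argument, which changes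
  -- nothing near the points where it consists of sections
  refine ⟨x, fun b y => C.param (y, C.coord (σ b y)), hx,
    SmoothNear.comp_contMDiffNear (f := C.param) (g := fun z : A × M => (z.2, C.coord (σ z.1 z.2)))
      hC hg, ?_, hg.continuousAt.eventually hC'⟩
  have hc : Tendsto (fun b => (b, x b)) (𝓝 a) (𝓝 (a, x a)) :=
    continuousAt_id.prodMk hx.continuousAt
  have hmem := hσ.eventually_mem C.isOpen_source hsrc
  filter_upwards [hj, hc.eventually hmem.eventually_nhds] with b hb hb'
  refine hb.congr ?_
  have hc' : Tendsto (fun y : M => (b, y)) (𝓝 (x b)) (𝓝 (b, x b)) :=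
    continuousAt_const.prodMk continuousAt_id
  filter_upwards [hb.1.2, hc'.eventually hb'] with y h1 h2
  have := C.param_coord _ h2
  rwa [h1] at this

end JetFamilies

/-! ### The correspondence between `V J^s P` and `J^s V P` -/

section Kappa

variable {E M P : Type*} [NormedAddCommGroup E] [NormedSpace ℝ E]
  [TopologicalSpace M] [ChartedSpace E M] [DiffeologicalSpace P]
  {π : P → M} {n k s : ℕ}
  {F : Type*} [NormedAddCommGroup F] [NormedSpace ℝ F]
  {X : Type*} [NormedAddCommGroup X] [NormedSpace ℝ X]

/-- The relation `v = d/dt|₀ j^s_x σ_t`, `w = j^s_x (y ↦ d/dt|₀ σ_t(y))` between elements of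
`V J^s P` and `J^s V P`. -/
def KappaRel (v : VBundle (Jet.base : Jet E s π → M))
    (w : Jet E s (fun v : VBundle π => π v.pt)) : Prop :=
  ∃ (x : M) (σ : ℝ → M → P) (γ : ℝ → Jet E s π) (ζ : M → VBundle π),
    SmoothNear (𝓘(ℝ, ℝ).prod 𝓘(ℝ, E)) (fun z : ℝ × M => σ z.1 z.2) (0, x) ∧
    (∀ᶠ t in 𝓝 (0 : ℝ), HasJet E s π (σ t) x (γ t)) ∧
    HasVelocity Jet.base γ v ∧
    (∀ᶠ y in 𝓝 x, HasVelocity π (fun t => σ t y) (ζ y)) ∧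
    HasJet E s (fun v : VBundle π => π v.pt) ζ x w

/-- A smooth family of sections over a common neighbourhood has a smooth velocity. -/
lemma isLocalSection_velocity_of_family {x : M} {σ : ℝ → M → P}
    (hσ : SmoothNear (𝓘(ℝ, ℝ).prod 𝓘(ℝ, E)) (fun z : ℝ × M => σ z.1 z.2) (0, x))
    (hπ : ∀ᶠ z : ℝ × M in 𝓝 (0, x), π (σ z.1 z.2) = z.2) :
    (∀ᶠ y in 𝓝 x, HasVelocity π (fun t => σ t y) (velocityOrZero π fun t => σ t y)) ∧
    IsLocalSection E (fun v : VBundle π => π v.pt) (fun y => velocityOrZero π fun t => σ t y) x ∧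
    ∀ᶠ t in 𝓝 (0 : ℝ), IsLocalSection E π (σ t) x := by
  have hc : Tendsto (fun y : M => ((0 : ℝ), y)) (𝓝 x) (𝓝 (0, x)) :=
    continuousAt_const.prodMk continuousAt_id
  have h1 : ∀ᶠ y in 𝓝 x, HasVelocity π (fun t => σ t y) (velocityOrZero π fun t => σ t y) := by
    filter_upwards [hc.eventually hσ.eventually, hc.eventually hπ.eventually_nhds] with y hy hy'
    have hc' : Tendsto (fun t : ℝ => (t, y)) (𝓝 0) (𝓝 (0, y)) :=
      continuousAt_id.prodMk continuousAt_const
    refine hasVelocity_velocityOrZero ⟨SmoothNear.comp_contMDiffNear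
      (f := fun z : ℝ × M => σ z.1 z.2) (g := fun t : ℝ => (t, y)) hy
      ((contMDiff_id.prodMk contMDiff_const).contMDiffNear _), ?_⟩
    have h2 := hc'.eventually hy'
    filter_upwards [h2] with t ht
    rw [ht, h2.self_of_nhds]
  refine ⟨h1, ⟨?_, ?_⟩, ?_⟩
  · refine smoothNear_velocity (γ := fun y t => σ t y) ?_ h1
    exact SmoothNear.comp_contMDiffNear (f := fun z : ℝ × M => σ z.1 z.2)
      (g := fun z : M × ℝ => (z.2, z.1)) hσ
      ((contMDiff_snd.prodMk contMDiff_fst).contMDiffNear _)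
  · filter_upwards [hc.eventually hπ] with y hy
    rw [velocityOrZero_pt, hy]
  · have hc2 : Tendsto (fun t : ℝ => (t, x)) (𝓝 0) (𝓝 (0, x)) :=
      continuousAt_id.prodMk continuousAt_const
    filter_upwards [hc2.eventually hσ.eventually, hc2.eventually hπ.eventually_nhds] with t ht ht'
    have hc' : Tendsto (fun y : M => (t, y)) (𝓝 x) (𝓝 (t, x)) :=
      continuousAt_const.prodMk continuousAt_id
    exact ⟨SmoothNear.comp_contMDiffNear
      (f := fun z : ℝ × M => σ z.1 z.2) (g := fun y : M => (t, y)) ht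
      ((contMDiff_const.prodMk contMDiff_id).contMDiffNear _), hc'.eventually ht'⟩

/-- The jets of a smooth family of sections over a common neighbourhood have a velocity. -/
lemma exists_velocity_of_family {x : M} {σ : ℝ → M → P}
    (hσ : SmoothNear (𝓘(ℝ, ℝ).prod 𝓘(ℝ, E)) (fun z : ℝ × M => σ z.1 z.2) (0, x))
    (hπ : ∀ᶠ z : ℝ × M in 𝓝 (0, x), π (σ z.1 z.2) = z.2) (s : ℕ) :
    ∃ (γ : ℝ → Jet E s π) (v : VBundle (Jet.base : Jet E s π → M)),
      (∀ᶠ t in 𝓝 (0 : ℝ), HasJet E s π (σ t) x (γ t)) ∧ HasVelocity Jet.base γ v := by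
  obtain ⟨-, -, h⟩ := isLocalSection_velocity_of_family hσ hπ
  set γ : ℝ → Jet E s π := fun t => jetOr (LocalSection.jet ⟨x, σ 0, h.self_of_nhds⟩ s) (σ t) x
  have hγ : ∀ᶠ t in 𝓝 (0 : ℝ), HasJet E s π (σ t) x (γ t) := by
    filter_upwards [h] with t ht using hasJet_jetOr _ ht
  refine ⟨γ, _, hγ, IsVerticalCurve.hasVelocity ⟨smoothNear_jet (x := fun _ => x)
    (contMDiff_const.contMDiffNear _) hσ hγ, ?_⟩⟩
  filter_upwards [hγ] with t ht
  rw [ht.base_eq, hγ.self_of_nhds.base_eq]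

lemma KappaRel.hasJet_pt {v : VBundle (Jet.base : Jet E s π → M)}
    {w : Jet E s (fun v : VBundle π => π v.pt)} (h : KappaRel v w) :
    ∃ (x : M) (ζ : M → VBundle π), HasJet E s (fun v : VBundle π => π v.pt) ζ x w ∧
      HasJet E s π (fun y => (ζ y).pt) x v.pt := by
  obtain ⟨x, σ, γ, ζ, hσ, hγ, hv, hζ, hwj⟩ := h
  refine ⟨x, ζ, hwj, ?_⟩
  rw [hv.pt_eq]
  refine hγ.self_of_nhds.congr ?_
  filter_upwards [hζ] with y hy using hy.pt_eq

lemma KappaRel.base_eq {v : VBundle (Jet.base : Jet E s π → M)}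
    {w : Jet E s (fun v : VBundle π => π v.pt)} (h : KappaRel v w) : v.pt.base = w.base := by
  obtain ⟨x, ζ, h1, h2⟩ := h.hasJet_pt
  rw [h1.base_eq, h2.base_eq]

lemma KappaRel.val_eq {v : VBundle (Jet.base : Jet E s π → M)}
    {w : Jet E s (fun v : VBundle π => π v.pt)} (h : KappaRel v w) : v.pt.val = w.val.pt := by
  obtain ⟨x, ζ, h1, h2⟩ := h.hasJet_pt
  rw [h1.val_eq, h2.val_eq]

variable [FiniteDimensional ℝ E] [IsManifold 𝓘(ℝ, E) ∞ M]

/-- The velocity of the Taylor coefficients is given by the Taylor coefficients of the velocity. -/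
lemma KappaRel.vderiv_jetCoord {v : VBundle (Jet.base : Jet E s π → M)}
    {w : Jet E s (fun v : VBundle π => π v.pt)} (h : KappaRel v w)
    (c : CutoffChart 𝓘(ℝ, E) M n) (hw : w.base ∈ c.source) {G : P → X}
    (hG : SmoothTo 𝓘(ℝ, X) G) :
    vderiv Jet.base (jetCoord π c G) v = jetCoord _ c (vderiv π G) w := by
  obtain ⟨x, σ, γ, ζ, hσ, hγ, hv, hζ, hwj⟩ := h
  rw [hwj.base_eq] at hw
  ext1 i
  rw [hwj.jetCoord_eq c (smoothTo_vderiv hG), hv.vderiv_eq (smoothTo_jetCoord c hG)]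
  have h1 := hasDerivAt_pi.1
    (hv.1.differentiableAt (smoothTo_jetCoord (r := s) c hG)).hasDerivAt i
  rw [← h1.deriv]
  have h2 : ContMDiffNear (𝓘(ℝ, ℝ).prod 𝓘(ℝ, RSp n)) 𝓘(ℝ, X)
      (fun z : ℝ × RSp n => G (σ z.1 (c.inv z.2))) (0, c.toFun x) := by
    refine ContMDiffNear.comp (J := 𝓘(ℝ, ℝ).prod 𝓘(ℝ, E)) (g := fun z : ℝ × M => G (σ z.1 z.2))
      (f := fun z : ℝ × RSp n => (z.1, c.inv z.2)) ?_ ?_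
    · simpa only [c.left_inv _ hw] using hσ.smoothTo_comp hG
    · exact (contMDiff_fst.prodMk (c.contMDiff_inv.comp contMDiff_snd)).contMDiffNear _
  obtain ⟨U, hU, hUe⟩ := h2.smoothGerm_prod.exists_contDiff
  have hc : Tendsto (fun t : ℝ => (t, c.toFun x)) (𝓝 0) (𝓝 (0, c.toFun x)) :=
    continuousAt_id.prodMk continuousAt_const
  have hc2 : Tendsto (fun u : RSp n => ((0 : ℝ), u)) (𝓝 (c.toFun x)) (𝓝 (0, c.toFun x)) :=
    continuousAt_const.prodMk continuousAt_id
  have e1 : (fun t => jetCoord π c G (γ t) i) =ᶠ[𝓝 0] fun t =>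
      c.cutoff x • iteratedFDeriv ℝ i (fun u => U (t, u)) (c.toFun x) := by
    filter_upwards [hγ, hc.eventually hUe.eventually_nhds] with t ht ht'
    rw [ht.jetCoord_eq c hG]
    have hc' : Tendsto (fun u => (t, u)) (𝓝 (c.toFun x)) (𝓝 (t, c.toFun x)) :=
      continuousAt_const.prodMk continuousAt_id
    have : (fun v => G (σ t (c.inv v))) =ᶠ[𝓝 (c.toFun x)] fun v => U (t, v) := by
      filter_upwards [hc'.eventually ht'] with v hv using hv.symm
    rw [(this.iteratedFDeriv_real i).self_of_nhds]
  have e2 : (fun u => vderiv π G (ζ (c.inv u))) =ᶠ[𝓝 (c.toFun x)] fun u =>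
      deriv (fun t => U (t, u)) 0 := by
    filter_upwards [(c.tendsto_inv hw).eventually hζ, hc2.eventually hUe.eventually_nhds]
      with u h1 h2
    rw [h1.vderiv_eq hG]
    have hc' : Tendsto (fun t => (t, u)) (𝓝 0) (𝓝 ((0 : ℝ), u)) :=
      continuousAt_id.prodMk continuousAt_const
    refine Filter.EventuallyEq.deriv_eq ?_
    filter_upwards [hc'.eventually h2] with t ht using ht.symm
  rw [e1.deriv_eq, (e2.iteratedFDeriv_real i).self_of_nhds]
  exact ((hasDerivAt_iteratedFDeriv_partial hU i (c.toFun x) 0).const_smul (c.cutoff x)).deriv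

lemma KappaRel.jetCoord_pt {v : VBundle (Jet.base : Jet E s π → M)}
    {w : Jet E s (fun v : VBundle π => π v.pt)} (h : KappaRel v w)
    (c : CutoffChart 𝓘(ℝ, E) M n) {G : P → X} (hG : SmoothTo 𝓘(ℝ, X) G) :
    jetCoord π c G v.pt = jetCoord _ c (fun u : VBundle π => G u.pt) w := by
  obtain ⟨x, ζ, h1, h2⟩ := h.hasJet_pt
  ext1 i
  rw [h1.jetCoord_eq c (hG.comp_dSmooth dSmooth_pt), h2.jetCoord_eq c hG]

/-- `ϰ_s` is defined everywhere. -/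
lemma exists_kappaRel (C : FibredChart E π F) (v : VBundle (Jet.base : Jet E s π → M))
    (hC : v.pt.val ∈ C.source) : ∃ w, KappaRel v w := by
  obtain ⟨γ, hγ⟩ := exists_hasVelocity v
  obtain ⟨x, σ, hx, hσ, hj, hπ⟩ := C.exists_family hγ.1.1 (by rw [← hγ.pt_eq]; exact hC)
  obtain ⟨h1, h2, -⟩ := isLocalSection_velocity_of_family hσ hπ
  refine ⟨_, x 0, σ, γ, _, hσ, ?_, hγ, h1, h2.hasJet s⟩
  filter_upwards [hj, hγ.1.2] with t ht ht'
  have : x t = x 0 := by rw [← ht.base_eq, ht', hj.self_of_nhds.base_eq]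
  rwa [this] at ht

variable [FiniteDimensional ℝ F]

/-- `ϰ_s` is onto: the jet of a section `ζ` of `V P` corresponds to the velocity of a family of
sections which is affine in the parameter in a chart. -/
lemma KappaRel.exists_left (C : FibredChart E π F)
    (w : Jet E s (fun v : VBundle π => π v.pt)) (hC : w.val.pt ∈ C.source) :
    ∃ v, KappaRel v w := by
  obtain ⟨ζ, x, hζ⟩ := exists_hasJet w
  rw [hζ.val_eq] at hC
  have hπx : π (ζ x).pt = x := hζ.1.2.self_of_nhds
  set σ : ℝ → M → P := fun t y =>
    C.param (y, C.coord (ζ y).pt + t • vderiv π C.coord (ζ y)) with hσdef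
  have hg : ContMDiffNear (𝓘(ℝ, ℝ).prod 𝓘(ℝ, E)) (𝓘(ℝ, E).prod 𝓘(ℝ, F))
      (fun z : ℝ × M => (z.2, C.coord (ζ z.2).pt + z.1 • vderiv π C.coord (ζ z.2))) (0, x) := by
    refine (contMDiff_snd.contMDiffNear _).prodMk ?_
    have h1 := ContMDiffNear.comp (I := 𝓘(ℝ, ℝ).prod 𝓘(ℝ, E)) (f := Prod.snd) (a := ((0 : ℝ), x))
      (hζ.1.1.smoothTo_comp (C.smoothTo_coord.comp_dSmooth dSmooth_pt))
      (contMDiff_snd.contMDiffNear _)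
    have h2 := ContMDiffNear.comp (I := 𝓘(ℝ, ℝ).prod 𝓘(ℝ, E)) (f := Prod.snd) (a := ((0 : ℝ), x))
      (hζ.1.1.smoothTo_comp (smoothTo_vderiv C.smoothTo_coord))
      (contMDiff_snd.contMDiffNear _)
    filter_upwards [h1, h2] with z hz1 hz2 using hz1.add (contMDiffAt_fst.smul hz2)
  have hpoint : (x, C.coord (ζ x).pt + (0 : ℝ) • vderiv π C.coord (ζ x)) =
      (π (ζ x).pt, C.coord (ζ x).pt) := by simp [hπx]
  have hσ : SmoothNear (𝓘(ℝ, ℝ).prod 𝓘(ℝ, E)) (fun z : ℝ × M => σ z.1 z.2) (0, x) := by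
    refine SmoothNear.comp_contMDiffNear (f := C.param) ?_ hg
    show SmoothNear _ _ (x, C.coord (ζ x).pt + (0 : ℝ) • vderiv π C.coord (ζ x))
    rw [hpoint]
    exact C.smoothNear_param _ hC
  have hσπ : ∀ᶠ z : ℝ × M in 𝓝 (0, x), π (σ z.1 z.2) = z.2 := by
    have ht : Tendsto _ _ (𝓝 (x, C.coord (ζ x).pt + (0 : ℝ) • vderiv π C.coord (ζ x))) :=
      hg.continuousAt
    rw [hpoint] at ht
    exact ht.eventually (C.proj_param _ hC)
  obtain ⟨h1, -, -⟩ := isLocalSection_velocity_of_family hσ hσπ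
  obtain ⟨γ, v, hγ, hv⟩ := exists_velocity_of_family hσ hσπ s
  have hζσ : ∀ᶠ y in 𝓝 x, ζ y = velocityOrZero π fun t => σ t y := by
    filter_upwards [hζ.1.2, hζ.1.1.eventually_mem C.vertical.isOpen_source hC] with y hy hy'
    have := C.vertical.param_coord (ζ y) hy'
    rw [hy] at this
    exact this.symm
  refine ⟨v, x, σ, γ, ζ, hσ, hγ, hv, ?_, hζ⟩
  filter_upwards [h1, hζσ] with y hy hy'
  rwa [hy']

/-- `ϰ_s` is injective, by comparison of coordinates. -/
lemma KappaRel.injective (C : FibredChart E π F) (c : CutoffChart 𝓘(ℝ, E) M n)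
    {v v' : VBundle (Jet.base : Jet E s π → M)} {w : Jet E s (fun v : VBundle π => π v.pt)}
    (h : KappaRel v w) (h' : KappaRel v' w) (hw : w.base ∈ c.core) (hC : w.val.pt ∈ C.source) :
    v = v' := by
  have hm : ∀ {v : VBundle (Jet.base : Jet E s π → M)}, KappaRel v w →
      v ∈ (C.jet c v.pt).vertical.source := fun {v} h =>
    ⟨by rw [mem_preimage, h.base_eq]; exact hw, by rw [mem_preimage, h.val_eq]; exact hC⟩
  refine (C.jet c v.pt).vertical.eq_of_coord_eq (hm h) (hm h') ?_ (Prod.ext ?_ ?_)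
  · rw [h.base_eq, h'.base_eq]
  · exact (h.jetCoord_pt c C.smoothTo_coord).trans (h'.jetCoord_pt c C.smoothTo_coord).symm
  · exact (h.vderiv_jetCoord c (c.core_subset hw) C.smoothTo_coord).trans
      (h'.vderiv_jetCoord c (c.core_subset hw) C.smoothTo_coord).symm

/-- `ϰ_s` is single-valued, by comparison of coordinates. -/
lemma KappaRel.unique (C : FibredChart E π F) (c : CutoffChart 𝓘(ℝ, E) M n)
    {v : VBundle (Jet.base : Jet E s π → M)} {w w' : Jet E s (fun v : VBundle π => π v.pt)}
    (h : KappaRel v w) (h' : KappaRel v w') (hw : w.base ∈ c.core) (hC : w.val.pt ∈ C.source) :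
    w = w' := by
  have hb : w'.base = w.base := by rw [← h.base_eq, h'.base_eq]
  have hw' : w'.base ∈ c.core := by rw [hb]; exact hw
  have hC' : w'.val.pt ∈ C.source := by rw [← h'.val_eq, h.val_eq]; exact hC
  have e1 := (h.jetCoord_pt c C.smoothTo_coord).symm.trans (h'.jetCoord_pt c C.smoothTo_coord)
  have e2 := (h.vderiv_jetCoord c (c.core_subset hw) C.smoothTo_coord).symm.trans
    (h'.vderiv_jetCoord c (c.core_subset hw') C.smoothTo_coord)
  obtain ⟨ζ, x, hζ⟩ := exists_hasJet w
  obtain ⟨ζ', x', hζ'⟩ := exists_hasJet w'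
  obtain rfl : x' = x := by rw [← hζ.base_eq, ← hζ'.base_eq, hb]
  rw [hζ.base_eq] at hw
  rw [hζ.val_eq] at hC
  rw [hζ'.val_eq] at hC'
  have hxs := c.core_subset hw
  have key : ∀ {G : VBundle π → F}, SmoothTo 𝓘(ℝ, F) G → jetCoord _ c G w = jetCoord _ c G w' →
      (fun y => G (ζ y) - G (ζ' y)) =O[𝓝 x'] fun y => ‖c.toFun y - c.toFun x'‖ ^ (s + 1) := by
    intro G hG he
    refine c.isBigO_comp_inv hxs ?_
    rw [(hζ.1.smoothGerm c.toEuclideanChart hxs hG).sub_isBigO_iff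
      (hζ'.1.smoothGerm c.toEuclideanChart hxs hG)]
    intro i hi
    have := congrFun he ⟨i, Nat.lt_succ_of_le hi⟩
    rwa [hζ.jetCoord_eq c hG, hζ'.jetCoord_eq c hG, c.cutoff_eq_one hw, one_smul, one_smul] at this
  have hk1 := key (C.smoothTo_coord.comp_dSmooth dSmooth_pt) e1
  have hk2 := key (smoothTo_vderiv C.smoothTo_coord) e2
  refine hζ.eq_of_coord_isBigO C.vertical c.toEuclideanChart hxs hζ' ?_ hC (hk1.prod_left hk2)
  have h0 : ∀ {g : M → F},
      g =O[𝓝 x'] (fun y => ‖c.toFun y - c.toFun x'‖ ^ (s + 1)) → g x' = 0 := by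
    intro g hg
    obtain ⟨K, hK⟩ := hg.bound
    simpa using hK.self_of_nhds
  refine C.vertical.eq_of_coord_eq hC hC' ?_ (Prod.ext (sub_eq_zero.1 (h0 hk1))
    (sub_eq_zero.1 (h0 hk2)))
  exact hζ.1.2.self_of_nhds.trans hζ'.1.2.self_of_nhds.symm

end Kappa

/-! ### Prolongation of morphisms and of sections -/

section JetMaps

open Asymptotics

variable {E M P Q : Type*} [NormedAddCommGroup E] [NormedSpace ℝ E]
  [TopologicalSpace M] [ChartedSpace E M] [DiffeologicalSpace P] [DiffeologicalSpace Q]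
  {π : P → M} {πQ : Q → M} {n k r : ℕ}
  {F : Type*} [NormedAddCommGroup F] [NormedSpace ℝ F]

lemma IsLocalSection.map {g : P → Q} (hg : DSmooth g) (hπ : ∀ p, πQ (g p) = π p) {S : M → P}
    {x : M} (h : IsLocalSection E π S x) : IsLocalSection E πQ (fun y => g (S y)) x :=
  ⟨h.1.dSmooth_comp hg, by simpa only [hπ] using h.2⟩

lemma HasJet.map_unique {g : P → Q} (hg : DSmooth g) {S S' : M → P}
    {x : M} {j : Jet E k π} {j₁ j₂ : Jet E k πQ} (h : HasJet E k π S x j)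
    (h' : HasJet E k π S' x j) (h₁ : HasJet E k πQ (fun y => g (S y)) x j₁)
    (h₂ : HasJet E k πQ (fun y => g (S' y)) x j₂) : j₁ = j₂ := by
  have hc := (h.contact h').2
  exact h₁.eq_of_contact h₂ (by rw [hc.1]) fun f hf =>
    hc.2 (fun p => f (g p)) fun n p hp => hf n _ (hg n p hp)

/-- `J^k χ` is computed on any representative. -/
lemma hasJet_jetMap {N : FiberedManifold E M} {χ : P → N.Total} (hχ : DSmooth χ)
    (hN : ∀ p, N.proj (χ p) = π p) {S : M → P} {x : M} {a : Jet E k π}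
    (h : HasJet E k π S x a) : HasJet E k N.proj (fun y => χ (S y)) x (jetMap k χ a) := by
  have h0 := (h.1.map hχ hN).hasJet k
  obtain ⟨x', S', h1, h2⟩ := Classical.epsilon_spec_aux (N.nonempty_J k a.base)
    (fun c => ∃ (x : M) (S : M → P), HasJet E k π S x a ∧ HasJet E k N.proj (χ ∘ S) x c)
    ⟨_, x, S, h, h0⟩
  obtain rfl : x = x' := by rw [← h.base_eq, h1.base_eq]
  rwa [h.map_unique hχ h1 h0 h2] at h0

variable [FiniteDimensional ℝ E] [IsManifold 𝓘(ℝ, E) ∞ M] [FiniteDimensional ℝ F]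

/-- Sections with the same jet of order `k + r` have prolongations of order `r` with the same jet
of order `k`. -/
lemma HasJet.prolongation_unique (C : FibredChart E π F) (c : CutoffChart 𝓘(ℝ, E) M n)
    {σ σ' : M → P} {S S' : M → Jet E r π} {x : M} {a : Jet E (k + r) π}
    {j j' : Jet E k (Jet.base : Jet E r π → M)} (hx : x ∈ c.core) (hC : σ x ∈ C.source)
    (h : HasJet E (k + r) π σ x a) (h' : HasJet E (k + r) π σ' x a)
    (hS : ∀ᶠ y in 𝓝 x, HasJet E r π σ y (S y)) (hS' : ∀ᶠ y in 𝓝 x, HasJet E r π σ' y (S' y))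
    (hj : HasJet E k Jet.base S x j) (hj' : HasJet E k Jet.base S' x j') : j = j' := by
  have hxs := c.core_subset hx
  have h0 : S x = S' x := by
    have h1 := h.res (Nat.le_add_left r k)
    have h2 := h'.res (Nat.le_add_left r k)
    rw [hS.self_of_nhds.unique h1, hS'.self_of_nhds.unique h2]
  refine hj.eq_of_coord_isBigO (C.jet c (S x)) c.toEuclideanChart hxs hj' h0
    ⟨by rw [mem_preimage, hS.self_of_nhds.base_eq]; exact hx,
      by rw [mem_preimage, hS.self_of_nhds.val_eq]; exact hC⟩ ?_
  refine isBigO_pi.2 fun i => ?_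
  -- the `i`-th Taylor coefficient of `σ` has contact of order `k + r - i ≥ k` with that of `σ'`
  have hi : (i : ℕ) ≤ r := Nat.lt_succ_iff.1 i.2
  have hg := h.1.smoothGerm c.toEuclideanChart hxs C.smoothTo_coord
  have hg' := h'.1.smoothGerm c.toEuclideanChart hxs C.smoothTo_coord
  have hO := (hg.sub_isBigO_iff hg' (k := k + i)).2 fun l hl =>
    h.iteratedFDeriv_eq c.toEuclideanChart hxs h' C.smoothTo_coord l (by omega)
  have hO2 := hg.iteratedFDeriv_sub_isBigO hg' hO
  refine (hO2.comp_tendsto (c.continuousAt_toFun hxs)).congr' ?_ .rfl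
  filter_upwards [hS, hS', isOpen_interior.mem_nhds hx] with y hy hy' hyx
  show _ = jetCoord π c C.coord (S y) i - jetCoord π c C.coord (S' y) i
  rw [hy.jetCoord_eq c C.smoothTo_coord, hy'.jetCoord_eq c C.smoothTo_coord,
    c.cutoff_eq_one hyx, one_smul, one_smul]
  rfl

/-- The inclusion `J^{k+r} P → J^k J^r P` is computed on any representative `σ`. -/
lemma HasJet.hasJet_jetIncl [T2Space M] (C : FibredChart E π F) {σ : M → P}
    {S : M → Jet E r π} {x : M} {a : Jet E (k + r) π} (hC : σ x ∈ C.source)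
    (h : HasJet E (k + r) π σ x a) (hS : ∀ᶠ y in 𝓝 x, HasJet E r π σ y (S y))
    (hloc : IsLocalSection E Jet.base S x) : HasJet E k Jet.base S x (jetIncl k r a) := by
  obtain ⟨n, c, hc⟩ := exists_cutoffChart 𝓘(ℝ, E) x
  have h1 : HasJet E (k + r) π a.rep.toFun a.rep.pt a := a.hasJet_rep
  have hx : a.rep.pt = x := (h1.contact h).1
  have h2 : HasJet E k Jet.base (jetSection r a.rep) a.rep.pt (jetIncl k r a) :=
    ⟨isLocalSection_jetSection r a.rep, rfl⟩
  have h3 : ∀ᶠ y in 𝓝 a.rep.pt, HasJet E r π a.rep.toFun y (jetSection r a.rep y) := by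
    filter_upwards [a.rep.isLocalSection.eventually] with y hy using hasJet_jetSection r a.rep hy
  rw [hx] at h1 h2 h3
  have h4 := hloc.hasJet k
  rwa [HasJet.prolongation_unique C c hc hC h h1 hS h3 h4 h2] at h4

end JetMaps

/-! ### The identification `ϰ_s` and its inverse -/

section KappaInverse

variable {E M : Type*} [NormedAddCommGroup E] [NormedSpace ℝ E]
  [TopologicalSpace M] [ChartedSpace E M] {Y : FiberedManifold E M} {s : ℕ}

/-- `ϰ_s` is a map over `J^s Y`. -/
lemma KappaRel.projJV_eq {v : Y.VJ s} {w : Y.JV s} (h : KappaRel v w) : projJV Y s w = v.pt := by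
  obtain ⟨x, ζ, h1, h2⟩ := h.hasJet_pt
  exact (hasJet_jetMap (N := Y) dSmooth_pt (fun _ => rfl) h1).unique h2

variable [FiniteDimensional ℝ E] [IsManifold 𝓘(ℝ, E) ∞ M]

lemma kappaRel_kappa (v : Y.VJ s) : KappaRel v (kappa Y s v) := by
  obtain ⟨m, C, hC, -⟩ := Y.exists_fibredChart v.pt.val
  obtain ⟨w, hw⟩ := exists_kappaRel C v hC
  exact Classical.epsilon_spec_aux (Y.nonempty_JV s v.pt.base) (fun w => KappaRel v w) ⟨w, hw⟩

variable [T2Space M]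

lemma KappaRel.kappa_eq {v : Y.VJ s} {w : Y.JV s} (h : KappaRel v w) : kappa Y s v = w := by
  obtain ⟨m, C, hC, -⟩ := Y.exists_fibredChart w.val.pt
  obtain ⟨n, c, hc⟩ := exists_cutoffChart 𝓘(ℝ, E) w.base
  exact (h.unique C c (kappaRel_kappa v) hc hC).symm

lemma KappaRel.left_unique {v v' : Y.VJ s} {w : Y.JV s} (h : KappaRel v w) (h' : KappaRel v' w) :
    v = v' := by
  obtain ⟨m, C, hC, -⟩ := Y.exists_fibredChart w.val.pt
  obtain ⟨n, c, hc⟩ := exists_cutoffChart 𝓘(ℝ, E) w.base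
  exact h.injective C c h' hc hC

lemma kappaRel_kappaInv (w : Y.JV s) : KappaRel (kappaInv Y s w).1 w := by
  obtain ⟨m, C, hC, -⟩ := Y.exists_fibredChart w.val.pt
  obtain ⟨v, hv⟩ := KappaRel.exists_left C w hC
  have h := Classical.epsilon_spec
    (p := fun v : {v : Y.VJ s // v.pt = projJV Y s w} => kappa Y s v.1 = w)
    ⟨⟨v, hv.projJV_eq.symm⟩, hv.kappa_eq⟩
  have h1 := kappaRel_kappa (kappaInv Y s w).1
  have h2 : kappa Y s (kappaInv Y s w).1 = w := h
  rwa [h2] at h1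

lemma KappaRel.kappaInv_eq {v : Y.VJ s} {w : Y.JV s} (h : KappaRel v w) :
    (kappaInv Y s w).1 = v := (kappaRel_kappaInv w).left_unique h

end KappaInverse

/-! ### Composition operators on spaces of continuous functions -/

section Nemytskii

universe u

variable {K : Type*} [TopologicalSpace K] [CompactSpace K]
  {X W : Type u} [NormedAddCommGroup X] [NormedSpace ℝ X] [NormedAddCommGroup W] [NormedSpace ℝ W]

/-- Pointwise application of linear maps, as a bilinear map of spaces of continuous functions. -/
def ContinuousMap.applyL (K X W : Type*) [TopologicalSpace K] [CompactSpace K]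
    [NormedAddCommGroup X] [NormedSpace ℝ X] [NormedAddCommGroup W] [NormedSpace ℝ W] :
    C(K, X →L[ℝ] W) →L[ℝ] C(K, X) →L[ℝ] C(K, W) :=
  LinearMap.mkContinuous₂
    (LinearMap.mk₂ ℝ (fun (A : C(K, X →L[ℝ] W)) (α : C(K, X)) =>
        (⟨fun s => A s (α s), by fun_prop⟩ : C(K, W)))
      (fun _ _ _ => by ext; simp) (fun _ _ _ => by ext; simp)
      (fun _ _ _ => by ext; simp) (fun _ _ _ => by ext; simp)) 1 fun A α => by
    rw [one_mul, ContinuousMap.norm_le _ (by positivity)]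
    intro s
    refine ((A s).le_opNorm _).trans ?_
    gcongr
    · exact A.norm_coe_le_norm s
    · exact α.norm_coe_le_norm s

/-- The composition operator `α ↦ B ∘ α` is differentiable if `B` is continuously differentiable. -/
lemma hasFDerivAt_comp_continuousMap (B : C(X, W)) (B' : C(X, X →L[ℝ] W))
    (h : ∀ x, HasFDerivAt B (B' x) x) (α : C(K, X)) :
    HasFDerivAt (fun α : C(K, X) => B.comp α) (ContinuousMap.applyL K X W (B'.comp α)) α := by
  rw [hasFDerivAt_iff_isLittleO_nhds_zero, Asymptotics.isLittleO_iff]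
  intro ε hε
  have hcont : Continuous fun γ : C(K, X) => B'.comp γ := ContinuousMap.continuous_postcomp B'
  obtain ⟨δ, hδ, hB⟩ := (Metric.continuous_iff (f := fun γ : C(K, X) => B'.comp γ)).1 hcont α ε hε
  filter_upwards [Metric.ball_mem_nhds 0 hδ] with d hd
  rw [mem_ball_zero_iff] at hd
  rw [ContinuousMap.norm_le _ (by positivity)]
  intro s
  have hds : ‖d s‖ ≤ ‖d‖ := d.norm_coe_le_norm s
  -- continuity of `γ ↦ B' ∘ γ` along constant translations of `α` is uniform continuity of `B'`
  have hbound : ∀ e : X, ‖e‖ ≤ ‖d‖ → ‖B' (α s + e) - B' (α s)‖ ≤ ε := by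
    intro e he
    have h1 : dist (α + ContinuousMap.const K e) α < δ := by
      rw [dist_eq_norm, add_sub_cancel_left]
      refine lt_of_le_of_lt ((ContinuousMap.norm_le _ (norm_nonneg d)).2 fun _ => he) hd
    have h2 := (ContinuousMap.dist_apply_le_dist (f := B'.comp (α + ContinuousMap.const K e))
      (g := B'.comp α) s).trans (hB _ h1).le
    rwa [dist_eq_norm] at h2
  have h3 := Convex.norm_image_sub_le_of_norm_hasFDerivWithin_le'
    (f := B) (f' := B') (φ := B' (α s)) (s := Metric.closedBall (α s) ‖d‖) (C := ε)
    (fun x _ => (h x).hasFDerivWithinAt)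
    (fun x hx => by
      have := hbound (x - α s) (by rwa [← mem_closedBall_iff_norm])
      rwa [add_sub_cancel] at this)
    (convex_closedBall _ _) (Metric.mem_closedBall_self (norm_nonneg d))
    (y := α s + d s) (by rw [mem_closedBall_iff_norm, add_sub_cancel_left]; exact hds)
  rw [add_sub_cancel_left] at h3
  exact h3.trans (by gcongr)

/-- The spaces `X` and `W` lie in one universe, as the induction passes from `W` to `X →L[ℝ] W`. -/
lemma contDiff_comp_continuousMap_nat (n : ℕ) : ∀ {W : Type u} [NormedAddCommGroup W]
    [NormedSpace ℝ W] (B : C(X, W)), ContDiff ℝ ∞ B →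
    ContDiff ℝ n fun α : C(K, X) => B.comp α := by
  induction n with
  | zero =>
    intro W _ _ B _
    exact contDiff_zero.2 (ContinuousMap.continuous_postcomp B)
  | succ n ih =>
    intro W _ _ B hB
    have hB' : ContDiff ℝ ∞ (fderiv ℝ B) := hB.fderiv_infty
    rw [show ((n + 1 : ℕ) : WithTop ℕ∞) = (n : WithTop ℕ∞) + 1 by norm_cast,
      contDiff_succ_iff_hasFDerivAt]
    refine ⟨fun α => ContinuousMap.applyL K X W
      ((⟨fderiv ℝ B, hB'.continuous⟩ : C(X, X →L[ℝ] W)).comp α), ?_, fun α => ?_⟩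
    · exact (ContinuousMap.applyL K X W).contDiff.comp (ih ⟨fderiv ℝ B, hB'.continuous⟩ hB')
    · exact hasFDerivAt_comp_continuousMap B ⟨fderiv ℝ B, hB'.continuous⟩
        (fun x => (hB.differentiable (by simp) x).hasFDerivAt) α

/-- The composition operator `α ↦ B ∘ α` is smooth if `B` is smooth. -/
lemma contDiff_comp_continuousMap (B : C(X, W)) (hB : ContDiff ℝ ∞ B) :
    ContDiff ℝ ∞ fun α : C(K, X) => B.comp α :=
  contDiff_infty.2 fun n => contDiff_comp_continuousMap_nat n B hB

end Nemytskii

/-! ### Smooth flows -/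

section Flow

universe u

variable {X : Type u} [NormedAddCommGroup X] [NormedSpace ℝ X]

/-- The interval `[-1, 1]`. -/
abbrev FlowInterval := Icc (-1 : ℝ) 1

/-- The operator `α ↦ (s ↦ ∫₀ˢ α)` on continuous curves on `[-1, 1]`. -/
def integralL (X : Type u) [NormedAddCommGroup X] [NormedSpace ℝ X] :
    C(FlowInterval, X) →L[ℝ] C(FlowInterval, X) :=
  have hc (α : C(FlowInterval, X)) : Continuous (IccExtend (by norm_num : (-1 : ℝ) ≤ 1) α) :=
    α.continuous.Icc_extend'
  LinearMap.mkContinuous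
    { toFun := fun α => ⟨fun s => ∫ τ in (0 : ℝ)..s, IccExtend (by norm_num : (-1 : ℝ) ≤ 1) α τ, by
        exact (intervalIntegral.continuous_primitive
          (fun a b => (hc α).intervalIntegrable a b) 0).comp continuous_subtype_val⟩
      map_add' := fun α β => by
        ext s
        exact intervalIntegral.integral_add ((hc α).intervalIntegrable _ _)
          ((hc β).intervalIntegrable _ _)
      map_smul' := fun r α => by
        ext s
        exact intervalIntegral.integral_smul r _ } 1 fun α => by
    rw [one_mul, ContinuousMap.norm_le _ (norm_nonneg _)]
    intro s
    refine (intervalIntegral.norm_integral_le_of_norm_le_const (C := ‖α‖)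
      fun τ _ => α.norm_coe_le_norm _).trans ?_
    have : |(s : ℝ)| ≤ 1 := abs_le.2 s.2
    simpa using mul_le_mul_of_nonneg_left this (norm_nonneg α)

lemma integralL_apply (α : C(FlowInterval, X)) (s : FlowInterval) :
    integralL X α s = ∫ τ in (0 : ℝ)..s, IccExtend (by norm_num : (-1 : ℝ) ≤ 1) α τ := rfl

/-- The invertible operator `(δε, δx, δα) ↦ (δε, δx, δα - δx - δε • c)`. -/
def shearEquiv (c : C(FlowInterval, X)) :
    (ℝ × X × C(FlowInterval, X)) ≃L[ℝ] (ℝ × X × C(FlowInterval, X)) :=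
  ContinuousLinearEquiv.equivOfInverse
    ((ContinuousLinearMap.fst ℝ ℝ (X × C(FlowInterval, X))).prod
      (((ContinuousLinearMap.fst ℝ X C(FlowInterval, X)).comp
        (ContinuousLinearMap.snd ℝ ℝ (X × C(FlowInterval, X)))).prod
      ((ContinuousLinearMap.snd ℝ X C(FlowInterval, X)).comp
        (ContinuousLinearMap.snd ℝ ℝ (X × C(FlowInterval, X))) -
      (ContinuousLinearMap.const ℝ FlowInterval).comp
        ((ContinuousLinearMap.fst ℝ X C(FlowInterval, X)).comp
          (ContinuousLinearMap.snd ℝ ℝ (X × C(FlowInterval, X)))) -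
      (ContinuousLinearMap.fst ℝ ℝ (X × C(FlowInterval, X))).smulRight c)))
    ((ContinuousLinearMap.fst ℝ ℝ (X × C(FlowInterval, X))).prod
      (((ContinuousLinearMap.fst ℝ X C(FlowInterval, X)).comp
        (ContinuousLinearMap.snd ℝ ℝ (X × C(FlowInterval, X)))).prod
      ((ContinuousLinearMap.snd ℝ X C(FlowInterval, X)).comp
        (ContinuousLinearMap.snd ℝ ℝ (X × C(FlowInterval, X))) +
      (ContinuousLinearMap.const ℝ FlowInterval).comp
        ((ContinuousLinearMap.fst ℝ X C(FlowInterval, X)).comp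
          (ContinuousLinearMap.snd ℝ ℝ (X × C(FlowInterval, X)))) +
      (ContinuousLinearMap.fst ℝ ℝ (X × C(FlowInterval, X))).smulRight c)))
    (fun z => by
      refine Prod.ext rfl (Prod.ext rfl ?_)
      ext s
      simp
      abel)
    (fun z => by
      refine Prod.ext rfl (Prod.ext rfl ?_)
      ext s
      simp
      abel)

/-- The map whose zeroes in the last component are the solutions of `α' = ε B(α)`, `α(0) = x`. -/
def flowMap (B : C(X, X)) (z : ℝ × X × C(FlowInterval, X)) : ℝ × X × C(FlowInterval, X) :=
  (z.1, z.2.1, z.2.2 - ContinuousMap.const _ z.2.1 - z.1 • integralL X (B.comp z.2.2))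

lemma contDiff_flowMap (B : C(X, X)) (hB : ContDiff ℝ ∞ B) : ContDiff ℝ ∞ (flowMap B) := by
  have h1 : ContDiff ℝ ∞ fun z : ℝ × X × C(FlowInterval, X) => integralL X (B.comp z.2.2) :=
    (integralL X).contDiff.comp
      ((contDiff_comp_continuousMap B hB).comp (contDiff_snd.comp contDiff_snd))
  have h2 : ContDiff ℝ ∞ fun z : ℝ × X × C(FlowInterval, X) =>
      (ContinuousMap.const FlowInterval z.2.1 : C(FlowInterval, X)) :=
    (ContinuousLinearMap.const (M := X) (R := ℝ) FlowInterval).contDiff.comp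
      (contDiff_fst.comp contDiff_snd)
  exact contDiff_fst.prodMk ((contDiff_fst.comp contDiff_snd).prodMk
    (((contDiff_snd.comp contDiff_snd).sub h2).sub (contDiff_fst.smul h1)))

/-- At a constant curve and `ε = 0`, the derivative of `flowMap` is invertible. -/
lemma hasFDerivAt_flowMap (B : C(X, X)) (hB : ContDiff ℝ ∞ B) (x : X) :
    HasFDerivAt (flowMap B)
      (shearEquiv (integralL X (B.comp (ContinuousMap.const _ x))) :
        (ℝ × X × C(FlowInterval, X)) →L[ℝ] _) (0, x, ContinuousMap.const _ x) := by
  have h1 : ContDiff ℝ ∞ fun z : ℝ × X × C(FlowInterval, X) => integralL X (B.comp z.2.2) :=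
    (integralL X).contDiff.comp
      ((contDiff_comp_continuousMap B hB).comp (contDiff_snd.comp contDiff_snd))
  have h2 := (h1.differentiable (by simp) (0, x, ContinuousMap.const _ x)).hasFDerivAt
  have hf : HasFDerivAt (fun z : ℝ × X × C(FlowInterval, X) => z.1)
    (ContinuousLinearMap.fst ℝ ℝ (X × C(FlowInterval, X))) (0, x, ContinuousMap.const _ x) :=
    hasFDerivAt_fst
  have hs : HasFDerivAt (fun z : ℝ × X × C(FlowInterval, X) => z.2)
    (ContinuousLinearMap.snd ℝ ℝ (X × C(FlowInterval, X))) (0, x, ContinuousMap.const _ x) :=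
    hasFDerivAt_snd
  have hsf := hs.fst
  have hss := hs.snd
  have hc := (ContinuousLinearMap.const (M := X) (R := ℝ) FlowInterval).hasFDerivAt.comp
    ((0 : ℝ), x, (ContinuousMap.const FlowInterval x : C(FlowInterval, X))) hsf
  have := hf.prodMk (hsf.prodMk ((hss.sub hc).sub (hf.smul h2)))
  refine this.congr_fderiv ?_
  refine ContinuousLinearMap.ext fun z => Prod.ext rfl (Prod.ext rfl ?_)
  ext s
  simp [shearEquiv]

/-- The change of variables `σ ↦ s σ`, for the rescaled curve `A' σ = A (s σ)`. -/
lemma integralL_comp_mul (A : C(FlowInterval, X)) (s τ : FlowInterval) (A' : C(FlowInterval, X))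
    (hA' : ∀ σ : FlowInterval, A' σ = IccExtend (by norm_num : (-1 : ℝ) ≤ 1) A (s * σ)) :
    (s : ℝ) • integralL X A' τ =
      ∫ σ in (0 : ℝ)..s * τ, IccExtend (by norm_num : (-1 : ℝ) ≤ 1) A σ := by
  have h := intervalIntegral.smul_integral_comp_mul_left (a := 0) (b := τ)
    (IccExtend (by norm_num : (-1 : ℝ) ≤ 1) A) (s : ℝ)
  rw [mul_zero] at h
  rw [← h, integralL_apply]
  congr 1
  refine intervalIntegral.integral_congr fun σ hσ => ?_
  have hσ' : σ ∈ Icc (-1 : ℝ) 1 := by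
    have h1 := uIcc_subset_Icc (a₁ := (0 : ℝ)) (b₁ := τ) (a₂ := -1) (b₂ := 1)
      (by norm_num) τ.2 hσ
    exact h1
  simp only [IccExtend_of_mem _ _ hσ', hA']

/-- A smooth vector field on a Banach space has a smooth local flow. The equation `α' = ε B(α)`,
`α(0) = x` on `[-1, 1]` is trivially solvable for `ε = 0`, so the inverse function theorem in
`C([-1, 1], X)` gives solutions `α_{ε,x}` which depend smoothly on small `ε` and on `x`. As
`α_{sε,x}(1) = α_{ε,x}(s)` by uniqueness, the flow is `Φ(t, x) = α_{t,x}(1)`. -/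
theorem exists_smooth_flow [CompleteSpace X] (B : C(X, X)) (hB : ContDiff ℝ ∞ B) (x₀ : X) :
    ∃ Φ : ℝ × X → X, SmoothGerm Φ (0, x₀) ∧ ∃ T > 0, ∀ᶠ x in 𝓝 x₀, Φ (0, x) = x ∧
      ∀ t, |t| < T → HasDerivAt (fun t => Φ (t, x)) (B (Φ (t, x))) t := by
  set p₀ : ℝ × X × C(FlowInterval, X) := (0, x₀, ContinuousMap.const _ x₀) with hp₀
  have hcd := contDiff_flowMap B hB
  have hstrict := hcd.contDiffAt.hasStrictFDerivAt' (hasFDerivAt_flowMap B hB x₀) (by simp)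
  set e := hstrict.toOpenPartialHomeomorph (flowMap B) with he
  have hcoe : ⇑e = flowMap B := hstrict.toOpenPartialHomeomorph_coe
  have hsrc : p₀ ∈ e.source := hstrict.mem_toOpenPartialHomeomorph_source
  have hfp : flowMap B p₀ = (0, x₀, 0) := by simp [flowMap, hp₀]
  have htgt : ((0 : ℝ), x₀, (0 : C(FlowInterval, X))) ∈ e.target := by
    rw [← hfp, ← hcoe]; exact e.map_source hsrc
  have hsymm₀ : e.symm (0, x₀, 0) = p₀ := by rw [← hfp, ← hcoe, e.left_inv hsrc]
  have hcsymm : Tendsto e.symm (𝓝 (0, x₀, 0)) (𝓝 p₀) := by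
    have := (e.continuousAt_symm htgt).tendsto
    rwa [hsymm₀] at this
  -- the inverse is smooth at all points near `flowMap B p₀`, as invertibility is an open condition
  have hinv : ∀ᶠ z in 𝓝 p₀, fderiv ℝ (flowMap B) z ∈ range
      ((↑) : ((ℝ × X × C(FlowInterval, X)) ≃L[ℝ] (ℝ × X × C(FlowInterval, X))) →
        ((ℝ × X × C(FlowInterval, X)) →L[ℝ] (ℝ × X × C(FlowInterval, X)))) := by
    refine hcd.fderiv_infty.continuous.continuousAt ?_
    rw [(hasFDerivAt_flowMap B hB x₀).fderiv]
    exact ContinuousLinearEquiv.nhds _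
  have hsm : SmoothGerm e.symm (0, x₀, 0) := by
    filter_upwards [e.open_target.mem_nhds htgt, hcsymm.eventually hinv] with w hw ⟨g, hg⟩
    refine e.contDiffAt_symm (f₀' := g) hw ?_ (hcoe ▸ hcd.contDiffAt)
    rw [hg, hcoe]
    exact (hcd.differentiable (by simp) _).hasFDerivAt
  set α : ℝ × X → C(FlowInterval, X) := fun z => (e.symm (z.1, z.2, 0)).2.2 with hα
  have hι : ContDiff ℝ ∞ fun z : ℝ × X => (z.1, z.2, (0 : C(FlowInterval, X))) :=
    contDiff_fst.prodMk (contDiff_snd.prodMk contDiff_const)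
  have hιt : Tendsto (fun z : ℝ × X => (z.1, z.2, (0 : C(FlowInterval, X)))) (𝓝 (0, x₀))
      (𝓝 (0, x₀, 0)) := hι.continuous.tendsto _
  have hαsm : SmoothGerm α (0, x₀) := by
    filter_upwards [hιt.eventually hsm] with z hz
    exact (contDiff_snd.comp contDiff_snd).contDiffAt.comp z (hz.comp z hι.contDiffAt)
  obtain ⟨δ₁, hδ₁, hball⟩ := Metric.isOpen_iff.1 e.open_source p₀ hsrc
  have hα₀ : α (0, x₀) = ContinuousMap.const _ x₀ := by simp [hα, hsymm₀, hp₀]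
  have hev : ∀ᶠ z in 𝓝 ((0 : ℝ), x₀), (z.1, z.2, (0 : C(FlowInterval, X))) ∈ e.target ∧
      dist (α z) (ContinuousMap.const _ x₀) < δ₁ := by
    refine (hιt.eventually (e.open_target.mem_nhds htgt)).and ?_
    have := hαsm.contDiffAt.continuousAt.tendsto
    rw [hα₀] at this
    exact this (Metric.ball_mem_nhds _ hδ₁)
  obtain ⟨δ₂, hδ₂, hN⟩ := Metric.eventually_nhds_iff_ball.1 hev
  set δ := min δ₁ δ₂ with hδ
  have hδpos : 0 < δ := lt_min hδ₁ hδ₂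
  have hmem : ∀ {ε : ℝ} {x : X}, |ε| < δ → dist x x₀ < δ →
      (ε, x, (0 : C(FlowInterval, X))) ∈ e.target ∧
      dist (α (ε, x)) (ContinuousMap.const _ x₀) < δ₁ := fun {ε x} h1 h2 => by
    refine hN (ε, x) ?_
    rw [Metric.mem_ball, Prod.dist_eq, max_lt_iff, Real.dist_eq, sub_zero]
    exact ⟨h1.trans_le (min_le_right _ _), h2.trans_le (min_le_right _ _)⟩
  have heq : ∀ {ε : ℝ} {x : X}, |ε| < δ → dist x x₀ < δ → ∀ s : FlowInterval,
      α (ε, x) s = x + ε • integralL X (B.comp (α (ε, x))) s := fun {ε x} h1 h2 s => by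
    have h3 := e.right_inv (hmem h1 h2).1
    rw [hcoe] at h3
    simp only [flowMap, Prod.mk.injEq] at h3
    obtain ⟨h4, h5, h6⟩ := h3
    rw [h4, h5] at h6
    have h7 := DFunLike.congr_fun h6 s
    simp only [ContinuousMap.sub_apply, ContinuousMap.smul_apply, ContinuousMap.const_apply,
      ContinuousMap.zero_apply] at h7
    rw [sub_sub, sub_eq_zero] at h7
    exact h7
  have huniq : ∀ {ε : ℝ} {x : X} {β : C(FlowInterval, X)}, |ε| < δ → dist x x₀ < δ →
      dist β (ContinuousMap.const _ x₀) < δ₁ →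
      (∀ s, β s = x + ε • integralL X (B.comp β) s) → β = α (ε, x) := by
    intro ε x β h1 h2 h3 h4
    have h5 : (ε, x, β) ∈ e.source := hball (by
      rw [Metric.mem_ball, Prod.dist_eq, Prod.dist_eq, max_lt_iff, max_lt_iff, Real.dist_eq]
      exact ⟨by simpa [hp₀] using h1.trans_le (min_le_left _ _), h2.trans_le (min_le_left _ _), h3⟩)
    have h6 : flowMap B (ε, x, β) = (ε, x, 0) := by
      refine Prod.ext rfl (Prod.ext rfl ?_)
      ext s
      simp only [flowMap, ContinuousMap.sub_apply, ContinuousMap.smul_apply,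
        ContinuousMap.const_apply, ContinuousMap.zero_apply]
      rw [h4 s]
      simp
    have h7 := e.left_inv h5
    rw [hcoe, h6] at h7
    simp [hα, h7]
  have hscale : ∀ {ε : ℝ} {x : X}, |ε| < δ → dist x x₀ < δ → ∀ s : FlowInterval,
      α (s * ε, x) ⟨1, by norm_num⟩ = α (ε, x) s := by
    intro ε x h1 h2 s
    have hs : |(s : ℝ)| ≤ 1 := abs_le.2 s.2
    have hmul : ∀ τ : FlowInterval, (s : ℝ) * τ ∈ FlowInterval := fun τ => by
      rw [mem_Icc, ← abs_le, abs_mul]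
      exact mul_le_one₀ hs (abs_nonneg _) (abs_le.2 τ.2)
    set β : C(FlowInterval, X) := (α (ε, x)).comp ⟨fun τ => ⟨s * τ, hmul τ⟩, by fun_prop⟩ with hβ
    have hβα : β = α (s * ε, x) := by
      refine huniq ?_ h2 ?_ fun τ => ?_
      · rw [abs_mul]
        exact (mul_le_of_le_one_left (abs_nonneg _) hs).trans_lt h1
      · refine lt_of_le_of_lt ((ContinuousMap.dist_le dist_nonneg).2 fun τ => ?_) (hmem h1 h2).2
        exact ContinuousMap.dist_apply_le_dist (f := α (ε, x)) (g := ContinuousMap.const _ x₀)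
          ⟨s * τ, hmul τ⟩
      · rw [mul_comm, mul_smul, integralL_comp_mul (B.comp (α (ε, x))) s τ (B.comp β)
          fun σ => by rw [IccExtend_of_mem _ _ (hmul σ)]; rfl]
        exact heq h1 h2 ⟨s * τ, hmul τ⟩
    rw [← hβα]
    simp [hβ]
  refine ⟨fun z => α z ⟨1, by norm_num⟩, ?_, δ / 2, half_pos hδpos, ?_⟩
  · filter_upwards [hαsm] with z hz
    exact (ContinuousMap.evalCLM ℝ (⟨1, by norm_num⟩ : FlowInterval)).contDiff.contDiffAt.comp z hz
  have hT : |δ / 2| < δ := by rw [abs_of_pos (half_pos hδpos)]; exact half_lt_self hδpos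
  filter_upwards [Metric.ball_mem_nhds x₀ hδpos] with x hx
  have hΦ : ∀ t, |t| < δ / 2 → ∃ h : t / (δ / 2) ∈ FlowInterval,
      α (t, x) ⟨1, by norm_num⟩ = α (δ / 2, x) ⟨t / (δ / 2), h⟩ := by
    intro t ht
    have h1 : t / (δ / 2) ∈ FlowInterval := by
      rw [mem_Icc, ← abs_le, abs_div, abs_of_pos (half_pos hδpos)]
      exact (div_le_one (half_pos hδpos)).2 ht.le
    refine ⟨h1, ?_⟩
    rw [← hscale hT hx ⟨t / (δ / 2), h1⟩]
    simp only [div_mul_cancel₀ t (half_pos hδpos).ne']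
  set A := B.comp (α (δ / 2, x)) with hA
  have hAc : Continuous (IccExtend (by norm_num : (-1 : ℝ) ≤ 1) A) := A.continuous.Icc_extend'
  have hform : ∀ t, |t| < δ / 2 → α (t, x) ⟨1, by norm_num⟩ = x + (δ / 2) •
      ∫ σ in (0 : ℝ)..t / (δ / 2), IccExtend (by norm_num : (-1 : ℝ) ≤ 1) A σ := by
    intro t ht
    obtain ⟨h1, h2⟩ := hΦ t ht
    rw [h2, heq hT hx]
    rfl
  constructor
  · rw [hform 0 (by simpa using half_pos hδpos)]
    simp
  · intro t ht
    obtain ⟨h1, h2⟩ := hΦ t ht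
    have h3 : (fun t => α (t, x) ⟨1, by norm_num⟩) =ᶠ[𝓝 t] fun t => x + (δ / 2) •
        ∫ σ in (0 : ℝ)..t / (δ / 2), IccExtend (by norm_num : (-1 : ℝ) ≤ 1) A σ := by
      filter_upwards [(isOpen_lt continuous_abs continuous_const).mem_nhds ht] with t ht
        using hform t ht
    refine HasDerivAt.congr_of_eventuallyEq ?_ h3
    have h4 := (hAc.integral_hasStrictDerivAt 0 (t / (δ / 2))).hasDerivAt
    have h5 := (h4.scomp t ((hasDerivAt_id t).div_const (δ / 2))).const_smul (δ / 2)
    have h6 := h5.const_add x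
    refine h6.congr_deriv ?_
    rw [smul_smul, mul_one_div_cancel (half_pos hδpos).ne', one_smul, IccExtend_of_mem _ _ h1]
    show B (α (δ / 2, x) ⟨t / (δ / 2), h1⟩) = B (α (t, x) ⟨1, by norm_num⟩)
    rw [h2]

/-- The smooth local flow of a vector field depending smoothly on parameters. -/
theorem exists_smooth_flow_param {V F : Type u} [NormedAddCommGroup V] [NormedSpace ℝ V]
    [CompleteSpace V] [NormedAddCommGroup F] [NormedSpace ℝ F] [CompleteSpace F]
    (b : V × F → F) (hb : ContDiff ℝ ∞ b) (z₀ : V × F) :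
    ∃ β : ℝ × (V × F) → F, SmoothGerm β (0, z₀) ∧ (∀ᶠ z in 𝓝 z₀, β (0, z) = z.2) ∧
      ∀ᶠ w in 𝓝 ((0 : ℝ), z₀), HasDerivAt (fun h => β (w.1 + h, w.2)) (b (w.2.1, β w)) 0 := by
  have hB : ContDiff ℝ ∞ fun z : V × F => ((0 : V), b z) := contDiff_const.prodMk hb
  obtain ⟨Φ, hΦ, T, hT, h⟩ := exists_smooth_flow ⟨_, hB.continuous⟩ hB z₀
  refine ⟨fun w => (Φ w).2, ?_, ?_, ?_⟩
  · filter_upwards [hΦ] with w hw using contDiff_snd.contDiffAt.comp w hw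
  · filter_upwards [h] with z hz
    rw [hz.1]
  · have h1 : ∀ᶠ w : ℝ × (V × F) in 𝓝 (0, z₀), |w.1| < T := by
      refine (continuous_abs.comp continuous_fst).continuousAt.eventually_lt continuousAt_const ?_
      simpa using hT
    have h2 : Tendsto Prod.snd (𝓝 ((0 : ℝ), z₀)) (𝓝 z₀) := continuous_snd.tendsto _
    filter_upwards [h1, h2.eventually h] with ⟨t, z⟩ ht hz
    -- the parameter is constant along the flow
    have hconst : (Φ (t, z)).1 = z.1 := by
      have hd : ∀ τ ∈ Metric.ball (0 : ℝ) T, HasDerivAt (fun t => (Φ (t, z)).1) 0 τ := fun τ hτ =>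
        (hz.2 τ (by simpa using hτ)).fst
      have := Convex.is_const_of_fderivWithin_eq_zero (𝕜 := ℝ) (convex_ball (0 : ℝ) T)
        (fun τ hτ => (hd τ hτ).differentiableAt.differentiableWithinAt)
        (fun τ hτ => by
          rw [fderivWithin_of_isOpen Metric.isOpen_ball hτ]
          ext
          simpa using (hd τ hτ).deriv)
        (x := t) (y := 0) (by simpa using ht) (Metric.mem_ball_self hT)
      rw [this, hz.1]
    have h3 : HasDerivAt (fun τ => (Φ (τ, z)).2) (b (Φ (t, z))) (t + 0) := by
      rw [add_zero]
      exact (hz.2 t ht).snd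
    have h4 : HasDerivAt (fun h : ℝ => t + h) 1 0 := (hasDerivAt_id (0 : ℝ)).const_add t
    have h5 := HasDerivAt.scomp (h := fun h : ℝ => t + h) (0 : ℝ) h3 h4
    refine (h5.congr_deriv ?_)
    rw [one_smul]
    show b (Φ (t, z)) = b (z.1, (Φ (t, z)).2)
    rw [← hconst]

end Flow

/-! ### Local flows of vertical vector fields -/

section LocalFlows

variable {E M : Type*} [NormedAddCommGroup E] [NormedSpace ℝ E]
  [TopologicalSpace M] [ChartedSpace E M] {Y : FiberedManifold E M} {s : ℕ}

lemma FiberedManifold.smoothNear_id (y : Y.Total) : SmoothNear 𝓘(ℝ, Y.Model) (fun z => z) y :=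
  (contMDiff_id.contMDiffNear y).smoothNear

variable [FiniteDimensional ℝ E] [IsManifold 𝓘(ℝ, E) ∞ M]

/-- A smooth vertical vector field has a local flow along the fibres. -/
theorem exists_isLocalFlow {η : Y.Total → Y.V} (hη : DSmooth η)
    (hηY : ∀ y, VBundle.pt (η y) = y) (y₀ : Y.Total) :
    ∃ Fl, IsLocalFlow η Fl y₀ ∧
      ∀ᶠ p : ℝ × Y.Total in 𝓝 (0, y₀), Y.proj (Fl p.1 p.2) = Y.proj p.2 := by
  obtain ⟨m, C, hC, hcp⟩ := Y.exists_fibredChart y₀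
  obtain ⟨n, c, hc, -⟩ := exists_euclideanChart 𝓘(ℝ, E) (Y.proj y₀) univ_mem
  have hηc : SmoothTo 𝓘(ℝ, RSp m) fun y => vderiv Y.proj C.coord (η y) :=
    (smoothTo_vderiv C.smoothTo_coord).comp_dSmooth hη
  -- the vector field in coordinates
  have hb₀ : SmoothGerm (fun z : RSp n × RSp m =>
      vderiv Y.proj C.coord (η (C.param (c.inv z.1, z.2)))) (c.toFun (Y.proj y₀), C.coord y₀) := by
    refine ContMDiffNear.smoothGerm_prod (ContMDiffNear.comp (J := 𝓘(ℝ, E).prod 𝓘(ℝ, RSp m))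
      (g := fun z => vderiv Y.proj C.coord (η (C.param z)))
      (f := fun z : RSp n × RSp m => (c.inv z.1, z.2)) ?_ ?_)
    · simpa only [c.left_inv _ hc] using (C.smoothNear_param _ hC).smoothTo_comp hηc
    · exact ((c.contMDiff_inv.comp contMDiff_fst).prodMk contMDiff_snd).contMDiffNear _
  obtain ⟨b, hb, hbe⟩ := hb₀.exists_contDiff
  obtain ⟨β, hβ, hβ0, hβd⟩ := exists_smooth_flow_param b hb (c.toFun (Y.proj y₀), C.coord y₀)
  have hcoord : ContMDiffNear 𝓘(ℝ, Y.Model) 𝓘(ℝ, RSp m) C.coord y₀ :=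
    (FiberedManifold.smoothNear_id y₀).smoothTo_comp C.smoothTo_coord
  have hproj : ContMDiff 𝓘(ℝ, Y.Model) 𝓘(ℝ, E) ∞ Y.proj := Y.isSubmersion.contMDiff
  have hcπ : ContMDiffNear 𝓘(ℝ, Y.Model) 𝓘(ℝ, RSp n) (fun y => c.toFun (Y.proj y)) y₀ :=
    ContMDiffNear.comp (g := c.toFun) (c.contMDiffNear_toFun hc) (hproj.contMDiffNear _)
  have hz : ContMDiffNear 𝓘(ℝ, Y.Model) 𝓘(ℝ, RSp n × RSp m)
      (fun y => (c.toFun (Y.proj y), C.coord y)) y₀ := by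
    filter_upwards [hcπ, hcoord] with y h1 h2 using h1.prodMk_space h2
  have hw : ContMDiffNear (𝓘(ℝ, ℝ).prod 𝓘(ℝ, Y.Model)) 𝓘(ℝ, ℝ × (RSp n × RSp m))
      (fun p : ℝ × Y.Total => (p.1, (c.toFun (Y.proj p.2), C.coord p.2))) (0, y₀) := by
    have h1 : ContMDiffNear (𝓘(ℝ, ℝ).prod 𝓘(ℝ, Y.Model)) 𝓘(ℝ, RSp n × RSp m)
        (fun p : ℝ × Y.Total => (c.toFun (Y.proj p.2), C.coord p.2)) (0, y₀) :=
      ContMDiffNear.comp (g := fun y => (c.toFun (Y.proj y), C.coord y)) (f := Prod.snd) hz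
        (contMDiff_snd.contMDiffNear _)
    filter_upwards [h1] with p hp using contMDiffAt_fst.prodMk_space hp
  set B : ℝ × Y.Total → RSp m := fun p => β (p.1, (c.toFun (Y.proj p.2), C.coord p.2)) with hB
  have hBs : ContMDiffNear (𝓘(ℝ, ℝ).prod 𝓘(ℝ, Y.Model)) 𝓘(ℝ, RSp m) B (0, y₀) :=
    ContMDiffNear.comp (g := β) hβ.contMDiffNear hw
  have hB0 : B (0, y₀) = C.coord y₀ := hβ0.self_of_nhds
  have hπB : ContMDiffNear (𝓘(ℝ, ℝ).prod 𝓘(ℝ, Y.Model)) (𝓘(ℝ, E).prod 𝓘(ℝ, RSp m))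
      (fun p : ℝ × Y.Total => (Y.proj p.2, B p)) (0, y₀) :=
    ContMDiffNear.prodMk ((hproj.comp contMDiff_snd).contMDiffNear _) hBs
  have hπBt : Tendsto (fun p : ℝ × Y.Total => (Y.proj p.2, B p)) (𝓝 (0, y₀))
      (𝓝 (Y.proj y₀, C.coord y₀)) := by
    rw [← hB0]; exact hπB.continuousAt
  have hcB : Tendsto (fun p : ℝ × Y.Total => (c.toFun (Y.proj p.2), B p)) (𝓝 (0, y₀))
      (𝓝 (c.toFun (Y.proj y₀), C.coord y₀)) := by
    rw [← hB0]
    exact (hcπ.continuousAt.tendsto.comp (continuous_snd.tendsto ((0 : ℝ), y₀))).prodMk_nhds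
      hBs.continuousAt
  have hFl : SmoothNear (𝓘(ℝ, ℝ).prod 𝓘(ℝ, Y.Model))
      (fun p : ℝ × Y.Total => C.param (Y.proj p.2, B p)) (0, y₀) := by
    refine SmoothNear.comp_contMDiffNear (f := C.param) ?_ hπB
    show SmoothNear _ _ (Y.proj y₀, B (0, y₀))
    rw [hB0]
    exact C.smoothNear_param _ hC
  have hFl0 : C.param (Y.proj y₀, B (0, y₀)) ∈ C.source := by
    rw [hB0, C.param_coord _ hC]; exact hC
  have hsnd : Tendsto Prod.snd (𝓝 ((0 : ℝ), y₀)) (𝓝 y₀) := continuous_snd.tendsto _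
  refine ⟨fun t y => C.param (Y.proj y, B (t, y)), ⟨hFl, ?_, ?_⟩,
    hπBt.eventually (C.proj_param _ hC)⟩
  · filter_upwards [hz.continuousAt.eventually hβ0,
      (FiberedManifold.smoothNear_id y₀).eventually_mem C.isOpen_source hC] with y h1 h2
    show C.param (Y.proj y, β (0, (c.toFun (Y.proj y), C.coord y))) = y
    rw [h1, C.param_coord _ h2]
  · filter_upwards [hFl.eventually, (hπBt.eventually (C.proj_param _ hC)).eventually_nhds,
      (hπBt.eventually hcp).eventually_nhds, hFl.eventually_mem C.isOpen_source hFl0,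
      hw.continuousAt.eventually hβd, hcB.eventually hbe,
      hsnd.eventually (hproj.continuous.continuousAt (c.source_mem_nhds hc))]
      with ⟨t, y⟩ h1 h2 h3 h4 h5 h6 h7
    have hl : Tendsto (fun h : ℝ => (t + h, y)) (𝓝 0) (𝓝 (t, y)) := by
      have : Continuous fun h : ℝ => (t + h, y) := by fun_prop
      simpa using this.tendsto 0
    have hv : IsVerticalCurve Y.proj fun h => C.param (Y.proj y, B (t + h, y)) := by
      constructor
      · refine SmoothNear.comp_contMDiffNear
          (f := fun p : ℝ × Y.Total => C.param (Y.proj p.2, B p))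
          (g := fun h : ℝ => (t + h, y)) (by simpa using h1) ?_
        have h8 : ContDiff ℝ ∞ fun h : ℝ => t + h := by fun_prop
        exact (h8.contMDiff.prodMk contMDiff_const).contMDiffNear _
      · have h8 := hl.eventually h2
        filter_upwards [h8] with h hh
        rw [hh, h8.self_of_nhds]
    have hvel := hv.hasVelocity
    have hpt : VBundle.pt (η (C.param (Y.proj y, B (t, y)))) =
      C.param (Y.proj y, B (t, y)) := hηY _
    have hpt' := hvel.pt_eq
    rw [add_zero] at hpt'
    suffices h : η (C.param (Y.proj y, B (t, y))) = _ by
      show HasVelocity _ _ (η (C.param (Y.proj y, B (t, y))))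
      rw [h]; exact hvel
    refine C.vertical.eq_of_coord_eq ?_ ?_ ?_ (Prod.ext ?_ ?_)
    · show VBundle.pt _ ∈ C.source
      rw [hpt]; exact h4
    · show VBundle.pt _ ∈ C.source
      rw [hpt']; exact h4
    · rw [hpt, hpt']
    · show C.coord (VBundle.pt _) = C.coord (VBundle.pt _)
      rw [hpt, hpt']
    · show vderiv Y.proj C.coord _ = vderiv Y.proj C.coord _
      have h8 : (fun h => C.coord (C.param (Y.proj y, B (t + h, y)))) =ᶠ[𝓝 0]
          fun h => B (t + h, y) := by
        filter_upwards [hl.eventually h3] with h hh using hh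
      rw [hvel.vderiv_eq C.smoothTo_coord, h8.deriv_eq]
      have h9 : deriv (fun h => B (t + h, y)) 0 = b (c.toFun (Y.proj y), B (t, y)) := h5.deriv
      have h10 : b (c.toFun (Y.proj y), B (t, y)) =
        vderiv Y.proj C.coord (η (C.param (c.inv (c.toFun (Y.proj y)), B (t, y)))) := h6
      rw [h9, h10, c.left_inv _ h7]

end LocalFlows

/-! ### Flow prolongation -/

section FlowProlongation

variable {E M : Type*} [NormedAddCommGroup E] [NormedSpace ℝ E]
  [TopologicalSpace M] [ChartedSpace E M] {Y : FiberedManifold E M} {s : ℕ}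

lemma IsLocalFlow.hasVelocity {η : Y.Total → Y.V} {Fl : ℝ → Y.Total → Y.Total} {y₀ : Y.Total}
    (h : IsLocalFlow η Fl y₀) : ∀ᶠ y in 𝓝 y₀, HasVelocity Y.proj (fun t => Fl t y) (η y) := by
  have hc : Tendsto (fun y : Y.Total => ((0 : ℝ), y)) (𝓝 y₀) (𝓝 (0, y₀)) :=
    continuousAt_const.prodMk continuousAt_id
  filter_upwards [h.2.1, hc.eventually h.2.2] with y h1 h2
  simpa [h1] using h2

lemma dSmooth_insertField {r : ℕ} {h : s ≤ r} {Z : FiberedManifold E M} {φ : JVJ Y h → Z.Total}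
    (hφ : DSmooth φ) {X : ∀ j : Y.J s, {v : Y.VJ s // v.pt = j}}
    (hX : DSmooth fun j => (X j).1) : DSmooth (insertField φ X) := fun n p hp =>
  hφ n _ (show IsPlot (fun u => (⟨(p u, (X ((p u).res h)).1), (X ((p u).res h)).2.symm⟩ : JVJ Y h))
    from ⟨hp, hX n _ (dSmooth_jet_res h n p hp)⟩)

variable [FiniteDimensional ℝ E] [IsManifold 𝓘(ℝ, E) ∞ M]

/-- Under `ϰ_s`, the flow prolongation corresponds to the jet of `η ∘ σ`, as
`d/dt|₀ Fl_t(σ(y)) = η(σ(y))`. -/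
lemma kappaRel_flowProlongation {η : Y.Total → Y.V} (hη : DSmooth η)
    (hηY : ∀ y, VBundle.pt (η y) = y) {σ : M → Y.Total} {x : M} {j : Y.J s} {w : Y.JV s}
    (hj : HasJet E s Y.proj σ x j) (hw : HasJet E s Y.projV (fun y => η (σ y)) x w) :
    KappaRel (flowProlongation s η j).1 w := by
  have hsm : ∀ {σ : M → Y.Total} {Fl : ℝ → Y.Total → Y.Total}, HasJet E s Y.proj σ x j →
      IsLocalFlow η Fl (σ x) →
      ContMDiffNear (𝓘(ℝ, ℝ).prod 𝓘(ℝ, E)) (𝓘(ℝ, ℝ).prod 𝓘(ℝ, Y.Model))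
        (fun z : ℝ × M => (z.1, σ z.2)) (0, x) ∧
      SmoothNear (𝓘(ℝ, ℝ).prod 𝓘(ℝ, E)) (fun z : ℝ × M => Fl z.1 (σ z.2)) (0, x) := by
    intro σ Fl hσ hFl
    have h1 : ContMDiffNear (𝓘(ℝ, ℝ).prod 𝓘(ℝ, E)) (𝓘(ℝ, ℝ).prod 𝓘(ℝ, Y.Model))
        (fun z : ℝ × M => (z.1, σ z.2)) (0, x) :=
      ContMDiffNear.prodMk (contMDiff_fst.contMDiffNear _) (ContMDiffNear.comp (g := σ)
        (f := Prod.snd) (hσ.1.1.smoothTo_comp FiberedManifold.smoothTo_id)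
        (contMDiff_snd.contMDiffNear _))
    exact ⟨h1, SmoothNear.comp_contMDiffNear (f := fun z : ℝ × Y.Total => Fl z.1 z.2)
      (g := fun z : ℝ × M => (z.1, σ z.2)) hFl.1 h1⟩
  have hcont : ∀ {σ : M → Y.Total}, HasJet E s Y.proj σ x j → Tendsto σ (𝓝 x) (𝓝 (σ x)) :=
    fun hσ => (hσ.1.1.smoothTo_comp FiberedManifold.smoothTo_id).continuousAt
  have hex : ∃ v : {v : Y.VJ s // v.pt = j},
      ∃ (x : M) (σ : M → Y.Total) (Fl : ℝ → Y.Total → Y.Total) (γ : ℝ → Y.J s),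
        HasJet E s Y.proj σ x j ∧ IsLocalFlow η Fl (σ x) ∧
        (∀ᶠ t in 𝓝 (0 : ℝ), HasJet E s Y.proj (fun y => Fl t (σ y)) x (γ t)) ∧
        HasVelocity Jet.base γ v.1 := by
    obtain ⟨Fl, hFl, hFlπ⟩ := exists_isLocalFlow hη hηY (σ x)
    obtain ⟨h1, h2⟩ := hsm hj hFl
    have hsnd : Tendsto Prod.snd (𝓝 ((0 : ℝ), x)) (𝓝 x) := continuous_snd.tendsto _
    obtain ⟨γ, v, hγ, hv⟩ := exists_velocity_of_family (π := Y.proj)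
      (σ := fun t y => Fl t (σ y)) h2 (by
      filter_upwards [h1.continuousAt.eventually hFlπ, hsnd.eventually hj.1.2] with z hz hz'
      rw [hz, hz']) s
    refine ⟨⟨v, ?_⟩, x, σ, Fl, γ, hj, hFl, hγ, hv⟩
    rw [hv.pt_eq]
    refine hγ.self_of_nhds.unique (hj.congr ?_)
    exact (hcont hj).eventually hFl.2.1
  -- `𝒥^s η` is given by some representative `σ'` of the jet and some local flow
  obtain ⟨x', σ', Fl, γ, hσ', hFl, hγ, hv⟩ := Classical.epsilon_spec_aux inferInstance _ hex
  obtain rfl : x = x' := by rw [← hj.base_eq, hσ'.base_eq]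
  have hloc := (hσ'.1.map hη (πQ := Y.projV) fun y => by rw [FiberedManifold.projV, hηY]).hasJet s
  rw [← hj.map_unique hη hσ' hw hloc] at hloc
  exact ⟨x, fun t y => Fl t (σ' y), γ, fun y => η (σ' y), (hsm hσ' hFl).2, hγ, hv,
    (hcont hσ').eventually hFl.hasVelocity, hloc⟩

/-- In coordinates, `𝒥^s η` is given by the Taylor coefficients of the components of `η ∘ σ`. -/
lemma vderiv_flowProlongation {η : Y.Total → Y.V} (hη : DSmooth η)
    (hηY : ∀ y, VBundle.pt (η y) = y) {n m : ℕ} {G : Y.Total → RSp m} (hG : SmoothTo 𝓘(ℝ, RSp m) G)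
    (c : CutoffChart 𝓘(ℝ, E) M n) {j : Y.J s} (hj : j.base ∈ c.source) :
    vderiv Jet.base (jetCoord Y.proj c G) (flowProlongation s η j).1 =
      jetCoord Y.proj c (fun y => vderiv Y.proj G (η y)) j := by
  obtain ⟨σ, x, hσ⟩ := exists_hasJet j
  have hw := (hσ.1.map hη (πQ := Y.projV) fun y => by rw [FiberedManifold.projV, hηY]).hasJet s
  have h := kappaRel_flowProlongation hη hηY hσ hw
  rw [h.vderiv_jetCoord c (by rw [← h.base_eq, (flowProlongation s η j).2]; exact hj) hG]
  ext1 i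
  rw [hw.jetCoord_eq c (smoothTo_vderiv hG),
    hσ.jetCoord_eq c ((smoothTo_vderiv hG).comp_dSmooth hη)]

variable [T2Space M]

/-- In a chart, `𝒥^s η` has smooth coordinates. -/
lemma dSmooth_flowProlongation {η : Y.Total → Y.V} (hη : DSmooth η)
    (hηY : ∀ y, VBundle.pt (η y) = y) : DSmooth fun j : Y.J s => (flowProlongation s η j).1 := by
  intro N p hp
  refine isPlot_of_smoothNear fun u₀ => ?_
  obtain ⟨m, C, hC, -⟩ := Y.exists_fibredChart (p u₀).val
  obtain ⟨n, c, hc⟩ := exists_cutoffChart 𝓘(ℝ, E) (p u₀).base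
  set D := (C.jet c (p u₀)) with hD
  have hsrc : p u₀ ∈ D.source := ⟨hc, hC⟩
  have hpn := hp.smoothNear u₀
  have hηG := (smoothTo_vderiv C.smoothTo_coord).comp_dSmooth hη
  have hg : ContMDiffNear 𝓘(ℝ, RSp N) (𝓘(ℝ, E).prod
      𝓘(ℝ, JetCoord (RSp n) (RSp m) s × JetCoord (RSp n) (RSp m) s))
      (fun u => ((p u).base, (jetCoord Y.proj c C.coord (p u),
        jetCoord Y.proj c (fun y => vderiv Y.proj C.coord (η y)) (p u)))) u₀ :=
    (hpn.smoothTo_comp smoothTo_jet_base).prodMk (hpn.smoothTo_comp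
      ((smoothTo_jetCoord c C.smoothTo_coord).prodMk_space (smoothTo_jetCoord c hηG)))
  refine SmoothNear.congr (SmoothNear.comp_contMDiffNear (f := D.vertical.param)
    (D.smoothNear_velocity_line hsrc _) hg) ?_
  filter_upwards [hpn.eventually_mem D.isOpen_source hsrc] with u hu
  have h1 := D.vertical.param_coord (flowProlongation s η (p u)).1
    (by show VBundle.pt _ ∈ D.source; rw [(flowProlongation s η (p u)).2]; exact hu)
  rw [← vderiv_flowProlongation hη hηY C.smoothTo_coord c (c.core_subset hu.1)]
  refine h1.symm.trans ?_
  have h2 : D.vertical.coord (flowProlongation s η (p u)).1 =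
      (jetCoord Y.proj c C.coord (flowProlongation s η (p u)).1.pt,
        vderiv Jet.base (jetCoord Y.proj c C.coord) (flowProlongation s η (p u)).1) := rfl
  rw [h2, (flowProlongation s η (p u)).2]

end FlowProlongation

/-! ### Holonomic prolongation -/

section HolonomicProlongation

variable {E M : Type*} [NormedAddCommGroup E] [NormedSpace ℝ E] [FiniteDimensional ℝ E]
  [TopologicalSpace M] [T2Space M] [ChartedSpace E M] [IsManifold 𝓘(ℝ, E) ∞ M]
  {Y Z : FiberedManifold E M} {k r s : ℕ} {h : s ≤ r}

/-- The `k`-jet of `φ(S, ϰ_s⁻¹ ∘ S')` depends only on the `k`-jets of `S` and `S'`, since the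
coordinates of the pair `(S, ϰ_s⁻¹ ∘ S')` are smooth functions of `S` and of `S'`. -/
lemma HasJet.eq_of_kappaRel {φ : JVJ Y h → Z.Total} (hφ : DSmooth φ) {x : M}
    {a : Jet E k (Jet.base : Y.J r → M)} {b : Jet E k (Jet.base : Y.JV s → M)}
    {S₁ S₂ : M → Y.J r} {S₁' S₂' : M → Y.JV s} {p₁ p₂ : M → JVJ Y h} {c₁ c₂ : Z.J k}
    (hS₁ : HasJet E k Jet.base S₁ x a) (hS₂ : HasJet E k Jet.base S₂ x a)
    (hS₁' : HasJet E k Jet.base S₁' x b) (hS₂' : HasJet E k Jet.base S₂' x b)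
    (hp₁ : ∀ᶠ y in 𝓝 x, (p₁ y).1.1 = S₁ y ∧ KappaRel (p₁ y).1.2 (S₁' y))
    (hp₂ : ∀ᶠ y in 𝓝 x, (p₂ y).1.1 = S₂ y ∧ KappaRel (p₂ y).1.2 (S₂' y))
    (h₁ : HasJet E k Z.proj (fun y => φ (p₁ y)) x c₁)
    (h₂ : HasJet E k Z.proj (fun y => φ (p₂ y)) x c₂) : c₁ = c₂ := by
  have hS0 : S₁ x = S₂ x := (hS₁.contact hS₂).2.1
  have hS0' : S₁' x = S₂' x := (hS₁'.contact hS₂').2.1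
  have hp0 : p₁ x = p₂ x := by
    obtain ⟨e1, k1⟩ := hp₁.self_of_nhds
    obtain ⟨e2, k2⟩ := hp₂.self_of_nhds
    rw [← hS0'] at k2
    exact Subtype.ext (Prod.ext (by rw [e1, e2, hS0]) (k1.left_unique k2))
  obtain ⟨m, D, hD, -⟩ := Z.exists_fibredChart (φ (p₁ x))
  obtain ⟨m', C, hC, -⟩ := Y.exists_fibredChart (S₁ x).val
  obtain ⟨n, c, hc⟩ := exists_cutoffChart 𝓘(ℝ, E) x
  have hcs := c.core_subset hc
  have hbase : ∀ {S : M → Y.J r}, HasJet E k Jet.base S x a → ∀ᶠ y in 𝓝 x, (S y).base = y :=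
    fun hS => hS.1.2
  set B := C.jetPullback c (S₁ x) h
  have hsrc : S₁ x ∈ (C.jet c (S₁ x)).source :=
    ⟨by rw [mem_preimage, (hbase hS₁).self_of_nhds]; exact hc, hC⟩
  have hG := D.smoothTo_coord.comp_dSmooth hφ
  have hV := smoothTo_jetCoord (r := s) (π := Y.projV) c
    (smoothTo_vderiv (π := Y.proj) C.smoothTo_coord)
  have hJ := smoothTo_jetCoord (r := r) (π := Y.proj) c C.smoothTo_coord
  have hcoord : ∀ {S : M → Y.J r} {S' : M → Y.JV s} {p : M → JVJ Y h},
      HasJet E k Jet.base S x a → HasJet E k Jet.base S' x b →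
      (∀ᶠ y in 𝓝 x, (p y).1.1 = S y ∧ KappaRel (p y).1.2 (S' y)) →
      ∀ᶠ y in 𝓝 x, B.coord (p y) = (jetCoord Y.proj c C.coord (S y),
        jetCoord Y.projV c (vderiv Y.proj C.coord) (S' y)) := by
    intro S S' p hS hS' hp
    filter_upwards [hp, hS'.1.2, c.source_mem_nhds hcs] with y ⟨e, hk⟩ hy' hy
    refine Prod.ext (congrArg (jetCoord Y.proj c C.coord) e)
      (hk.vderiv_jetCoord c ?_ C.smoothTo_coord)
    rw [hy']; exact hy
  have hlim : ∀ {S : M → Y.J r} {S' : M → Y.JV s} {p : M → JVJ Y h},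
      HasJet E k Jet.base S x a → HasJet E k Jet.base S' x b →
      (∀ᶠ y in 𝓝 x, (p y).1.1 = S y ∧ KappaRel (p y).1.2 (S' y)) →
      Tendsto (fun y => B.coord (p y)) (𝓝 x) (𝓝 (B.coord (p x))) := by
    intro S S' p hS hS' hp
    have h0 := hcoord hS hS' hp
    rw [h0.self_of_nhds]
    refine Tendsto.congr' (h0.mono fun y hy => hy.symm) (Tendsto.prodMk_nhds ?_ ?_)
    · exact (hS.1.1.smoothTo_comp hJ).continuousAt
    · exact (hS'.1.1.smoothTo_comp hV).continuousAt
  have hmem : ∀ {S : M → Y.J r} {S' : M → Y.JV s} {p : M → JVJ Y h},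
      HasJet E k Jet.base S x a → S x = S₁ x →
      (∀ᶠ y in 𝓝 x, (p y).1.1 = S y ∧ KappaRel (p y).1.2 (S' y)) →
      ∀ᶠ y in 𝓝 x, p y ∈ B.source ∧ (p y).1.1.base = y := by
    intro S S' p hS hS0 hp
    filter_upwards [hp, hS.1.1.eventually_mem (C.jet c (S₁ x)).isOpen_source (hS0 ▸ hsrc),
      hbase hS] with y ⟨e, _⟩ hy hy'
    refine ⟨?_, by rw [e, hy']⟩
    show (p y).1.1 ∈ (C.jet c (S₁ x)).source
    rw [e]
    exact hy
  have hm₁ := hmem hS₁ rfl hp₁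
  have hm₂ := hmem hS₂ hS0.symm hp₂
  refine h₁.eq_of_coord_isBigO D c.toEuclideanChart hcs h₂ (congrArg φ hp0) hD ?_
  have hO := B.sub_isBigO_coord_sub (L := 𝓝 x) (q := p₁ x) hm₁.self_of_nhds.1
    (hm₁.mono fun _ hy => hy.1) (hm₂.mono fun _ hy => hy.1)
    (by filter_upwards [hm₁, hm₂] with y h1 h2 using h1.2.trans h2.2.symm)
    (Tendsto.congr' (hm₁.mono fun _ hy => hy.2.symm)
      (by rw [hm₁.self_of_nhds.2]; exact tendsto_id))
    (hlim hS₁ hS₁' hp₁) (by rw [hp0]; exact hlim hS₂ hS₂' hp₂) hG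
  refine hO.trans ?_
  refine ((hS₁.sub_isBigO c.toEuclideanChart hcs hS₂ hJ).prod_left
    (hS₁'.sub_isBigO c.toEuclideanChart hcs hS₂' hV)).congr' ?_ .rfl
  filter_upwards [hcoord hS₁ hS₁' hp₁, hcoord hS₂ hS₂' hp₂] with y e1 e2
  rw [e1, e2]
  rfl

/-- `J^k_hol` of `φ ∘ (id × ϰ_s⁻¹)` is computed on representatives. -/
lemma HasJet.jetMap₂_eq {φ : JVJ Y h → Z.Total} (hφ : DSmooth φ) {x : M}
    {a : Jet E k (Jet.base : Y.J r → M)} {b : Jet E k (Jet.base : Y.JV s → M)}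
    {S : M → Y.J r} {S' : M → Y.JV s} {p : M → JVJ Y h} {c : Z.J k}
    (hS : HasJet E k Jet.base S x a) (hS' : HasJet E k Jet.base S' x b)
    (hp : ∀ᶠ y in 𝓝 x, (p y).1.1 = S y ∧ KappaRel (p y).1.2 (S' y))
    (hc : HasJet E k Z.proj (fun y => φ (p y)) x c) :
    jetMap₂ k (φ ∘ idKappaInv h) a b = c := by
  obtain ⟨x', S₁, S₁', T, h1, h2, h3, h4⟩ := Classical.epsilon_spec_aux (Z.nonempty_J k a.base)
    (fun c : Z.J k => ∃ (x : M) (S : M → Y.J r) (S' : M → Y.JV s) (T : M → Z.Total),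
      HasJet E k Jet.base S x a ∧ HasJet E k Jet.base S' x b ∧ HasJet E k Z.proj T x c ∧
      ∀ᶠ y in 𝓝 x, ∃ h' : (S y).res h = projJV Y s (S' y),
        T y = (φ ∘ idKappaInv h) ⟨(S y, S' y), h'⟩)
    ⟨c, x, S, S', fun y => φ (p y), hS, hS', hc, by
      filter_upwards [hp] with y ⟨e, hk⟩
      refine ⟨by rw [hk.projJV_eq, ← e]; exact (p y).2, congrArg φ (Subtype.ext (Prod.ext e ?_))⟩
      exact hk.kappaInv_eq.symm⟩
  obtain rfl : x = x' := by rw [← hS.base_eq, h1.base_eq]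
  -- near `x`, the sections `S₁` and `S₁'` define a section `p₁` of the fibre product; elsewhere its
  -- values are irrelevant
  classical
  set p₁ : M → JVJ Y h := fun y =>
    if h' : (S₁ y).res h = projJV Y s (S₁' y) then idKappaInv h ⟨(S₁ y, S₁' y), h'⟩ else p y
  refine HasJet.eq_of_kappaRel hφ (p₁ := p₁) h1 hS h2 hS' ?_ hp (h3.congr ?_) hc
  · filter_upwards [h4] with y ⟨h', _⟩
    rw [show p₁ y = idKappaInv h ⟨(S₁ y, S₁' y), h'⟩ from dif_pos h']
    exact ⟨rfl, kappaRel_kappaInv _⟩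
  · filter_upwards [h4] with y ⟨h', e⟩
    rw [e]
    exact congrArg φ (dif_pos h')

end HolonomicProlongation

theorem proposition1p1 {E M : Type*} [NormedAddCommGroup E] [NormedSpace ℝ E]
    [FiniteDimensional ℝ E] [TopologicalSpace M] [T2Space M] [ChartedSpace E M]
    [IsManifold 𝓘(ℝ, E) ∞ M]
    (Y Z : FiberedManifold E M) (k r s : ℕ) (h : s ≤ r)
    (φ : JVJ Y h → Z.Total) (hφ : DSmooth φ) (hφM : ∀ p, Z.proj (φ p) = Jet.base p.1.1)
    (η : Y.Total → Y.V) (hη : DSmooth η) (hηY : ∀ y, VBundle.pt (η y) = y) :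
    insertField (holProlongation k φ) (flowProlongation (k + s) η) =
      jetHol k (insertField φ (flowProlongation s η)) := by
  funext a
  obtain ⟨σ, x, hσ⟩ := exists_hasJet a
  have hησ : IsLocalSection E Y.projV (fun y => η (σ y)) x :=
    hσ.1.map hη fun y => by rw [FiberedManifold.projV, hηY]
  obtain ⟨m, C, hC, -⟩ := Y.exists_fibredChart (σ x)
  set S := jetSection r ⟨x, σ, hσ.1⟩
  set S' := jetSection s ⟨x, fun y => η (σ y), hησ⟩
  have hSy : ∀ᶠ y in 𝓝 x, HasJet E r Y.proj σ y (S y) :=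
    hσ.1.eventually.mono fun y hy => hasJet_jetSection r ⟨x, σ, hσ.1⟩ hy
  have hSy' : ∀ᶠ y in 𝓝 x, HasJet E s Y.projV (fun y => η (σ y)) y (S' y) :=
    hησ.eventually.mono fun y hy => hasJet_jetSection s ⟨x, _, hησ⟩ hy
  have hS : HasJet E k Jet.base S x (jetIncl k r a) :=
    hσ.hasJet_jetIncl C hC hSy (isLocalSection_jetSection r ⟨x, σ, hσ.1⟩)
  have hb : HasJet E (k + s) Y.projV (fun y => η (σ y)) x
      (kappa Y (k + s) (flowProlongation (k + s) η (a.res (Nat.add_le_add_left h k))).1) := by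
    have h1 := hησ.hasJet (k + s)
    rwa [← (kappaRel_flowProlongation hη hηY (hσ.res (Nat.add_le_add_left h k)) h1).kappa_eq]
      at h1
  have hS' := hb.hasJet_jetIncl C.vertical
    (show VBundle.pt (η (σ x)) ∈ C.source by rw [hηY]; exact hC) hSy'
    (isLocalSection_jetSection s ⟨x, _, hησ⟩)
  refine HasJet.jetMap₂_eq hφ (p := fun y => ⟨(S y, (flowProlongation s η ((S y).res h)).1),
    (flowProlongation s η ((S y).res h)).2.symm⟩) hS hS' ?_
    (hasJet_jetMap (dSmooth_insertField hφ (dSmooth_flowProlongation hη hηY)) (fun j => hφM _) hS)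
  filter_upwards [hSy, hSy'] with y hy hy'
  exact ⟨rfl, kappaRel_flowProlongation hη hηY (hy.res h) hy'⟩

end
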